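/- Write $\log_+x:=\max\{1,\log x\}$. For a finite group $G$ of order $N$, a symmetric subset $S=S^{-1}\subseteq G$ and a symmetric weight function $w:S\to\mathbb{R}_{\ge 0}$ (that is, $w(s)=w(s^{-1})$ for all $s\in S$), let $\mathrm{Cay}(G,S,w)$ be the weighted graph on the vertex set $G$ in which $g,h$ are adjacent iff $g^{-1}h\in S$, with edge weight $w(g^{-1}h)$; let $\mathrm{Cay}(G,S)$ be the case $w\equiv 1$. The Laplacian of a weighted graph is the diagonal matrix of weighted degrees minus the weighted adjacency matrix. For real symmetric matrices, $A\approx_\varepsilon B$ means that $A-(1-\varepsilon)B$ and $(1+\varepsilon)B-A$ are positive semidefinite. **Theorem.** There is an absolute constant $C>0$ such that the following holds. (1) For every finite group $G$ of order $N$, every symmetric subset $S\subseteq G$ that generates $G$, and every $\varepsilon\in(0,1)$, there is a symmetric weight function $\mu:S\to\mathbb{R}_{\ge 0}$ such that $$|\mathrm{supp}(\mu)|\le C\,\varepsilon^{-2}(\log_+ N)^3\log_+|S|,\qquad |\mathrm{supp}(\mu)|\le C\,\varepsilon^{-2}(\log_+N)^4,\qquad L'\approx_\varepsilon L,$$ where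 $L$ is the Laplacian of $\mathrm{Cay}(G,S)$ and $L'$ is the Laplacian of $\mathrm{Cay}(G,S,\mu)$. (2) Such a $\mu$ is computable in randomized $\mathrm{poly}(N)$ time: there are a single randomized program and constants $c,d\in\mathbb N$ such that for all $G,S,\varepsilon$ as in (1) and every numbering of the elements of $G$ by $0,\dots,N-1$, the program, given $N$, the multiplication table of $G$, the indicator function of $S$, and $\varepsilon$ through random access to its binary truncations $\lfloor 2^i\varepsilon\rfloor$, $i\ge 0$, halts for all outcomes of its coin tosses within time $cN^d$ and, with probability at least $1-e^{-N}$, outputs (as fractions of integers) the values of a symmetric weight function $\mu:S\to\mathbb{R}_{\ge 0}$ with all the properties in (1). Here programs are random access programs over integer memory, with integer arithmetic, branching, loops and fair coin tosses, and running time is measured by the logarithmic cost criterion (each operation is charged the bit lengths of the numbers and addresses it handles). -/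

import Mathlib

open MeasureTheory
open scoped NNReal

universe u

/-! ## Weighted Cayley graphs and their Laplacians -/

/-- `max {1, log x}`, the reading of `log` inside `O(·)`. -/
noncomputable def logOne (x : ℝ) : ℝ := max 1 (Real.log x)

/-- The Laplacian `D - W` of the weighted graph whose edge `{i, j}` has weight `W i j`
(loops contribute nothing). -/
def weightedLaplacian {V : Type u} [Fintype V] [DecidableEq V] (W : Matrix V V ℝ) :
    Matrix V V ℝ :=
  Matrix.diagonal (fun i => ∑ j, W i j) - W

/-- The weighted adjacency matrix of `Cay(G, S, w)`: the pair `(g, h)` is adjacent iff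
`g⁻¹ * h ∈ S`, and the edge then has weight `w (g⁻¹ * h)`. -/
def cayleyAdjacency {G : Type u} [Group G] [DecidableEq G] (S : Finset G) (w : S → ℝ≥0) :
    Matrix G G ℝ :=
  Matrix.of fun g h => if hs : g⁻¹ * h ∈ S then (w ⟨g⁻¹ * h, hs⟩ : ℝ) else 0

/-- The Laplacian of `Cay(G, S, w)`. The unweighted graph `Cay(G, S)` is the case `w = 1`. -/
def cayleyLaplacian {G : Type u} [Group G] [Fintype G] [DecidableEq G] (S : Finset G)
    (w : S → ℝ≥0) : Matrix G G ℝ :=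
  weightedLaplacian (cayleyAdjacency S w)

/-- `A ≈_ε B`, i.e. `(1 - ε) B ⪯ A ⪯ (1 + ε) B` in the positive semidefinite order. -/
def SpectralApprox {V : Type u} [Fintype V] (ε : ℝ) (A B : Matrix V V ℝ) : Prop :=
  (A - (1 - ε) • B).PosSemidef ∧ ((1 + ε) • B - A).PosSemidef

/-- `μ` is a symmetric weighting of `S` whose weighted Cayley graph is an `ε`-sparsifier of
`Cay(G, S)`, with support size `O(ε⁻² log³ N log |S|)` and `O(ε⁻² log⁴ N)`, where `C` is the
constant in both bounds. -/
structure IsCayleySparsifier {G : Type u} [Group G] [Fintype G] [DecidableEq G] (C : ℝ)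
    (S : Finset G) (ε : ℝ) (μ : S → ℝ≥0) : Prop where
  symmetric : ∀ s t : S, (t : G) = (s : G)⁻¹ → μ t = μ s
  support_le : ((Function.support μ).ncard : ℝ) ≤
    C * (ε⁻¹ ^ 2 * logOne (Fintype.card G) ^ 3 * logOne S.card)
  support_le' : ((Function.support μ).ncard : ℝ) ≤
    C * (ε⁻¹ ^ 2 * logOne (Fintype.card G) ^ 4)
  approx : SpectralApprox ε (cayleyLaplacian S μ) (cayleyLaplacian S 1)

/-! ## Randomized random access programs with logarithmic cost

Programs of a small imperative language over integer arrays. Every operation is charged the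
bit lengths of the numbers (values and addresses) it handles, so that running times are
polynomially related to those of probabilistic Turing machines. -/

/-- Memory: cell `i` of array number `a` holds the integer `m a i`. -/
abbrev Mem := ℕ → ℤ → ℤ

/-- Writing a value into one cell. -/
def Mem.set (m : Mem) (a : ℕ) (i v : ℤ) : Mem :=
  fun b j => if b = a ∧ j = i then v else m b j

/-- Length of the signed binary representation of an integer (at least `1`). -/
def bitLength (z : ℤ) : ℕ := z.natAbs.size + 1

inductive Expr where
  | const (n : ℤ)
  | get (a : ℕ) (i : Expr)
  | add (x y : Expr)
  | sub (x y : Expr)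
  | mul (x y : Expr)
  | div (x y : Expr)

/-- The value of an expression; `div` is integer division with remainder, and gives `0` when
the divisor is `0`. -/
def Expr.eval (m : Mem) : Expr → ℤ
  | .const n => n
  | .get a i => m a (i.eval m)
  | .add x y => x.eval m + y.eval m
  | .sub x y => x.eval m - y.eval m
  | .mul x y => x.eval m * y.eval m
  | .div x y => x.eval m / y.eval m

/-- The cost of evaluating an expression: the sum of the bit lengths of the values of all its
subexpressions (addresses included). -/
def Expr.cost (m : Mem) : Expr → ℕ
  | .const n => bitLength n
  | .get a i => i.cost m + bitLength (m a (i.eval m))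
  | .add x y => x.cost m + y.cost m + bitLength (x.eval m + y.eval m)
  | .sub x y => x.cost m + y.cost m + bitLength (x.eval m - y.eval m)
  | .mul x y => x.cost m + y.cost m + bitLength (x.eval m * y.eval m)
  | .div x y => x.cost m + y.cost m + bitLength (x.eval m / y.eval m)

inductive Prog where
  /-- `a[i] := e` -/
  | assign (a : ℕ) (i e : Expr)
  /-- `a[i] :=` a fair random bit -/
  | flip (a : ℕ) (i : Expr)
  | seq (p q : Prog)
  /-- `if e > 0 then p else q` -/
  | ifPos (e : Expr) (p q : Prog)
  /-- `while e > 0 do p` -/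
  | whilePos (e : Expr) (p : Prog)

/-- `Exec ω p m k m' k' t`: with coin tosses `ω`, the program `p`, started in memory `m` when
`k` coins have been used, halts in memory `m'` with `k'` coins used, after time `t`. -/
inductive Exec (ω : ℕ → Bool) : Prog → Mem → ℕ → Mem → ℕ → ℕ → Prop
  | assign (a : ℕ) (i e : Expr) (m : Mem) (k : ℕ) :
      Exec ω (.assign a i e) m k (m.set a (i.eval m) (e.eval m)) k (i.cost m + e.cost m)
  | flip (a : ℕ) (i : Expr) (m : Mem) (k : ℕ) :
      Exec ω (.flip a i) m k (m.set a (i.eval m) (if ω k then 1 else 0)) (k + 1)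
        (i.cost m + 1)
  | seq {p q : Prog} {m₀ m₁ m₂ : Mem} {k₀ k₁ k₂ t₁ t₂ : ℕ} :
      Exec ω p m₀ k₀ m₁ k₁ t₁ → Exec ω q m₁ k₁ m₂ k₂ t₂ →
      Exec ω (.seq p q) m₀ k₀ m₂ k₂ (t₁ + t₂)
  | ifPos_pos {e : Expr} {p q : Prog} {m m' : Mem} {k k' t : ℕ} :
      0 < e.eval m → Exec ω p m k m' k' t →
      Exec ω (.ifPos e p q) m k m' k' (e.cost m + t)
  | ifPos_nonpos {e : Expr} {p q : Prog} {m m' : Mem} {k k' t : ℕ} :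
      e.eval m ≤ 0 → Exec ω q m k m' k' t →
      Exec ω (.ifPos e p q) m k m' k' (e.cost m + t)
  | whilePos_pos {e : Expr} {p : Prog} {m₀ m₁ m₂ : Mem} {k₀ k₁ k₂ t₁ t₂ : ℕ} :
      0 < e.eval m₀ → Exec ω p m₀ k₀ m₁ k₁ t₁ →
      Exec ω (.whilePos e p) m₁ k₁ m₂ k₂ t₂ →
      Exec ω (.whilePos e p) m₀ k₀ m₂ k₂ (e.cost m₀ + t₁ + t₂)
  | whilePos_nonpos {e : Expr} {p : Prog} {m : Mem} {k : ℕ} :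
      e.eval m ≤ 0 → Exec ω (.whilePos e p) m k m k (e.cost m)

/-- The law of an infinite sequence of independent fair coin tosses. -/
noncomputable def coinMeasure : Measure (ℕ → Bool) :=
  Measure.infinitePi fun _ : ℕ => (PMF.uniformOfFintype Bool).toMeasure

/-- The memory `m` holds the input `(G, S, ε)`, where the elements of `G` are numbered by `e`:
array `0` holds the order of `G`, array `1` the multiplication table, array `2` the indicator
function of `S`, array `3` the real number `ε` through its binary truncations `⌊2 ^ i * ε⌋`;
all further arrays are blank. -/
structure IsInput {G : Type u} [Group G] [Fintype G] [DecidableEq G]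
    (e : G ≃ Fin (Fintype.card G)) (S : Finset G) (ε : ℝ) (m : Mem) : Prop where
  order : m 0 0 = Fintype.card G
  table : ∀ g h : G, m 1 ((e g : ℕ) * Fintype.card G + (e h : ℕ)) = (e (g * h) : ℕ)
  gens : ∀ g : G, m 2 (e g : ℕ) = if g ∈ S then 1 else 0
  eps : ∀ i : ℕ, m 3 i = ⌊2 ^ i * ε⌋
  blank : ∀ a : ℕ, 4 ≤ a → ∀ i : ℤ, m a i = 0

/-- The memory `m` holds the weighting `μ` of `S` as output: array `4` holds the numerators of
the weights, array `5` the (positive) denominators. -/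
def IsOutput {G : Type u} [Fintype G] (e : G ≃ Fin (Fintype.card G)) (S : Finset G)
    (μ : S → ℝ≥0) (m : Mem) : Prop :=
  ∀ s : S, 0 < m 5 (e s : ℕ) ∧ (μ s : ℝ) = (m 4 (e s : ℕ) : ℝ) / (m 5 (e s : ℕ) : ℝ)

/-! ### Trace and order inequalities for real symmetric matrices. -/

section MatrixAnalysis

set_option linter.unusedSectionVars false

open Matrix
open scoped MatrixOrder

variable {n : Type*} [Fintype n] [DecidableEq n]

/-! ## The Lieb–Thirring trace inequality for exponents that are powers of two -/

/-! Let E_g(x) = Σ_h (x(h) - x(hg))² and let T be the matrix of the quadratic form Σ_{s ∈ S} E_s,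
which is twice the Laplacian of Cay(G, S). A signed combination of the E_s is small relative to T
once its matrix, normalized by an approximate inverse of T, has small norm.

Group structure makes most generators unimportant. The square root of E is subadditive under
products. Take a maximal T₀ ⊆ S that admits 2^|T₀| group elements of controlled energy, as the
subset products of T₀ would be. Then |T₀| ≤ log₂ N, and every generator is a quotient of two of
these elements, so its energy is O(log N) times the energy of T₀. Peeling off such sets repeatedly
puts s into a layer c(s) with c(s) E_s ≤ O(log N) Σ_{t ∈ S} E_t (`exists_layering`). Layers have
O(log N) elements, so Σ 1/c(s) = O(log N log |S|) by the harmonic sum (`sum_inv_layer_le`). Sampling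
s with probability proportional to 1/c(s), with weight inverse to that probability, gives increments
of mean T and relative norm O(log² N log |S|). By the matrix Chernoff heuristic, K = O(ε⁻² log³ N
log |S|) rounds then suffice.

The sampling is derandomized by conditional expectations. The potential is tr (1 + Y/2)^p + tr (1 -
Y/2)^p, where Y is the normalized deviation, p is of order ε⁻¹ log N, and p is a power of two. For
such p the Lieb–Thirring inequality has an elementary inductive proof. Together with a second-order
expansion it shows that a random round multiplies the potential by at most 1 + O(log N)/K on average
(`exists_potential_add_le`), so some candidate does at least as well and the greedy choice also
does. After K rounds the potential is still N^{O(1)}, which forces |Y| to be of order ε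
(`le_of_potential_le`).

All of this can be done in integers. A truncated Neumann series Q replaces the inverse of T; the
crude spectral gap of order N⁻³ makes 2N³ terms enough (`cayleyPreconditioner_spec`). The square
root of Q appears only in the analysis, because 1 + cQL and 1 + cQ^{1/2}LQ^{1/2} are similar
(`trace_precond_pow`). Clearing denominators leaves integer matrix arithmetic.

The algorithm is a deterministic program of counting loops. Its steps are polynomially many because
the loop bounds are. Its numbers have polynomial bit length because arrays are graded by levels and
an iterated array enters its own update only linearly (`cost_le_of_leveled`). When ε is of order 1/N
or less, the trivial weights 1 are already sparse enough. Existence of the sparsifier is read off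
from the output, and the success probability is 1. -/

theorem trace_mul_pow_comm (A B : Matrix n n ℝ) (k : ℕ) :
    ((A * B) ^ k).trace = ((B * A) ^ k).trace := by
  rcases k with _ | k
  · simp
  · have h : ∀ j : ℕ, (A * B) ^ j * A = A * (B * A) ^ j := by
      intro j
      induction j with
      | zero => simp
      | succ j ih => rw [pow_succ', mul_assoc, ih, pow_succ']; simp only [mul_assoc]
    rw [pow_succ, ← mul_assoc, h, trace_mul_comm, ← mul_assoc, ← pow_succ']

theorem trace_mul_le_frobenius (A B : Matrix n n ℝ) :
    (Aᵀ * B).trace ≤ ((Aᵀ * A).trace + (Bᵀ * B).trace) / 2 := by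
  have h := (posSemidef_conjTranspose_mul_self (A - B)).trace_nonneg
  have hc : (Bᵀ * A).trace = (Aᵀ * B).trace := by
    rw [← trace_transpose, transpose_mul, transpose_transpose]
  rw [conjTranspose_eq_transpose_of_trivial, transpose_sub, sub_mul, mul_sub, mul_sub, trace_sub,
    trace_sub, trace_sub, hc] at h
  linarith

theorem transpose_pow_of_symm {A : Matrix n n ℝ} (hA : Aᵀ = A) (k : ℕ) : (A ^ k)ᵀ = A ^ k := by
  rw [transpose_pow, hA]

/-- The two inequalities feed each other. Lieb–Thirring at k + 1 follows from the first inequality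
for AB and from Lieb–Thirring at k for A², B². The first inequality at k + 1 applies its level k to
X²; up to cyclic order the result is a power of (XᵀX)(XXᵀ), which Lieb–Thirring splits. The
Frobenius inequality then finishes, since XᵀX and XXᵀ have equal traces of powers. Only symmetry of
A and B is needed, not positivity. -/
theorem trace_pow_two_pow_le_and_liebThirring (k : ℕ) :
    (∀ X : Matrix n n ℝ, (X ^ 2 ^ (k + 1)).trace ≤ ((Xᵀ * X) ^ 2 ^ k).trace) ∧
    (∀ A B : Matrix n n ℝ, Aᵀ = A → Bᵀ = B →
      ((A * B) ^ 2 ^ k).trace ≤ (A ^ 2 ^ k * B ^ 2 ^ k).trace) := by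
  induction k with
  | zero =>
    refine ⟨fun X => ?_, fun A B _ _ => by simp⟩
    have h := trace_mul_le_frobenius Xᵀ X
    rw [transpose_transpose, trace_mul_comm X Xᵀ] at h
    simp only [zero_add, pow_one, pow_zero, pow_two]
    linarith
  | succ k ih =>
    obtain ⟨ihW, ihL⟩ := ih
    have hL : ∀ A B : Matrix n n ℝ, Aᵀ = A → Bᵀ = B →
        ((A * B) ^ 2 ^ (k + 1)).trace ≤ (A ^ 2 ^ (k + 1) * B ^ 2 ^ (k + 1)).trace := by
      intro A B hA hB
      have hA2 : (A ^ 2)ᵀ = A ^ 2 := transpose_pow_of_symm hA 2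
      have hB2 : (B ^ 2)ᵀ = B ^ 2 := transpose_pow_of_symm hB 2
      calc ((A * B) ^ 2 ^ (k + 1)).trace ≤ (((A * B)ᵀ * (A * B)) ^ 2 ^ k).trace := ihW _
        _ = ((A ^ 2 * B ^ 2) ^ 2 ^ k).trace := by
          rw [transpose_mul, hA, hB, pow_two A, pow_two B, mul_assoc B A, trace_mul_pow_comm]
          simp only [mul_assoc]
        _ ≤ ((A ^ 2) ^ 2 ^ k * (B ^ 2) ^ 2 ^ k).trace := ihL _ _ hA2 hB2
        _ = _ := by rw [← pow_mul, ← pow_mul, ← pow_succ']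
    refine ⟨fun X => ?_, hL⟩
    have hP : (Xᵀ * X)ᵀ = Xᵀ * X := by rw [transpose_mul, transpose_transpose]
    have hR : (X * Xᵀ)ᵀ = X * Xᵀ := by rw [transpose_mul, transpose_transpose]
    calc (X ^ 2 ^ (k + 2)).trace = ((X ^ 2) ^ 2 ^ (k + 1)).trace := by
          rw [← pow_mul, ← pow_succ']
      _ ≤ (((X ^ 2)ᵀ * X ^ 2) ^ 2 ^ k).trace := ihW _
      _ = (((Xᵀ * X) * (X * Xᵀ)) ^ 2 ^ k).trace := by
          rw [pow_two, transpose_mul, ← mul_assoc (Xᵀ * X), trace_mul_pow_comm _ Xᵀ]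
          simp only [mul_assoc]
      _ ≤ ((Xᵀ * X) ^ 2 ^ k * (X * Xᵀ) ^ 2 ^ k).trace := ihL _ _ hP hR
      _ ≤ (((Xᵀ * X) ^ 2 ^ k * (Xᵀ * X) ^ 2 ^ k).trace +
            ((X * Xᵀ) ^ 2 ^ k * (X * Xᵀ) ^ 2 ^ k).trace) / 2 := by
          have h := trace_mul_le_frobenius ((Xᵀ * X) ^ 2 ^ k) ((X * Xᵀ) ^ 2 ^ k)
          rwa [transpose_pow_of_symm hP, transpose_pow_of_symm hR] at h
      _ = ((Xᵀ * X) ^ 2 ^ (k + 1)).trace := by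
          rw [← pow_add, ← pow_add, trace_mul_pow_comm X Xᵀ, ← mul_two, ← mul_two, ← pow_succ]
          ring

theorem trace_mul_pow_le {p : ℕ} (hp : ∃ q, p = 2 ^ q) {A B : Matrix n n ℝ} (hA : Aᵀ = A)
    (hB : Bᵀ = B) : ((A * B) ^ p).trace ≤ (A ^ p * B ^ p).trace := by
  obtain ⟨q, rfl⟩ := hp
  exact (trace_pow_two_pow_le_and_liebThirring q).2 A B hA hB

/-! ## Order facts for symmetric matrices -/

theorem transpose_eq_of_nonneg {A : Matrix n n ℝ} (h : 0 ≤ A) : Aᵀ = A := by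
  have := h.posSemidef.isHermitian
  rwa [IsHermitian, conjTranspose_eq_transpose_of_trivial] at this

theorem isSelfAdjoint_of_transpose {A : Matrix n n ℝ} (h : Aᵀ = A) : IsSelfAdjoint A := by
  rw [IsSelfAdjoint, star_eq_conjTranspose, conjTranspose_eq_transpose_of_trivial, h]

theorem conj_le_conj_of_symm {A B : Matrix n n ℝ} (h : A ≤ B) {C : Matrix n n ℝ} (hC : Cᵀ = C) :
    C * A * C ≤ C * B * C := by
  have := star_left_conjugate_le_conjugate h C
  rwa [star_eq_conjTranspose, conjTranspose_eq_transpose_of_trivial, hC] at this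

theorem conj_nonneg_of_symm {A : Matrix n n ℝ} (h : 0 ≤ A) {C : Matrix n n ℝ} (hC : Cᵀ = C) :
    0 ≤ C * A * C := by
  simpa using conj_le_conj_of_symm h hC

theorem sq_nonneg_of_symm {C : Matrix n n ℝ} (hC : Cᵀ = C) : 0 ≤ C * C := by
  simpa using conj_nonneg_of_symm (zero_le_one : (0 : Matrix n n ℝ) ≤ 1) hC

theorem pow_nonneg_of_nonneg {A : Matrix n n ℝ} (h : 0 ≤ A) (k : ℕ) : 0 ≤ A ^ k :=
  (h.posSemidef.pow k).nonneg

theorem trace_mul_nonneg {A B : Matrix n n ℝ} (hA : 0 ≤ A) (hB : 0 ≤ B) : 0 ≤ (A * B).trace := by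
  have hs : (CFC.sqrt A)ᵀ = CFC.sqrt A := transpose_eq_of_nonneg (CFC.sqrt_nonneg A)
  have h := (conj_nonneg_of_symm hB hs).posSemidef.trace_nonneg
  rwa [mul_assoc, trace_mul_comm, mul_assoc, CFC.sqrt_mul_sqrt_self A hA, trace_mul_comm] at h

theorem trace_mul_le_trace_mul {A B C : Matrix n n ℝ} (hA : 0 ≤ A) (h : B ≤ C) :
    (A * B).trace ≤ (A * C).trace := by
  have := trace_mul_nonneg hA (sub_nonneg.2 h)
  rw [mul_sub, trace_sub] at this
  linarith

theorem aeval_nonneg_of_spectrum {A : Matrix n n ℝ} (hA : Aᵀ = A) (f : Polynomial ℝ)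
    (hf : ∀ x ∈ spectrum ℝ A, 0 ≤ f.eval x) : 0 ≤ Polynomial.aeval A f := by
  rw [← cfc_polynomial f A (isSelfAdjoint_of_transpose hA)]
  exact cfc_nonneg hf

theorem mem_spectrum_le {A : Matrix n n ℝ} (hA : Aᵀ = A) {c : ℝ} (h : A ≤ c • 1) {x : ℝ}
    (hx : x ∈ spectrum ℝ A) : x ≤ c := by
  rw [← Algebra.algebraMap_eq_smul_one] at h
  exact (le_algebraMap_iff_spectrum_le (isSelfAdjoint_of_transpose hA)).1 h x hx

theorem le_mem_spectrum {A : Matrix n n ℝ} (hA : Aᵀ = A) {c : ℝ} (h : c • 1 ≤ A) {x : ℝ}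
    (hx : x ∈ spectrum ℝ A) : c ≤ x := by
  rw [← Algebra.algebraMap_eq_smul_one] at h
  exact (algebraMap_le_iff_le_spectrum (isSelfAdjoint_of_transpose hA)).1 h x hx

theorem le_smul_one_of_spectrum {A : Matrix n n ℝ} (hA : Aᵀ = A) {c : ℝ}
    (h : ∀ x ∈ spectrum ℝ A, x ≤ c) : A ≤ c • 1 := by
  rw [← Algebra.algebraMap_eq_smul_one]
  exact (le_algebraMap_iff_spectrum_le (isSelfAdjoint_of_transpose hA)).2 h

theorem le_trace_smul_one {A : Matrix n n ℝ} (hA : 0 ≤ A) : A ≤ A.trace • 1 := by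
  refine le_smul_one_of_spectrum (transpose_eq_of_nonneg hA) fun x hx => ?_
  rw [hA.posSemidef.isHermitian.spectrum_real_eq_range_eigenvalues] at hx
  obtain ⟨i, rfl⟩ := hx
  rw [hA.posSemidef.isHermitian.trace_eq_sum_eigenvalues]
  exact Finset.single_le_sum (f := hA.posSemidef.isHermitian.eigenvalues)
    (fun j _ => hA.posSemidef.eigenvalues_nonneg j) (Finset.mem_univ i)

/-- For even `p` the power `M ^ p` is a square, hence positive, so the `p`-th power of each
eigenvalue of `M` is at most the trace. -/
theorem le_of_trace_pow_le {M : Matrix n n ℝ} (hM : Mᵀ = M) {p : ℕ} (hp : Even p) (hp0 : p ≠ 0)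
    {c : ℝ} (hc : 0 ≤ c) (h : (M ^ p).trace ≤ c ^ p) : M ≤ c • 1 := by
  have hpow : 0 ≤ M ^ p := by
    obtain ⟨k, rfl⟩ := hp
    rw [pow_add]
    exact sq_nonneg_of_symm (transpose_pow_of_symm hM k)
  refine le_smul_one_of_spectrum hM fun x hx => ?_
  have hx' : x ^ p ∈ spectrum ℝ (M ^ p) := spectrum.pow_mem_pow M p hx
  have := mem_spectrum_le (transpose_eq_of_nonneg hpow) (le_trace_smul_one hpow) hx'
  exact le_of_pow_le_pow_left₀ hp0 hc (this.trans h)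

/-- By functional calculus this is the scalar inequality (1 + x)^p ≤ exp(px) ≤ 1 + px + (px)², valid
for |px| ≤ 1. -/
theorem one_add_pow_le {X : Matrix n n ℝ} (hX : Xᵀ = X) {p : ℕ} (hp : 1 ≤ p)
    (h1 : (p : ℝ) • X ≤ 1) (h2 : -1 ≤ (p : ℝ) • X) :
    (1 + X) ^ p ≤ 1 + (p : ℝ) • X + (p : ℝ) ^ 2 • (X * X) := by
  rw [← sub_nonneg]
  have hp' : (1 : ℝ) ≤ p := by exact_mod_cast hp
  have hp0 : (0 : ℝ) < p := by linarith
  have hle : X ≤ ((p : ℝ)⁻¹) • 1 := by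
    have := smul_le_smul_of_nonneg_left h1 (inv_nonneg.2 hp0.le)
    rwa [smul_smul, inv_mul_cancel₀ hp0.ne', one_smul] at this
  have hge : (-(p : ℝ)⁻¹) • 1 ≤ X := by
    have := smul_le_smul_of_nonneg_left h2 (inv_nonneg.2 hp0.le)
    rwa [smul_smul, inv_mul_cancel₀ hp0.ne', one_smul, smul_neg, ← neg_smul] at this
  have key := aeval_nonneg_of_spectrum hX
    (1 + Polynomial.C (p : ℝ) * Polynomial.X + Polynomial.C ((p : ℝ) ^ 2) * Polynomial.X ^ 2
      - (1 + Polynomial.X) ^ p) (fun x hx => by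
        have hx1 := mem_spectrum_le hX hle hx
        have hx2 := le_mem_spectrum hX hge hx
        have hpx1 : (p : ℝ) * x ≤ 1 := by
          calc (p : ℝ) * x ≤ p * (p : ℝ)⁻¹ := by gcongr
            _ = 1 := mul_inv_cancel₀ hp0.ne'
        have hpx2 : -1 ≤ (p : ℝ) * x := by
          calc (-1 : ℝ) = p * -(p : ℝ)⁻¹ := by rw [mul_neg, mul_inv_cancel₀ hp0.ne']
            _ ≤ p * x := by gcongr
        have hpinv : (p : ℝ)⁻¹ ≤ 1 := inv_le_one_of_one_le₀ hp'
        have hexp := Real.abs_exp_sub_one_sub_id_le (abs_le.2 ⟨hpx2, hpx1⟩)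
        have h3 : (1 + x) ^ p ≤ Real.exp (p * x) := by
          rw [Real.exp_nat_mul]
          exact pow_le_pow_left₀ (by linarith) (by linarith [Real.add_one_le_exp x]) p
        simp only [Polynomial.eval_sub, Polynomial.eval_add, Polynomial.eval_one,
          Polynomial.eval_mul, Polynomial.eval_C, Polynomial.eval_X, Polynomial.eval_pow]
        have := (abs_le.1 hexp).2
        nlinarith)
  simpa [Algebra.smul_def, pow_two] using key

end MatrixAnalysis

section Potential

set_option linter.unusedSectionVars false

open Matrix
open scoped MatrixOrder

variable {n : Type*} [Fintype n] [DecidableEq n]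

/-! ## The potential function and its increments -/

/-- With M = H² and N = H⁻¹, one has M + Z/2 = H(1 + X)H for X = NZN/2. The trace of its `p`-th
power is tr (M(1 + X))^p, which Lieb–Thirring bounds by tr M^p(1 + X)^p, and (1 + X)^p is expanded
to second order. The lower bound 1/2 on M gives N² ≤ 2, which keeps |pX| ≤ pβ ≤ 1 and bounds the
quadratic term. -/
theorem trace_add_half_pow_le {p : ℕ} (hp : ∃ q, p = 2 ^ q) {M Z : Matrix n n ℝ} {β : ℝ}
    (hM : (1 / 2 : ℝ) • 1 ≤ M) (hZ : Zᵀ = Z) (hZ1 : Z ≤ β • 1) (hZ2 : -(β • 1) ≤ Z)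
    (hβ0 : 0 ≤ β) (hβ : p * β ≤ 1) :
    ((M + (1 / 2 : ℝ) • Z) ^ p).trace ≤ (M ^ p).trace + p / 2 * (M ^ (p - 1) * Z).trace
      + p ^ 2 / 2 * (M ^ (p - 1) * (Z * Z)).trace := by
  have hp1 : 1 ≤ p := by obtain ⟨q, rfl⟩ := hp; exact Nat.one_le_two_pow
  have hM0 : 0 ≤ M := le_trans (smul_nonneg (by norm_num) zero_le_one) hM
  have hMt := transpose_eq_of_nonneg hM0
  have hMpd : M.PosDef := by
    have h1 : ((1 / 2 : ℝ) • (1 : Matrix n n ℝ)).PosDef := PosDef.one.smul (by norm_num)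
    have := h1.add_posSemidef (sub_nonneg.2 hM).posSemidef
    rwa [add_sub_cancel] at this
  set H := CFC.sqrt M with hH
  have hHt : Hᵀ = H := transpose_eq_of_nonneg (CFC.sqrt_nonneg M)
  have hHH : H * H = M := CFC.sqrt_mul_sqrt_self M hM0
  have hdet : IsUnit H.det := by
    have h1 : IsUnit (H * H).det := by rw [hHH]; exact (isUnit_iff_isUnit_det _).1 hMpd.isUnit
    rw [det_mul] at h1
    exact isUnit_of_mul_isUnit_left h1
  set N := H⁻¹ with hN
  have hNH : N * H = 1 := nonsing_inv_mul H hdet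
  have hHN : H * N = 1 := mul_nonsing_inv H hdet
  have hNt : Nᵀ = N := by rw [hN, transpose_nonsing_inv, hHt]
  have hNN : N * N ≤ (2 : ℝ) • 1 := by
    have h1 := conj_le_conj_of_symm hM hNt
    rw [← hHH, ← mul_assoc, hNH, one_mul, hHN, mul_smul_comm, mul_one, smul_mul_assoc] at h1
    have h2 := smul_le_smul_of_nonneg_left h1 (by norm_num : (0 : ℝ) ≤ 2)
    rwa [smul_smul, show (2 : ℝ) * (1 / 2) = 1 by norm_num, one_smul] at h2
  have hcomm : H * M ^ (p - 1) = M ^ (p - 1) * H := by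
    have : Commute H M := by rw [← hHH]; exact (Commute.refl H).mul_right (Commute.refl H)
    exact (this.pow_right _).eq
  have hMp : N * M ^ p * N = M ^ (p - 1) := by
    have : M ^ p = H * M ^ (p - 1) * H := by
      rw [hcomm, mul_assoc, hHH, ← pow_succ, Nat.sub_add_cancel hp1]
    rw [this, mul_assoc H, ← mul_assoc N, hNH, one_mul, mul_assoc, hHN, mul_one]
  set X := (1 / 2 : ℝ) • (N * Z * N) with hX
  have hXt : Xᵀ = X := by
    rw [hX, transpose_smul, transpose_mul, transpose_mul, hNt, hZ, mul_assoc]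
  have hfac : M + (1 / 2 : ℝ) • Z = H * (1 + X) * H := by
    have : H * (N * Z * N) * H = Z := by
      rw [mul_assoc N, ← mul_assoc H, hHN, one_mul, mul_assoc, hNH, mul_one]
    rw [mul_add, add_mul, mul_one, hHH, hX, mul_smul_comm, smul_mul_assoc, this]
  have hup : (p : ℝ) • X ≤ 1 := by
    have h1 := conj_le_conj_of_symm hZ1 hNt
    rw [mul_smul_comm, mul_one, smul_mul_assoc] at h1
    have h2 := h1.trans (smul_le_smul_of_nonneg_left hNN hβ0)
    have h3 := smul_le_smul_of_nonneg_left h2 (by positivity : (0 : ℝ) ≤ p * (1 / 2))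
    rw [hX, smul_smul]
    refine h3.trans ?_
    rw [smul_smul, smul_smul, show (p : ℝ) * (1 / 2) * β * 2 = p * β by ring]
    calc ((p : ℝ) * β) • (1 : Matrix n n ℝ) ≤ (1 : ℝ) • 1 :=
          smul_le_smul_of_nonneg_right hβ zero_le_one
      _ = 1 := one_smul _ _
  have hdown : -1 ≤ (p : ℝ) • X := by
    have h1 := conj_le_conj_of_symm (neg_le.1 hZ2) hNt
    rw [mul_smul_comm, mul_one, smul_mul_assoc] at h1
    have h2 := h1.trans (smul_le_smul_of_nonneg_left hNN hβ0)
    have h3 := smul_le_smul_of_nonneg_left h2 (by positivity : (0 : ℝ) ≤ p * (1 / 2))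
    rw [neg_le, hX, smul_smul]
    rw [mul_neg, neg_mul, smul_neg] at h3
    refine h3.trans ?_
    rw [smul_smul, smul_smul, show (p : ℝ) * (1 / 2) * β * 2 = p * β by ring]
    calc ((p : ℝ) * β) • (1 : Matrix n n ℝ) ≤ (1 : ℝ) • 1 :=
          smul_le_smul_of_nonneg_right hβ zero_le_one
      _ = 1 := one_smul _ _
  have hMX : (M ^ p * X).trace = 1 / 2 * (M ^ (p - 1) * Z).trace := by
    rw [hX, mul_smul_comm, trace_smul, smul_eq_mul, ← mul_assoc, trace_mul_comm, ← mul_assoc,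
      ← mul_assoc, hMp]
  have hMXX : (M ^ p * (X * X)).trace ≤ 1 / 2 * (M ^ (p - 1) * (Z * Z)).trace := by
    have h1 : (M ^ p * (X * X)).trace = 1 / 4 * (M ^ (p - 1) * (Z * (N * N) * Z)).trace := by
      rw [hX, smul_mul_smul_comm, mul_smul_comm, trace_smul, smul_eq_mul,
        show M ^ p * (N * Z * N * (N * Z * N)) = (M ^ p * (N * Z * N * (N * Z))) * N by
          simp only [mul_assoc], trace_mul_comm,
        show N * (M ^ p * (N * Z * N * (N * Z))) = N * M ^ p * N * (Z * (N * N) * Z) by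
          simp only [mul_assoc], hMp]
      norm_num
    have h2 := conj_le_conj_of_symm hNN hZ
    rw [mul_smul_comm, mul_one, smul_mul_assoc] at h2
    have h3 := trace_mul_le_trace_mul (pow_nonneg_of_nonneg hM0 (p - 1)) h2
    rw [mul_smul_comm, trace_smul, smul_eq_mul] at h3
    rw [h1]; linarith
  calc ((M + (1 / 2 : ℝ) • Z) ^ p).trace = ((M * (1 + X)) ^ p).trace := by
        rw [hfac, trace_mul_pow_comm, ← mul_assoc, hHH]
    _ ≤ (M ^ p * (1 + X) ^ p).trace :=
        trace_mul_pow_le hp hMt (by rw [transpose_add, transpose_one, hXt])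
    _ ≤ (M ^ p * (1 + (p : ℝ) • X + (p : ℝ) ^ 2 • (X * X))).trace :=
        trace_mul_le_trace_mul (pow_nonneg_of_nonneg hM0 p) (one_add_pow_le hXt hp1 hup hdown)
    _ = (M ^ p).trace + p * (M ^ p * X).trace + p ^ 2 * (M ^ p * (X * X)).trace := by
        rw [mul_add, mul_add, mul_one, mul_smul_comm (p : ℝ), mul_smul_comm ((p : ℝ) ^ 2), trace_add,
          trace_add, trace_smul, trace_smul, smul_eq_mul, smul_eq_mul]
    _ ≤ _ := by
        rw [hMX]
        have : (p : ℝ) ^ 2 * (M ^ p * (X * X)).trace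
            ≤ p ^ 2 * (1 / 2 * (M ^ (p - 1) * (Z * Z)).trace) := by gcongr
        linarith

/-- A random increment `Z i`, taken with probability `π i`, that has mean zero, norm at most `β`
and variance at most `v`, increases the expected trace of the `p`-th power by a factor of at most
`1 + p ^ 2 * v`. -/
theorem sum_trace_add_half_pow_le {ι : Type*} (s : Finset ι) (π : ι → ℝ) (Z : ι → Matrix n n ℝ)
    {p : ℕ} (hp : ∃ q, p = 2 ^ q) {M : Matrix n n ℝ} {β v : ℝ}
    (hπ : ∀ i ∈ s, 0 ≤ π i) (hπ1 : ∑ i ∈ s, π i = 1)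
    (hM : (1 / 2 : ℝ) • 1 ≤ M) (hZ : ∀ i ∈ s, (Z i)ᵀ = Z i) (hZ1 : ∀ i ∈ s, Z i ≤ β • 1)
    (hZ2 : ∀ i ∈ s, -(β • 1) ≤ Z i) (hβ0 : 0 ≤ β) (hβ : p * β ≤ 1)
    (hmean : ∑ i ∈ s, π i • Z i = 0) (hvar : ∑ i ∈ s, π i • (Z i * Z i) ≤ v • 1) (hv : 0 ≤ v) :
    ∑ i ∈ s, π i * ((M + (1 / 2 : ℝ) • Z i) ^ p).trace ≤ (1 + p ^ 2 * v) * (M ^ p).trace := by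
  have hp1 : 1 ≤ p := by obtain ⟨q, rfl⟩ := hp; exact Nat.one_le_two_pow
  have hM0 : 0 ≤ M := le_trans (smul_nonneg (by norm_num) zero_le_one) hM
  have h1 : ∀ i ∈ s, π i * ((M + (1 / 2 : ℝ) • Z i) ^ p).trace ≤ π i * (M ^ p).trace
      + p / 2 * (M ^ (p - 1) * (π i • Z i)).trace
      + p ^ 2 / 2 * (M ^ (p - 1) * (π i • (Z i * Z i))).trace := by
    intro i hi
    have := mul_le_mul_of_nonneg_left
      (trace_add_half_pow_le hp hM (hZ i hi) (hZ1 i hi) (hZ2 i hi) hβ0 hβ) (hπ i hi)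
    rw [mul_smul_comm, mul_smul_comm, trace_smul, trace_smul, smul_eq_mul, smul_eq_mul]
    linarith
  have h2 : (M ^ (p - 1) * ∑ i ∈ s, π i • (Z i * Z i)).trace ≤ v * (M ^ (p - 1)).trace := by
    have := trace_mul_le_trace_mul (pow_nonneg_of_nonneg hM0 (p - 1)) hvar
    rwa [mul_smul_comm, mul_one, trace_smul, smul_eq_mul] at this
  -- Since M ≥ 1/2, the missing factor of M costs at most 2, which turns the error term into a
  -- multiple of the potential itself.
  have h3 : (M ^ (p - 1)).trace ≤ 2 * (M ^ p).trace := by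
    have h4 := trace_mul_le_trace_mul (pow_nonneg_of_nonneg hM0 (p - 1)) hM
    rw [mul_smul_comm, mul_one, trace_smul, smul_eq_mul, ← pow_succ, Nat.sub_add_cancel hp1] at h4
    linarith
  calc _ ≤ ∑ i ∈ s, (π i * (M ^ p).trace + p / 2 * (M ^ (p - 1) * (π i • Z i)).trace
      + p ^ 2 / 2 * (M ^ (p - 1) * (π i • (Z i * Z i))).trace) := Finset.sum_le_sum h1
    _ = (M ^ p).trace + p / 2 * (M ^ (p - 1) * ∑ i ∈ s, π i • Z i).trace
      + p ^ 2 / 2 * (M ^ (p - 1) * ∑ i ∈ s, π i • (Z i * Z i)).trace := by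
        rw [Finset.sum_add_distrib, Finset.sum_add_distrib, ← Finset.sum_mul, hπ1, one_mul,
          ← Finset.mul_sum, ← Finset.mul_sum, ← trace_sum, ← trace_sum, ← Finset.mul_sum,
          ← Finset.mul_sum]
    _ ≤ (M ^ p).trace + p ^ 2 / 2 * (v * (2 * (M ^ p).trace)) := by
        rw [hmean, mul_zero, trace_zero, mul_zero, add_zero]
        gcongr
        exact h2.trans (by gcongr)
    _ = _ := by ring

/-- The two-sided potential of the deviation matrix `Y`. -/
noncomputable def potential (p : ℕ) (Y : Matrix n n ℝ) : ℝ :=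
  ((1 + (1 / 2 : ℝ) • Y) ^ p).trace + ((1 - (1 / 2 : ℝ) • Y) ^ p).trace

/-- One of the increments `X i - U` does not increase the potential by more than the expected
factor. -/
theorem exists_potential_add_le {ι : Type*} (s : Finset ι) (π : ι → ℝ) (X : ι → Matrix n n ℝ)
    {p : ℕ} (hp : ∃ q, p = 2 ^ q) {Y U : Matrix n n ℝ} {β v : ℝ}
    (hπ : ∀ i ∈ s, 0 ≤ π i) (hπ1 : ∑ i ∈ s, π i = 1)
    (hY1 : Y ≤ 1) (hY2 : -1 ≤ Y) (hX0 : ∀ i ∈ s, 0 ≤ X i) (hX : ∀ i ∈ s, X i ≤ β • 1)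
    (hv : 0 ≤ v) (hvβ : v ≤ β) (hβ : p * β ≤ 1)
    (hmean : ∑ i ∈ s, π i • X i = U) (hU : U ≤ v • 1) :
    ∃ i ∈ s, potential p (Y + (X i - U)) ≤ (1 + p ^ 2 * (β * v)) * potential p Y := by
  have hβ0 := hv.trans hvβ
  have hU0 : 0 ≤ U := by
    rw [← hmean]; exact Finset.sum_nonneg fun i hi => smul_nonneg (hπ i hi) (hX0 i hi)
  have hUt := transpose_eq_of_nonneg hU0
  have hXt : ∀ i ∈ s, (X i)ᵀ = X i := fun i hi => transpose_eq_of_nonneg (hX0 i hi)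
  have hvβ' : v • (1 : Matrix n n ℝ) ≤ β • 1 := smul_le_smul_of_nonneg_right hvβ zero_le_one
  have hZt : ∀ i ∈ s, (X i - U)ᵀ = X i - U := fun i hi => by rw [transpose_sub, hXt i hi, hUt]
  have hZ1 : ∀ i ∈ s, X i - U ≤ β • 1 := fun i hi => (sub_le_self _ hU0).trans (hX i hi)
  have hZ2 : ∀ i ∈ s, -(β • 1) ≤ X i - U := fun i hi => by
    rw [neg_le, neg_sub]
    exact (sub_le_self _ (hX0 i hi)).trans (hU.trans hvβ')
  have hmean' : ∑ i ∈ s, π i • (X i - U) = 0 := by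
    simp only [smul_sub, Finset.sum_sub_distrib, hmean]
    rw [← Finset.sum_smul, hπ1, one_smul, sub_self]
  have hvar : ∑ i ∈ s, π i • ((X i - U) * (X i - U)) ≤ (β * v) • 1 := by
    have h1 : ∑ i ∈ s, π i • ((X i - U) * (X i - U)) = ∑ i ∈ s, π i • (X i * X i) - U * U := by
      calc _ = ∑ i ∈ s, (π i • (X i * X i) - (π i • X i) * U - U * (π i • X i)
              + π i • (U * U)) := by
            refine Finset.sum_congr rfl fun i _ => ?_
            rw [sub_mul, mul_sub, mul_sub, smul_mul_assoc, mul_smul_comm]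
            simp only [smul_sub]
            abel
        _ = _ := by
            rw [Finset.sum_add_distrib, Finset.sum_sub_distrib, Finset.sum_sub_distrib,
              ← Finset.sum_mul, ← Finset.mul_sum, hmean, ← Finset.sum_smul, hπ1, one_smul]
            abel
    rw [h1]
    -- From 0 ≤ X ≤ β one gets X² ≤ βX, so the variance is at most β times the mean, that is, at
    -- most βv.
    have h2 : ∀ i ∈ s, X i * X i ≤ β • X i := by
      intro i hi
      have h3 : Commute (X i) (β • 1 - X i) :=
        ((Commute.one_right _).smul_right _).sub_right (Commute.refl _)
      have h4 := h3.mul_nonneg (hX0 i hi) (sub_nonneg.2 (hX i hi))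
      rw [mul_sub, mul_smul_comm, mul_one] at h4
      exact sub_nonneg.1 h4
    calc _ ≤ ∑ i ∈ s, π i • (X i * X i) := sub_le_self _ (sq_nonneg_of_symm hUt)
      _ ≤ ∑ i ∈ s, π i • (β • X i) :=
          Finset.sum_le_sum fun i hi => smul_le_smul_of_nonneg_left (h2 i hi) (hπ i hi)
      _ = β • U := by
          rw [← hmean, Finset.smul_sum]
          exact Finset.sum_congr rfl fun i _ => smul_comm _ _ _
      _ ≤ β • (v • 1) := smul_le_smul_of_nonneg_left hU hβ0
      _ = _ := smul_smul _ _ _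
  -- The factor 1/2 in the potential is there so that both 1 + Y/2 and 1 - Y/2 stay above 1/2 as
  -- long as |Y| ≤ 1.
  have hM : ∀ Y' : Matrix n n ℝ, -1 ≤ Y' → (1 / 2 : ℝ) • 1 ≤ 1 + (1 / 2 : ℝ) • Y' := by
    intro Y' h
    have h1 := smul_le_smul_of_nonneg_left h (by norm_num : (0 : ℝ) ≤ 1 / 2)
    calc (1 / 2 : ℝ) • (1 : Matrix n n ℝ) = 1 + (1 / 2 : ℝ) • (-1) := by
          rw [smul_neg, ← sub_eq_add_neg, eq_sub_iff_add_eq, ← add_smul]; norm_num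
      _ ≤ _ := by gcongr
  have key1 := sum_trace_add_half_pow_le s π (fun i => X i - U) hp hπ hπ1 (hM Y hY2) hZt hZ1 hZ2
    hβ0 hβ hmean' hvar (mul_nonneg hβ0 hv)
  have key2 := sum_trace_add_half_pow_le s π (fun i => -(X i - U)) hp hπ hπ1
    (hM (-Y) (neg_le_neg hY1)) (fun i hi => by rw [transpose_neg, hZt i hi])
    (fun i hi => neg_le.1 (hZ2 i hi)) (fun i hi => neg_le_neg (hZ1 i hi))
    hβ0 hβ (by simp only [smul_neg, Finset.sum_neg_distrib, hmean', neg_zero])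
    (by simpa only [neg_mul_neg] using hvar) (mul_nonneg hβ0 hv)
  -- The averaged bounds for the two signs add up to a bound for the average of the whole potential.
  -- If every candidate exceeded that bound, so would the average, strictly, because some weight π i
  -- is positive.
  by_contra! hcon
  have hs : s.Nonempty := by
    rw [Finset.nonempty_iff_ne_empty]; rintro rfl; simp at hπ1
  have hlt : ∑ i ∈ s, π i * ((1 + p ^ 2 * (β * v)) * potential p Y)
      < ∑ i ∈ s, π i * potential p (Y + (X i - U)) := by
    refine Finset.sum_lt_sum (fun i hi => mul_le_mul_of_nonneg_left (hcon i hi).le (hπ i hi)) ?_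
    by_contra! h
    have : ∀ i ∈ s, π i = 0 := by
      intro i hi
      by_contra hne
      have hpos := lt_of_le_of_ne (hπ i hi) (Ne.symm hne)
      exact absurd (h i hi) (not_le.2 (mul_lt_mul_of_pos_left (hcon i hi) hpos))
    rw [Finset.sum_eq_zero this] at hπ1
    exact zero_ne_one hπ1
  rw [← Finset.sum_mul, hπ1, one_mul] at hlt
  have hsum : ∑ i ∈ s, π i * potential p (Y + (X i - U))
      = ∑ i ∈ s, π i * ((1 + (1 / 2 : ℝ) • Y + (1 / 2 : ℝ) • (X i - U)) ^ p).trace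
        + ∑ i ∈ s, π i * ((1 + (1 / 2 : ℝ) • -Y + (1 / 2 : ℝ) • -(X i - U)) ^ p).trace := by
    rw [← Finset.sum_add_distrib]
    refine Finset.sum_congr rfl fun i _ => ?_
    have e1 : 1 + (1 / 2 : ℝ) • (Y + (X i - U))
        = 1 + (1 / 2 : ℝ) • Y + (1 / 2 : ℝ) • (X i - U) := by rw [smul_add]; abel
    have e2 : 1 - (1 / 2 : ℝ) • (Y + (X i - U))
        = 1 + (1 / 2 : ℝ) • -Y + (1 / 2 : ℝ) • -(X i - U) := by
      rw [smul_add, smul_neg, smul_neg]; abel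
    rw [potential, mul_add, e1, e2]
  rw [hsum] at hlt
  have hpot : potential p Y = ((1 + (1 / 2 : ℝ) • Y) ^ p).trace
      + ((1 + (1 / 2 : ℝ) • -Y) ^ p).trace := by
    rw [potential, smul_neg, ← sub_eq_add_neg]
  rw [hpot, mul_add] at hlt
  linarith

/-- Both traces are nonnegative because `p` is even, so each of them separately obeys the bound,
which then controls the top eigenvalue of 1 + Y/2 and of 1 - Y/2. -/
theorem le_of_potential_le {p : ℕ} (hp : Even p) (hp0 : p ≠ 0) {Y : Matrix n n ℝ} (hY : Yᵀ = Y)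
    {δ : ℝ} (hδ : 0 ≤ δ) (h : potential p Y ≤ (1 + δ / 2) ^ p) : Y ≤ δ • 1 ∧ -(δ • 1) ≤ Y := by
  have hnn : ∀ M : Matrix n n ℝ, Mᵀ = M → 0 ≤ (M ^ p).trace := by
    intro M hM
    obtain ⟨k, rfl⟩ := hp
    rw [pow_add]
    exact (sq_nonneg_of_symm (transpose_pow_of_symm hM k)).posSemidef.trace_nonneg
  have ht1 : (1 + (1 / 2 : ℝ) • Y)ᵀ = 1 + (1 / 2 : ℝ) • Y := by
    rw [transpose_add, transpose_one, transpose_smul, hY]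
  have ht2 : (1 - (1 / 2 : ℝ) • Y)ᵀ = 1 - (1 / 2 : ℝ) • Y := by
    rw [transpose_sub, transpose_one, transpose_smul, hY]
  have h1 := hnn _ ht1
  have h2 := hnn _ ht2
  rw [potential] at h
  have e1 := le_of_trace_pow_le ht1 hp hp0 (by linarith) (by linarith :
    ((1 + (1 / 2 : ℝ) • Y) ^ p).trace ≤ (1 + δ / 2) ^ p)
  have e2 := le_of_trace_pow_le ht2 hp hp0 (by linarith) (by linarith :
    ((1 - (1 / 2 : ℝ) • Y) ^ p).trace ≤ (1 + δ / 2) ^ p)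
  rw [add_smul, one_smul, add_le_add_iff_left] at e1
  rw [add_smul, one_smul, sub_eq_add_neg, add_le_add_iff_left, neg_le] at e2
  have e3 := smul_le_smul_of_nonneg_left e1 (by norm_num : (0 : ℝ) ≤ 2)
  have e4 := smul_le_smul_of_nonneg_left e2 (by norm_num : (0 : ℝ) ≤ 2)
  rw [smul_smul, smul_smul] at e3
  rw [smul_neg, smul_smul, smul_smul] at e4
  norm_num [mul_div_cancel₀] at e3 e4
  exact ⟨e3, e4⟩

end Potential

/-! ### Energies of translations, layering of the generators, and the spectral gap. -/

section Cayley

set_option linter.unusedSectionVars false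

open Matrix
open scoped MatrixOrder

variable {G : Type u} [Group G] [Fintype G] [DecidableEq G]

/-! ## Energies of translations -/

/-- The energy `∑ h, (x h - x (h * g)) ^ 2` of `x` along right translation by `g`. -/
def translationEnergy (g : G) (x : G → ℝ) : ℝ := ∑ h, (x h - x (h * g)) ^ 2

theorem translationEnergy_nonneg (g : G) (x : G → ℝ) : 0 ≤ translationEnergy g x :=
  Finset.sum_nonneg fun _ _ => sq_nonneg _

theorem translationEnergy_one (x : G → ℝ) : translationEnergy 1 x = 0 := by
  simp [translationEnergy]

theorem translationEnergy_inv (g : G) (x : G → ℝ) :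
    translationEnergy g⁻¹ x = translationEnergy g x := by
  rw [translationEnergy, ← Equiv.sum_comp (Equiv.mulRight g), translationEnergy]
  refine Finset.sum_congr rfl fun h _ => ?_
  simp only [Equiv.coe_mulRight, mul_inv_cancel_right]
  ring

/-- Pointwise (u + v)² ≤ (1 + 1/t)u² + (1 + t)v², summed using translation invariance. The free
parameter t matters: with t equal to the current constant r, the factor (1 + 1/r)r is only r + 1, so
long products lose linearly rather than exponentially. -/
theorem translationEnergy_mul_le (a b : G) (x : G → ℝ) {t : ℝ} (ht : 0 < t) :
    translationEnergy (a * b) x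
      ≤ (1 + t⁻¹) * translationEnergy a x + (1 + t) * translationEnergy b x := by
  have hb : translationEnergy b x = ∑ h, (x (h * a) - x (h * a * b)) ^ 2 := by
    rw [translationEnergy, ← Equiv.sum_comp (Equiv.mulRight a)]; rfl
  rw [hb, translationEnergy, translationEnergy, Finset.mul_sum, Finset.mul_sum,
    ← Finset.sum_add_distrib]
  refine Finset.sum_le_sum fun h _ => ?_
  rw [← mul_assoc]
  set u := x h - x (h * a)
  set v := x (h * a) - x (h * a * b)
  rw [show x h - x (h * a * b) = u + v by ring]
  have h1 : 0 ≤ t⁻¹ * (u - t * v) ^ 2 := by positivity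
  have h2 : t⁻¹ * (u - t * v) ^ 2 = t⁻¹ * u ^ 2 - 2 * u * v + t * v ^ 2 := by
    field_simp; ring
  linarith [h1, h2]

theorem translationEnergy_inv_mul_le (a b : G) (x : G → ℝ) :
    translationEnergy (a⁻¹ * b) x ≤ 2 * (translationEnergy a x + translationEnergy b x) := by
  have := translationEnergy_mul_le a⁻¹ b x one_pos
  rw [translationEnergy_inv] at this
  norm_num at this
  linarith

/-- Among the elements of `A` there are at most `log₂ |G|` that dominate the energies of all. -/
theorem exists_dominating_subset (A : Finset G) (hA : 1 ∉ A) :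
    ∃ T ⊆ A, 2 ^ T.card ≤ Fintype.card G ∧ (A.Nonempty → T.Nonempty) ∧
      ∀ s ∈ A, ∀ x, translationEnergy s x ≤ 4 * (T.card + 1) * ∑ t ∈ T, translationEnergy t x := by
  classical
  -- `P` stands in for the 2^|T| distinct subset products of an independent set T; the energy of
  -- each is controlled by that of T. A largest such T plays the role of a basis.
  let good : Finset G → Prop := fun T => ∃ P : Finset G, P.card = 2 ^ T.card ∧ 
    ∀ p ∈ P, ∀ x, translationEnergy p x ≤ (T.card + 1) * ∑ t ∈ T, translationEnergy t x
  have hgood : ∃ P : Finset G, P.card = 2 ^ (∅ : Finset G).card ∧ 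
    ∀ p ∈ P, ∀ x, translationEnergy p x
      ≤ ((∅ : Finset G).card + 1) * ∑ t ∈ (∅ : Finset G), translationEnergy t x := 
    ⟨{1}, by simp, by simp [translationEnergy_one]⟩
  obtain ⟨T, hT, hmax⟩ := Finset.exists_max_image (A.powerset.filter good) Finset.card
    ⟨∅, by simpa [good] using hgood⟩
  rw [Finset.mem_filter, Finset.mem_powerset] at hT
  obtain ⟨hTA, P, hP, hE⟩ := hT
  -- If P and Ps were disjoint, their union would certify that T ∪ {s} is good, against maximality.
  -- Hence s is a quotient of two elements of P.
  have hmeet : ∀ s ∈ A, s ∉ T → ∃ p ∈ P, p * s ∈ P := by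
    intro s hs hsT
    by_contra! hcon
    have hdisj : Disjoint P (P.image (· * s)) := by
      rw [Finset.disjoint_right]
      intro y hy hyP
      obtain ⟨p, hp, rfl⟩ := Finset.mem_image.1 hy
      exact hcon p hp hyP
    have hmem : insert s T ∈ A.powerset.filter good := by
      rw [Finset.mem_filter, Finset.mem_powerset]
      refine ⟨Finset.insert_subset hs hTA, P ∪ P.image (· * s), ?_, ?_⟩
      · rw [Finset.card_union_of_disjoint hdisj,
          Finset.card_image_of_injective _ (mul_left_injective s), hP,
          Finset.card_insert_of_notMem hsT, pow_succ]
        ring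
      · intro p hp x
        rw [Finset.sum_insert hsT, Finset.card_insert_of_notMem hsT]
        push_cast
        have hs0 := translationEnergy_nonneg s x
        have hT0 : 0 ≤ ∑ t ∈ T, translationEnergy t x :=
          Finset.sum_nonneg fun t _ => translationEnergy_nonneg t x
        rcases Finset.mem_union.1 hp with hp | hp
        · refine (hE p hp x).trans ?_
          gcongr <;> linarith
        · obtain ⟨q, hq, rfl⟩ := Finset.mem_image.1 hp
          have hr : (0 : ℝ) < T.card + 1 := by positivity
          calc translationEnergy (q * s) x
              ≤ (1 + (T.card + 1 : ℝ)⁻¹) * translationEnergy q x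
                + (1 + (T.card + 1)) * translationEnergy s x := translationEnergy_mul_le q s x hr
            _ ≤ (1 + (T.card + 1 : ℝ)⁻¹) * ((T.card + 1) * ∑ t ∈ T, translationEnergy t x)
                + (1 + (T.card + 1)) * translationEnergy s x := by gcongr; exact hE q hq x
            _ = _ := by field_simp; ring
    have := hmax _ hmem
    rw [Finset.card_insert_of_notMem hsT] at this
    omega
  refine ⟨T, hTA, ?_, ?_, ?_⟩
  · rw [← hP]; exact Finset.card_le_univ P
  · rintro ⟨s, hs⟩
    rw [Finset.nonempty_iff_ne_empty]
    rintro rfl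
    -- For empty T the set P is a single point, so p and ps coincide and s = 1, which is excluded
    -- from A.
    obtain ⟨p, hp, hps⟩ := hmeet s hs (Finset.notMem_empty s)
    have hcard : P.card ≤ 1 := by rw [hP]; simp
    have heq := Finset.card_le_one.1 hcard p hp _ hps
    have : s = 1 := by simpa using heq.symm
    exact hA (this ▸ hs)
  · intro s hs x
    have hT0 : 0 ≤ ∑ t ∈ T, translationEnergy t x :=
      Finset.sum_nonneg fun t _ => translationEnergy_nonneg t x
    by_cases hsT : s ∈ T
    · have h1 := Finset.single_le_sum (f := fun t => translationEnergy t x)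
        (fun t _ => translationEnergy_nonneg t x) hsT
      have h2 : (1 : ℝ) ≤ 4 * (T.card + 1) := by
        have : (0 : ℝ) ≤ T.card := Nat.cast_nonneg _
        linarith
      calc translationEnergy s x ≤ 1 * ∑ t ∈ T, translationEnergy t x := by rw [one_mul]; exact h1
        _ ≤ _ := by gcongr
    · obtain ⟨p, hp, hps⟩ := hmeet s hs hsT
      -- Here s = p⁻¹(ps) with both p and ps in P; the factor 2 for two energies of size |T| + 1
      -- gives the constant 4.
      have h1 := translationEnergy_inv_mul_le p (p * s) x
      rw [inv_mul_cancel_left] at h1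
      have h2 := hE p hp x
      have h3 := hE _ hps x
      linarith

/-- Layering of the generators: an element of layer `c s` has importance `O(log |G|) / c s`, and
every layer has at most `log₂ |G|` elements. -/
theorem exists_layering {l : ℕ} (hl : Fintype.card G < 2 ^ l) (A : Finset G) (hA : 1 ∉ A) :
    ∃ c : G → ℕ, (∀ s ∈ A, 1 ≤ c s ∧ c s ≤ A.card) ∧
      (∀ j, (A.filter fun s => c s = j).card ≤ l) ∧
      ∀ s ∈ A, ∀ x, c s * translationEnergy s x ≤ 4 * l * ∑ t ∈ A, translationEnergy t x := by
  classical
  induction A using Finset.strongInduction with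
  | H A ih =>
    rcases A.eq_empty_or_nonempty with rfl | hne
    · exact ⟨fun _ => 0, by simp, by simp, by simp⟩
    obtain ⟨T, hTA, hcard, hT, hE⟩ := exists_dominating_subset A hA
    have hTl : T.card + 1 ≤ l :=
      (Nat.pow_lt_pow_iff_right (by norm_num : 1 < 2)).1 (hcard.trans_lt hl)
    have hss : A \ T ⊂ A := Finset.sdiff_ssubset hTA (hT hne)
    obtain ⟨c, hc1, hc2, hc3⟩ := ih (A \ T) hss (fun h => hA (Finset.mem_sdiff.1 h).1)
    have hE' : ∀ s ∈ A, ∀ x, translationEnergy s x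
        ≤ 4 * l * ∑ t ∈ T, translationEnergy t x := by
      intro s hs x
      refine (hE s hs x).trans ?_
      have hT0 : 0 ≤ ∑ t ∈ T, translationEnergy t x :=
        Finset.sum_nonneg fun t _ => translationEnergy_nonneg t x
      gcongr
      exact_mod_cast hTl
    have hlt := Finset.card_lt_card hss
    -- The dominating set T becomes layer 1 and all layers of A \ T move up by one. Each move adds
    -- one copy of E_s ≤ 4l Σ_T to the inductive bound; the peeled sets are disjoint, so these sums
    -- add up to at most the sum over A.
    refine ⟨fun s => if s ∈ T then 1 else c s + 1, ?_, ?_, ?_⟩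
    · intro s hs
      by_cases hsT : s ∈ T
      · simp only [hsT, if_true]
        exact ⟨le_rfl, Finset.card_pos.2 hne⟩
      · simp only [hsT, if_false]
        have := hc1 s (Finset.mem_sdiff.2 ⟨hs, hsT⟩)
        omega
    · intro j
      rcases Nat.lt_or_ge j 2 with hj | hj
      · refine (Finset.card_le_card ?_).trans (Nat.le_of_succ_le hTl)
        intro s hs
        rw [Finset.mem_filter] at hs
        by_contra hsT
        have h1 := hs.2
        simp only [hsT, if_false] at h1
        have := hc1 s (Finset.mem_sdiff.2 ⟨hs.1, hsT⟩)
        omega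
      · refine (Finset.card_le_card ?_).trans (hc2 (j - 1))
        intro s hs
        rw [Finset.mem_filter] at hs ⊢
        by_cases hsT : s ∈ T
        · have h1 := hs.2
          simp only [hsT, if_true] at h1
          omega
        · have h1 := hs.2
          simp only [hsT, if_false] at h1
          exact ⟨Finset.mem_sdiff.2 ⟨hs.1, hsT⟩, by omega⟩
    · intro s hs x
      have hsum : ∑ t ∈ A, translationEnergy t x = ∑ t ∈ A \ T, translationEnergy t x
          + ∑ t ∈ T, translationEnergy t x := (Finset.sum_sdiff hTA).symm
      have h0 : 0 ≤ ∑ t ∈ A \ T, translationEnergy t x :=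
        Finset.sum_nonneg fun t _ => translationEnergy_nonneg t x
      have h1 := hE' s hs x
      have hl0 : (0 : ℝ) ≤ 4 * l := by positivity
      rw [hsum, mul_add]
      by_cases hsT : s ∈ T
      · simp only [hsT, if_true]
        have := mul_nonneg hl0 h0
        push_cast
        linarith
      · simp only [hsT, if_false]
        have := hc3 s (Finset.mem_sdiff.2 ⟨hs, hsT⟩) x
        push_cast
        linarith

/-- Each dyadic block from 2^h to 2^(h+1) contributes at most 1. -/
theorem sum_Ico_inv_le (h : ℕ) : ∑ j ∈ (Finset.Ico 1 (2 ^ h) : Finset ℕ), (j : ℝ)⁻¹ ≤ h := by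
  induction h with
  | zero => simp
  | succ h ih =>
    rw [← Finset.sum_Ico_consecutive _ Nat.one_le_two_pow
      (Nat.pow_le_pow_right (by norm_num) (Nat.le_succ h) : 2 ^ h ≤ 2 ^ (h + 1))]
    have : ∑ j ∈ (Finset.Ico (2 ^ h) (2 ^ (h + 1)) : Finset ℕ), (j : ℝ)⁻¹ ≤ 1 := by
      calc ∑ j ∈ (Finset.Ico (2 ^ h) (2 ^ (h + 1)) : Finset ℕ), (j : ℝ)⁻¹
          ≤ ∑ j ∈ (Finset.Ico (2 ^ h) (2 ^ (h + 1)) : Finset ℕ), ((2 : ℝ) ^ h)⁻¹ := by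
            refine Finset.sum_le_sum fun j hj => ?_
            have := (Finset.mem_Ico.1 hj).1
            gcongr
            exact_mod_cast this
        _ = 1 := by
            rw [Finset.sum_const, Nat.card_Ico, pow_succ, mul_two, Nat.add_sub_cancel, nsmul_eq_mul]
            push_cast
            exact mul_inv_cancel₀ (by positivity)
    push_cast
    linarith

-- At most l elements share a layer, so the sum is at most l harmonic sums. This bounds the total
-- importance of the generators, hence the normalization of the sampling probabilities.
theorem sum_inv_layer_le {ι : Type*} (A : Finset ι) (c : ι → ℕ) {l h : ℕ}
    (hc : ∀ s ∈ A, 1 ≤ c s ∧ c s ≤ A.card) (hl : ∀ j, (A.filter fun s => c s = j).card ≤ l)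
    (hh : A.card < 2 ^ h) : ∑ s ∈ A, (c s : ℝ)⁻¹ ≤ l * h := by
  classical
  have hmap : ∀ s ∈ A, c s ∈ Finset.Ico 1 (2 ^ h) := fun s hs =>
    Finset.mem_Ico.2 ⟨(hc s hs).1, (hc s hs).2.trans_lt hh⟩
  rw [← Finset.sum_fiberwise_of_maps_to hmap]
  calc ∑ j ∈ (Finset.Ico 1 (2 ^ h) : Finset ℕ), ∑ s ∈ A with c s = j, (c s : ℝ)⁻¹
      ≤ ∑ j ∈ (Finset.Ico 1 (2 ^ h) : Finset ℕ), l * (j : ℝ)⁻¹ := by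
        refine Finset.sum_le_sum fun j _ => ?_
        rw [Finset.sum_congr rfl (fun s hs => by rw [(Finset.mem_filter.1 hs).2] :
          ∀ s ∈ A.filter (fun s => c s = j), (c s : ℝ)⁻¹ = (j : ℝ)⁻¹), Finset.sum_const,
          nsmul_eq_mul]
        gcongr
        exact_mod_cast hl j
    _ ≤ l * h := by
        rw [← Finset.mul_sum]
        gcongr
        exact sum_Ico_inv_le h

/-! ## The spectral gap -/

/-- The ball of radius `k` around `1` in the Cayley graph. -/
def cayleyBall (S : Finset G) : ℕ → Finset G
  | 0 => {1}
  | k + 1 => cayleyBall S k ∪ (cayleyBall S k ×ˢ S).image fun q => q.1 * q.2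

/-- Taking t = k + 1 in the product inequality gives (k + 2)(k + 1) + (k + 2) = (k + 2)², the square
expected from Cauchy–Schwarz along a path. -/
theorem translationEnergy_le_of_mem_ball (S : Finset G) (k : ℕ) (x : G → ℝ) :
    ∀ g ∈ cayleyBall S k, translationEnergy g x
      ≤ (k + 1) ^ 2 * ∑ s ∈ S, translationEnergy s x := by
  have hW : 0 ≤ ∑ s ∈ S, translationEnergy s x :=
    Finset.sum_nonneg fun t _ => translationEnergy_nonneg t x
  induction k with
  | zero =>
    intro g hg
    rw [cayleyBall, Finset.mem_singleton] at hg
    rw [hg, translationEnergy_one]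
    positivity
  | succ k ih =>
    intro g hg
    rw [cayleyBall, Finset.mem_union, Finset.mem_image] at hg
    push_cast
    rcases hg with hg | ⟨⟨a, s⟩, has, rfl⟩
    · refine (ih g hg).trans ?_
      gcongr
      linarith
    · rw [Finset.mem_product] at has
      have hk : (0 : ℝ) < k + 1 := by positivity
      have hs := Finset.single_le_sum (f := fun t => translationEnergy t x)
        (fun t _ => translationEnergy_nonneg t x) has.2
      calc translationEnergy (a * s) x ≤ (1 + (k + 1 : ℝ)⁻¹) * translationEnergy a x
            + (1 + (k + 1)) * translationEnergy s x := translationEnergy_mul_le a s x hk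
        _ ≤ (1 + (k + 1 : ℝ)⁻¹) * ((k + 1) ^ 2 * ∑ s ∈ S, translationEnergy s x)
            + (1 + (k + 1)) * ∑ s ∈ S, translationEnergy s x := by
            gcongr
            exact ih a has.1
        _ = _ := by field_simp; ring

/-- Balls grow by at least one element until they stabilize, and a stable ball is closed under right
multiplication by S, so it contains the group generated by S. -/
theorem cayleyBall_eq_univ {S : Finset G} (hS : ∀ s ∈ S, s⁻¹ ∈ S)
    (hgen : Subgroup.closure (S : Set G) = ⊤) :
    cayleyBall S (Fintype.card G - 1) = Finset.univ := by
  have h1 : ∀ k, (1 : G) ∈ cayleyBall S k := by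
    intro k
    induction k with
    | zero => simp [cayleyBall]
    | succ k ih => rw [cayleyBall]; exact Finset.mem_union_left _ ih
  have hstab : ∀ k, cayleyBall S (k + 1) = cayleyBall S k → cayleyBall S k = Finset.univ := by
    intro k hk
    have hmul : ∀ a ∈ cayleyBall S k, ∀ s ∈ S, a * s ∈ cayleyBall S k := by
      intro a ha s hs
      rw [← hk, cayleyBall]
      exact Finset.mem_union_right _ (Finset.mem_image.2 ⟨(a, s), by simp [ha, hs], rfl⟩)
    ext g
    simp only [Finset.mem_univ, iff_true]
    have hg : g ∈ Subgroup.closure (S : Set G) := by rw [hgen]; trivial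
    induction hg using Subgroup.closure_induction_right with
    | one => exact h1 k
    | mul_right a _ s hs ih => exact hmul a ih s hs
    | mul_inv_cancel a _ s hs ih => exact hmul a ih _ (hS s hs)
  have hgrow : ∀ k, cayleyBall S k = Finset.univ ∨ k + 1 ≤ (cayleyBall S k).card := by
    intro k
    induction k with
    | zero => right; simp [cayleyBall]
    | succ k ih =>
      by_cases heq : cayleyBall S (k + 1) = cayleyBall S k
      · left; rw [heq]; exact hstab k heq
      · have hsub : cayleyBall S k ⊆ cayleyBall S (k + 1) := by
          rw [cayleyBall]; exact Finset.subset_union_left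
        have hlt := Finset.card_lt_card (hsub.ssubset_of_ne (Ne.symm heq))
        rcases ih with ih | ih
        · left
          rw [ih] at hsub
          exact Finset.univ_subset_iff.1 hsub
        · right; omega
  have hpos : 0 < Fintype.card G := Fintype.card_pos
  rcases hgrow (Fintype.card G - 1) with h | h
  · exact h
  · rw [← Finset.card_eq_iff_eq_univ]
    exact le_antisymm (Finset.card_le_univ _) (by omega)

theorem sum_translationEnergy_univ (x : G → ℝ) :
    ∑ g, translationEnergy g x = 2 * (Fintype.card G * ∑ h, x h ^ 2) - 2 * (∑ h, x h) ^ 2 := by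
  simp only [translationEnergy]
  rw [Finset.sum_comm]
  have : ∀ h : G, ∑ g, (x h - x (h * g)) ^ 2 = ∑ g, (x h - x g) ^ 2 := fun h => by
    rw [← Equiv.sum_comp (Equiv.mulLeft h) fun g => (x h - x g) ^ 2]; rfl
  simp only [this]
  simp only [sub_sq, Finset.sum_add_distrib, Finset.sum_sub_distrib, Finset.sum_const,
    Finset.card_univ, nsmul_eq_mul, ← Finset.mul_sum, ← Finset.sum_mul]
  ring

/-- A crude Poincaré inequality: the variance is an average of the energies of all group elements,
and each element is a word of length less than |G|. Any polynomial gap suffices, since it only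
determines the length of the Neumann series. -/
theorem card_mul_sum_sq_sub_le {S : Finset G} (hS : ∀ s ∈ S, s⁻¹ ∈ S)
    (hgen : Subgroup.closure (S : Set G) = ⊤) (x : G → ℝ) :
    2 * (Fintype.card G * ∑ h, x h ^ 2) - 2 * (∑ h, x h) ^ 2
      ≤ (Fintype.card G : ℝ) ^ 3 * ∑ s ∈ S, translationEnergy s x := by
  rw [← sum_translationEnergy_univ]
  have hpos : 1 ≤ Fintype.card G := Fintype.card_pos
  calc ∑ g, translationEnergy g x
      ≤ ∑ _g : G, (Fintype.card G : ℝ) ^ 2 * ∑ s ∈ S, translationEnergy s x := by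
        refine Finset.sum_le_sum fun g _ => ?_
        have := translationEnergy_le_of_mem_ball S (Fintype.card G - 1) x g
          (by rw [cayleyBall_eq_univ hS hgen]; exact Finset.mem_univ g)
        rwa [Nat.cast_sub hpos, Nat.cast_one, sub_add_cancel] at this
    _ = _ := by rw [Finset.sum_const, Finset.card_univ, nsmul_eq_mul]; ring

/-! ## Laplacians of single generators -/

/-- The Laplacian of the Cayley graph of the multiset `{g, g⁻¹}`. -/
def generatorLaplacian (R : Type*) [Ring R] (g : G) : Matrix G G R :=
  of fun i j => 2 * (if i = j then 1 else 0) - (if i * g = j then 1 else 0)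
    - (if j * g = i then 1 else 0)

theorem generatorLaplacian_transpose (R : Type*) [Ring R] (g : G) :
    (generatorLaplacian R g)ᵀ = generatorLaplacian R g := by
  ext i j
  simp only [generatorLaplacian, transpose_apply, of_apply, eq_comm (a := j) (b := i)]
  abel

theorem generatorLaplacian_inv (R : Type*) [Ring R] (g : G) :
    generatorLaplacian R g⁻¹ = generatorLaplacian R g := by
  ext i j
  simp only [generatorLaplacian, of_apply, mul_inv_eq_iff_eq_mul, eq_comm (a := i) (b := j * g),
    eq_comm (a := j) (b := i * g)]
  abel

theorem generatorLaplacian_dotProduct (g : G) (x : G → ℝ) :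
    x ⬝ᵥ (generatorLaplacian ℝ g *ᵥ x) = translationEnergy g x := by
  have h1 : ∀ i, (generatorLaplacian ℝ g *ᵥ x) i = 2 * x i - x (i * g) - x (i * g⁻¹) := by
    intro i
    have key : ∀ j : G, j * g = i ↔ i * g⁻¹ = j := fun j => by
      rw [mul_inv_eq_iff_eq_mul, eq_comm]
    simp only [generatorLaplacian, mulVec, dotProduct, of_apply, sub_mul, mul_assoc, ite_mul,
      one_mul, zero_mul, Finset.sum_sub_distrib, ← Finset.mul_sum, Finset.sum_ite_eq,
      Finset.mem_univ, if_true, key]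
  simp only [dotProduct, h1, translationEnergy]
  have h2 : ∑ i, x i * x (i * g⁻¹) = ∑ i, x i * x (i * g) := by
    rw [← Equiv.sum_comp (Equiv.mulRight g)]
    refine Finset.sum_congr rfl fun h _ => ?_
    simp [mul_comm]
  have h3 : ∑ i, x (i * g) ^ 2 = ∑ i, x i ^ 2 :=
    Equiv.sum_comp (Equiv.mulRight g) fun i => x i ^ 2
  simp only [mul_sub, sub_sq, Finset.sum_sub_distrib, Finset.sum_add_distrib, h2, h3]
  have h4 : ∀ i, x i * (2 * x i) = 2 * x i ^ 2 := fun i => by ring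
  have h5 : ∀ i, 2 * x i * x (i * g) = 2 * (x i * x (i * g)) := fun i => by ring
  simp only [h4, h5, ← Finset.mul_sum]
  ring

theorem le_of_quadratic {n : Type*} [Fintype n] {A B : Matrix n n ℝ} (hA : Aᵀ = A) (hB : Bᵀ = B)
    (h : ∀ x : n → ℝ, x ⬝ᵥ (A *ᵥ x) ≤ x ⬝ᵥ (B *ᵥ x)) : A ≤ B := by
  rw [le_iff]
  refine PosSemidef.of_dotProduct_mulVec_nonneg ?_ fun x => ?_
  · rw [IsHermitian, conjTranspose_eq_transpose_of_trivial, transpose_sub, hA, hB]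
  · rw [star_trivial, sub_mulVec, dotProduct_sub, sub_nonneg]
    exact h x

/-- The Laplacian of the sum of the graphs `{g, g⁻¹}` with weights `w g`. -/
def weightLaplacian (R : Type*) [CommRing R] (w : G → R) : Matrix G G R :=
  ∑ g, w g • generatorLaplacian R g

theorem weightLaplacian_transpose (R : Type*) [CommRing R] (w : G → R) :
    (weightLaplacian R w)ᵀ = weightLaplacian R w := by
  simp only [weightLaplacian, transpose_sum, transpose_smul, generatorLaplacian_transpose]

theorem weightLaplacian_dotProduct (w : G → ℝ) (x : G → ℝ) :
    x ⬝ᵥ (weightLaplacian ℝ w *ᵥ x) = ∑ g, w g * translationEnergy g x := by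
  simp only [weightLaplacian, sum_mulVec, dotProduct_sum, smul_mulVec, dotProduct_smul,
    generatorLaplacian_dotProduct, smul_eq_mul]

theorem weightLaplacian_nonneg {w : G → ℝ} (hw : ∀ g, 0 ≤ w g) : 0 ≤ weightLaplacian ℝ w := by
  refine le_of_quadratic (by simp) (weightLaplacian_transpose ℝ w) fun x => ?_
  rw [weightLaplacian_dotProduct, zero_mulVec, dotProduct_zero]
  exact Finset.sum_nonneg fun g _ => mul_nonneg (hw g) (translationEnergy_nonneg g x)

theorem weightLaplacian_mul_one (R : Type*) [CommRing R] (w : G → R) :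
    weightLaplacian R w * of (fun _ _ => 1) = 0 := by
  have : ∀ g : G, generatorLaplacian R g * of (fun _ _ => (1 : R)) = 0 := by
    intro g
    ext i j
    have key : ∀ j : G, j * g = i ↔ i * g⁻¹ = j := fun j => by
      rw [mul_inv_eq_iff_eq_mul, eq_comm]
    simp only [generatorLaplacian, mul_apply, of_apply, mul_one, Matrix.zero_apply,
      Finset.sum_sub_distrib, ← Finset.mul_sum, Finset.sum_ite_eq, Finset.mem_univ, if_true, key]
    ring
  simp only [weightLaplacian, Finset.sum_mul, smul_mul_assoc, this, smul_zero,
    Finset.sum_const_zero]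

end Cayley

section Preconditioner

set_option linter.unusedSectionVars false

open Matrix
open scoped MatrixOrder

variable {n : Type*} [Fintype n] [DecidableEq n]

/-! ## A polynomial preconditioner -/

/-- Partial sums of the Neumann series for the inverse of `T`. -/
def neumannSum (a : ℝ) (T : Matrix n n ℝ) : ℕ → Matrix n n ℝ
  | 0 => 0
  | j + 1 => (1 - a • T) * neumannSum a T j + a • 1

theorem neumannSum_commute {a : ℝ} {T X : Matrix n n ℝ} (h : Commute X T) (j : ℕ) :
    Commute X (neumannSum a T j) := by
  induction j with
  | zero => exact Commute.zero_right X
  | succ j ih =>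
    exact ((((Commute.one_right X).sub_right (h.smul_right a)).mul_right ih).add_right
      ((Commute.one_right X).smul_right a))

/-- The geometric series telescopes, so (1 - aT)^j is exactly the error of the approximate inverse.
-/
theorem neumannSum_mul (a : ℝ) (T : Matrix n n ℝ) (j : ℕ) :
    neumannSum a T j * T = 1 - (1 - a • T) ^ j := by
  induction j with
  | zero => simp [neumannSum]
  | succ j ih =>
    rw [neumannSum, add_mul, mul_assoc, ih, mul_sub, mul_one, pow_succ', smul_mul_assoc, one_mul]
    abel

theorem neumannSum_nonneg {a : ℝ} (ha : 0 ≤ a) {T : Matrix n n ℝ} (haT : a • T ≤ 1) (j : ℕ) :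
    0 ≤ neumannSum a T j := by
  induction j with
  | zero => exact le_rfl
  | succ j ih =>
    have hB : 0 ≤ 1 - a • T := sub_nonneg.2 haT
    have hc : Commute (1 - a • T) (neumannSum a T j) := neumannSum_commute
      ((Commute.one_left T).sub_left ((Commute.refl T).smul_left a)) j
    exact add_nonneg (hc.mul_nonneg hB ih) (smul_nonneg ha zero_le_one)

theorem neumannSum_posDef {a : ℝ} (ha : 0 < a) {T : Matrix n n ℝ} (haT : a • T ≤ 1) {j : ℕ}
    (hj : j ≠ 0) : (neumannSum a T j).PosDef := by
  obtain ⟨j, rfl⟩ := Nat.exists_eq_succ_of_ne_zero hj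
  have hB : 0 ≤ 1 - a • T := sub_nonneg.2 haT
  have hc : Commute (1 - a • T) (neumannSum a T j) := neumannSum_commute
    ((Commute.one_left T).sub_left ((Commute.refl T).smul_left a)) j
  exact PosDef.posSemidef_add (hc.mul_nonneg hB (neumannSum_nonneg ha.le haT j)).posSemidef
    (PosDef.one.smul ha)

/-- On the range of J the matrix B is the identity, and on the complement it is at most r; the bound
describes the power on both parts. The induction multiplies by B, which commutes with everything
involved. -/
theorem one_sub_pow_le {B J : Matrix n n ℝ} {r : ℝ} (hr : 0 ≤ r) (hB : 0 ≤ B) (hBJ : B * J = J)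
    (hJB : J * B = J) (hgap : B ≤ r • 1 + (1 - r) • J) (j : ℕ) :
    B ^ j ≤ r ^ j • 1 + (1 - r ^ j) • J := by
  induction j with
  | zero => simp
  | succ j ih =>
    have hc : Commute B (r ^ j • 1 + (1 - r ^ j) • J - B ^ j) := by
      refine Commute.sub_right (Commute.add_right ((Commute.one_right B).smul_right _)
        (Commute.smul_right ?_ _)) ((Commute.refl B).pow_right j)
      rw [Commute, SemiconjBy, hBJ, hJB]
    have h1 := hc.mul_nonneg hB (sub_nonneg.2 ih)
    rw [mul_sub, mul_add, mul_smul_comm, mul_smul_comm, mul_one, hBJ, ← pow_succ', sub_nonneg] at h1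
    refine h1.trans ?_
    have h2 := smul_le_smul_of_nonneg_left hgap (pow_nonneg hr j)
    calc r ^ j • B + (1 - r ^ j) • J ≤ r ^ j • (r • 1 + (1 - r) • J) + (1 - r ^ j) • J := by gcongr
      _ = _ := by
        rw [smul_add, smul_smul, smul_smul, add_assoc, ← add_smul, ← pow_succ]
        congr 2
        ring

/-- Bernoulli gives (1 + γ)^m ≥ 2, while (1 - γ)^m (1 + γ)^m = (1 - γ²)^m ≤ 1. -/
theorem one_sub_pow_le_half {m : ℕ} {γ : ℝ} (hγ : 0 ≤ γ) (hγ1 : γ ≤ 1) (hm : 1 ≤ m * γ) :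
    (1 - γ) ^ m ≤ 1 / 2 := by
  have h1 : (2 : ℝ) ≤ (1 + γ) ^ m := by
    have := one_add_mul_le_pow (by linarith : (-2 : ℝ) ≤ γ) m
    linarith
  have h2 : (1 - γ) ^ m * (1 + γ) ^ m ≤ 1 := by
    rw [← mul_pow]
    exact pow_le_one₀ (mul_nonneg (by linarith) (by linarith)) (by nlinarith)
  have h3 : 0 ≤ (1 - γ) ^ m := pow_nonneg (by linarith) m
  nlinarith

/-- `Q` is, up to a constant factor, an inverse of the Laplacian `T` on the complement of the
range of the projection `J`. -/
theorem neumannSum_spec {a γ : ℝ} {T J : Matrix n n ℝ} {m : ℕ} (ha : 0 < a) (hT : 0 ≤ T)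
    (haT : a • T ≤ 1) (hJt : Jᵀ = J) (hJJ : J * J = J) (hTJ : T * J = 0)
    (hγ : 0 ≤ γ) (hγ1 : γ ≤ 1) (hgap : γ • (1 - J) ≤ a • T) (hm : 1 ≤ m * γ) :
    T ≤ (neumannSum a T m)⁻¹ ∧ ∀ (D : Matrix n n ℝ) (δ : ℝ), 0 ≤ δ → Dᵀ = D → D * J = 0 →
      D ≤ δ • (neumannSum a T m)⁻¹ → D ≤ (2 * δ) • T := by
  have hTt := transpose_eq_of_nonneg hT
  have hJ0 : 0 ≤ J := by
    have := sq_nonneg_of_symm hJt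
    rwa [hJJ] at this
  have hJT : J * T = 0 := by
    have := congrArg transpose hTJ
    rwa [transpose_mul, hJt, hTt, transpose_zero] at this
  have hm0 : m ≠ 0 := by rintro rfl; simp at hm; linarith
  have hQpd := neumannSum_posDef ha haT hm0
  set Q := neumannSum a T m with hQ
  set B := 1 - a • T with hB
  have hB0 : 0 ≤ B := sub_nonneg.2 haT
  have hdet : IsUnit Q.det := (isUnit_iff_isUnit_det _).1 hQpd.isUnit
  have hQi0 : 0 ≤ Q⁻¹ := hQpd.inv.posSemidef.nonneg
  have hinvcomm : ∀ X : Matrix n n ℝ, Commute X T → Commute Q⁻¹ X := by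
    intro X hX
    have h1 : X * Q = Q * X := (neumannSum_commute hX m).eq
    rw [Commute, SemiconjBy]
    calc Q⁻¹ * X = Q⁻¹ * (X * Q) * Q⁻¹ := by
          rw [mul_assoc, mul_assoc, mul_nonsing_inv Q hdet, mul_one]
      _ = X * Q⁻¹ := by rw [h1, ← mul_assoc, nonsing_inv_mul Q hdet, one_mul]
  have hBT : Commute B T := (Commute.one_left T).sub_left ((Commute.refl T).smul_left a)
  have hJTc : Commute J T := by rw [Commute, SemiconjBy, hTJ, hJT]
  have hQT : Q * T = 1 - B ^ m := neumannSum_mul a T m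
  have hT' : T = Q⁻¹ * (1 - B ^ m) := by
    rw [← hQT, ← mul_assoc, nonsing_inv_mul Q hdet, one_mul]
  refine ⟨?_, ?_⟩
  -- The difference Q⁻¹ - T is Q⁻¹B^m, a product of commuting positive matrices.
  · have h1 : 0 ≤ Q⁻¹ * B ^ m :=
      (hinvcomm _ (hBT.pow_left m)).mul_nonneg hQi0 (pow_nonneg_of_nonneg hB0 m)
    have h2 : Q⁻¹ - T = Q⁻¹ * B ^ m := by
      conv_lhs => rw [hT']
      rw [mul_sub, mul_one, sub_sub_cancel]
    rw [← sub_nonneg, h2]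
    exact h1
  · have hBJ : B * J = J := by rw [hB, sub_mul, one_mul, smul_mul_assoc, hTJ, smul_zero, sub_zero]
    have hJB : J * B = J := by rw [hB, mul_sub, mul_one, mul_smul_comm, hJT, smul_zero, sub_zero]
    have hBm : B ^ m ≤ (1 / 2 : ℝ) • 1 + (1 / 2 : ℝ) • J := by
      have h1 : B ≤ (1 - γ) • 1 + (1 - (1 - γ)) • J := by
        rw [hB, sub_sub_cancel]
        have h2 : (1 - γ) • (1 : Matrix n n ℝ) + γ • J = 1 - γ • (1 - J) := by
          rw [smul_sub, sub_smul, one_smul]; abel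
        rw [h2]
        exact sub_le_sub_left hgap 1
      have h2 := one_sub_pow_le (by linarith) hB0 hBJ hJB h1 m
      have h3 := one_sub_pow_le_half hγ hγ1 hm
      have hJ1 : 0 ≤ 1 - J := by
        have h4 : (1 - J) * (1 - J) = 1 - J := by
          rw [mul_sub, mul_one, sub_mul, one_mul, hJJ, sub_self, sub_zero]
        have h5 := sq_nonneg_of_symm (C := 1 - J) (by rw [transpose_sub, transpose_one, hJt])
        rwa [h4] at h5
      have h6 := smul_le_smul_of_nonneg_right h3 hJ1
      calc B ^ m ≤ (1 - γ) ^ m • (1 - J) + J := by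
            refine h2.trans (le_of_eq ?_)
            rw [smul_sub, sub_smul, one_smul]; abel
        _ ≤ (1 / 2 : ℝ) • (1 - J) + J := by gcongr
        _ = _ := by
            have : J = (1 / 2 : ℝ) • J + (1 / 2 : ℝ) • J := by rw [← add_smul]; norm_num
            nth_rw 2 [this]
            rw [smul_sub]; abel
    -- On the complement of J one has B^m ≤ 1/2, so T = Q⁻¹(1 - B^m) is at least half of Q⁻¹ there.
    have hkey : Q⁻¹ * (1 - J) ≤ (2 : ℝ) • T := by
      have h1 : 0 ≤ 1 + J - (2 : ℝ) • B ^ m := by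
        have h2 := smul_le_smul_of_nonneg_left hBm (by norm_num : (0 : ℝ) ≤ 2)
        rw [smul_add, smul_smul, smul_smul] at h2
        norm_num at h2
        exact sub_nonneg.2 h2
      have h3 : Commute (1 + J - (2 : ℝ) • B ^ m) T :=
        ((Commute.one_left T).add_left hJTc).sub_left ((hBT.pow_left m).smul_left 2)
      have h4 := (hinvcomm _ h3).mul_nonneg hQi0 h1
      have h5 : (2 : ℝ) • T - Q⁻¹ * (1 - J) = Q⁻¹ * (1 + J - (2 : ℝ) • B ^ m) := by
        conv_lhs => rw [hT']
        rw [← mul_smul_comm, ← mul_sub]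
        congr 1
        rw [smul_sub, two_smul ℝ (1 : Matrix n n ℝ)]
        abel
      rw [← sub_nonneg, h5]
      exact h4
    intro D δ hδ hD hDJ hle
    have hJD : J * D = 0 := by
      have := congrArg transpose hDJ
      rwa [transpose_mul, hJt, hD, transpose_zero] at this
    -- As D vanishes on the range of J, compressing by 1 - J leaves D unchanged and replaces Q⁻¹ by
    -- Q⁻¹(1 - J).
    have h1 := conj_le_conj_of_symm hle (C := 1 - J) (by rw [transpose_sub, transpose_one, hJt])
    have h2 : (1 - J) * D * (1 - J) = D := by
      rw [sub_mul, one_mul, hJD, sub_zero, mul_sub, mul_one, hDJ, sub_zero]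
    have h3 : (1 - J) * δ • Q⁻¹ * (1 - J) = δ • (Q⁻¹ * (1 - J)) := by
      have h4 : (1 - J) * (1 - J) = 1 - J := by
        rw [mul_sub, mul_one, sub_mul, one_mul, hJJ, sub_self, sub_zero]
      have h5 : Q⁻¹ * (1 - J) = (1 - J) * Q⁻¹ :=
        (hinvcomm _ ((Commute.one_left T).sub_left hJTc)).eq
      rw [mul_smul_comm, smul_mul_assoc, ← h5, mul_assoc, h4]
    rw [h2, h3] at h1
    refine h1.trans ?_
    rw [mul_comm, mul_smul]
    exact smul_le_smul_of_nonneg_left hkey hδ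

end Preconditioner

/-! ### The preconditioner of a Cayley graph, from the spectral gap. -/

section CayleyPreconditioner

set_option linter.unusedSectionVars false

open Matrix
open scoped MatrixOrder

variable {G : Type u} [Group G] [Fintype G] [DecidableEq G]

/-- The integral indicator function of `S`. -/
def finsetIndicator (R : Type*) [Ring R] (S : Finset G) (g : G) : R := if g ∈ S then 1 else 0

/-- Twice the Laplacian of `Cay(G, S)`. -/
def doubleLaplacian (R : Type*) [CommRing R] (S : Finset G) : Matrix G G R :=
  weightLaplacian R (finsetIndicator R S)

theorem doubleLaplacian_dotProduct (S : Finset G) (x : G → ℝ) :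
    x ⬝ᵥ (doubleLaplacian ℝ S *ᵥ x) = ∑ s ∈ S, translationEnergy s x := by
  rw [doubleLaplacian, weightLaplacian_dotProduct]
  simp [finsetIndicator]

theorem doubleLaplacian_nonneg (S : Finset G) : 0 ≤ doubleLaplacian ℝ S :=
  weightLaplacian_nonneg fun g => by rw [finsetIndicator]; split_ifs <;> norm_num

theorem translationEnergy_le_sum_sq (g : G) (x : G → ℝ) :
    translationEnergy g x ≤ 4 * ∑ h, x h ^ 2 := by
  have h3 : ∑ i, x (i * g) ^ 2 = ∑ i, x i ^ 2 :=
    Equiv.sum_comp (Equiv.mulRight g) fun i => x i ^ 2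
  calc translationEnergy g x ≤ ∑ h, (2 * x h ^ 2 + 2 * x (h * g) ^ 2) :=
        Finset.sum_le_sum fun h _ => by nlinarith [sq_nonneg (x h + x (h * g))]
    _ = 4 * ∑ h, x h ^ 2 := by
        rw [Finset.sum_add_distrib, ← Finset.mul_sum, ← Finset.mul_sum, h3]; ring

/-- The orthogonal projection onto the constant functions. -/
noncomputable def constProjection (G : Type u) [Fintype G] : Matrix G G ℝ :=
  (Fintype.card G : ℝ)⁻¹ • of fun _ _ => 1

theorem constProjection_dotProduct (x : G → ℝ) :
    x ⬝ᵥ (constProjection G *ᵥ x) = (Fintype.card G : ℝ)⁻¹ * (∑ h, x h) ^ 2 := by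
  have : ∀ i : G, ((of fun _ _ => (1 : ℝ)) *ᵥ x) i = ∑ h, x h := by
    intro i; simp [mulVec, dotProduct]
  rw [constProjection, smul_mulVec, dotProduct_smul, smul_eq_mul]
  congr 1
  simp only [dotProduct, this, ← Finset.sum_mul, pow_two]

theorem sum_sq_eq_dotProduct (x : G → ℝ) : x ⬝ᵥ ((1 : Matrix G G ℝ) *ᵥ x) = ∑ h, x h ^ 2 := by
  rw [one_mulVec]
  simp only [dotProduct, pow_two]

/-- The preconditioner for `Cay(G, S)`. -/
noncomputable def cayleyPreconditioner (S : Finset G) : Matrix G G ℝ :=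
  neumannSum (4 * Fintype.card G : ℝ)⁻¹ (doubleLaplacian ℝ S) (2 * Fintype.card G ^ 3)

/-- There are at most |G| generators and each has energy at most 4 Σ x², so the step 1/(4|G|) keeps
all terms of the Neumann series positive. -/
theorem smul_doubleLaplacian_le_one (S : Finset G) :
    (4 * Fintype.card G : ℝ)⁻¹ • doubleLaplacian ℝ S ≤ 1 := by
  have hN : (0 : ℝ) < Fintype.card G := by exact_mod_cast Fintype.card_pos
  refine le_of_quadratic (by rw [transpose_smul, doubleLaplacian, weightLaplacian_transpose])
    transpose_one fun x => ?_
  rw [smul_mulVec, dotProduct_smul, smul_eq_mul, doubleLaplacian_dotProduct, sum_sq_eq_dotProduct,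
    inv_mul_le_iff₀ (by positivity)]
  have h0 : 0 ≤ ∑ h, x h ^ 2 := Finset.sum_nonneg fun _ _ => sq_nonneg _
  calc ∑ s ∈ S, translationEnergy s x ≤ ∑ _s ∈ S, 4 * ∑ h, x h ^ 2 :=
        Finset.sum_le_sum fun s _ => translationEnergy_le_sum_sq s x
    _ = S.card * (4 * ∑ h, x h ^ 2) := by rw [Finset.sum_const, nsmul_eq_mul]
    _ ≤ Fintype.card G * (4 * ∑ h, x h ^ 2) := by
        gcongr
        exact Finset.card_le_univ S
    _ = _ := by ring

theorem cayleyPreconditioner_posDef (S : Finset G) : (cayleyPreconditioner S).PosDef := by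
  have hN : (0 : ℝ) < Fintype.card G := by exact_mod_cast Fintype.card_pos
  refine neumannSum_posDef (by positivity) (smul_doubleLaplacian_le_one S) ?_
  have := Fintype.card_pos (α := G)
  positivity

/-- With step 1/(4N) the Poincaré inequality gives the relative gap 1/(2N³), so 2N³ terms of the
series halve the error. Up to a factor 2, comparison with the inverse preconditioner is then the
same as comparison with T, for all combinations of generator Laplacians, since these annihilate
constants. -/
theorem cayleyPreconditioner_spec {S : Finset G} (hS : ∀ s ∈ S, s⁻¹ ∈ S)
    (hgen : Subgroup.closure (S : Set G) = ⊤) :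
    doubleLaplacian ℝ S ≤ (cayleyPreconditioner S)⁻¹ ∧ ∀ (w : G → ℝ) (δ : ℝ), 0 ≤ δ →
      weightLaplacian ℝ w ≤ δ • (cayleyPreconditioner S)⁻¹ →
      weightLaplacian ℝ w ≤ (2 * δ) • doubleLaplacian ℝ S := by
  have hN1 : 1 ≤ Fintype.card G := Fintype.card_pos
  have hN : (0 : ℝ) < Fintype.card G := by exact_mod_cast hN1
  have hJt : (constProjection G)ᵀ = constProjection G := by
    ext i j; simp [constProjection]
  have hJJ : constProjection G * constProjection G = constProjection G := by
    ext i j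
    simp only [constProjection, mul_apply, Matrix.smul_apply, of_apply, smul_eq_mul, mul_one,
      Finset.sum_const, Finset.card_univ, nsmul_eq_mul]
    field_simp
  have hWJ : ∀ w : G → ℝ, weightLaplacian ℝ w * constProjection G = 0 := by
    intro w
    rw [constProjection, mul_smul_comm, weightLaplacian_mul_one, smul_zero]
  have hgap : (2 * (Fintype.card G : ℝ) ^ 3)⁻¹ • (1 - constProjection G)
      ≤ (4 * Fintype.card G : ℝ)⁻¹ • doubleLaplacian ℝ S := by
    refine le_of_quadratic (by rw [transpose_smul, transpose_sub, transpose_one, hJt])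
      (by rw [transpose_smul, doubleLaplacian, weightLaplacian_transpose]) fun x => ?_
    rw [smul_mulVec, smul_mulVec, dotProduct_smul, dotProduct_smul, sub_mulVec, dotProduct_sub,
      sum_sq_eq_dotProduct, constProjection_dotProduct, doubleLaplacian_dotProduct, smul_eq_mul,
      smul_eq_mul]
    have h1 := card_mul_sum_sq_sub_le hS hgen x
    rw [inv_mul_le_iff₀ (by positivity)]
    have h2 : (2 * (Fintype.card G : ℝ) ^ 3) * ((4 * Fintype.card G : ℝ)⁻¹
        * ∑ s ∈ S, translationEnergy s x)
        = (2 * (Fintype.card G : ℝ))⁻¹ * ((Fintype.card G : ℝ) ^ 3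
          * ∑ s ∈ S, translationEnergy s x) := by
      field_simp; ring
    rw [h2]
    calc ∑ h, x h ^ 2 - (Fintype.card G : ℝ)⁻¹ * (∑ h, x h) ^ 2
        = (2 * (Fintype.card G : ℝ))⁻¹ * (2 * (Fintype.card G * ∑ h, x h ^ 2)
          - 2 * (∑ h, x h) ^ 2) := by field_simp
      _ ≤ _ := by gcongr
  have hγ1 : (2 * (Fintype.card G : ℝ) ^ 3)⁻¹ ≤ 1 := by
    refine inv_le_one_of_one_le₀ ?_
    have : (1 : ℝ) ≤ (Fintype.card G : ℝ) ^ 3 := one_le_pow₀ (by exact_mod_cast hN1)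
    linarith
  have hm : (1 : ℝ) ≤ (2 * Fintype.card G ^ 3 : ℕ) * (2 * (Fintype.card G : ℝ) ^ 3)⁻¹ := by
    push_cast
    rw [mul_inv_cancel₀ (by positivity)]
  have key := neumannSum_spec (m := 2 * Fintype.card G ^ 3) (by positivity)
    (doubleLaplacian_nonneg S) (smul_doubleLaplacian_le_one S) hJt hJJ (hWJ _) (by positivity) hγ1
    hgap hm
  exact ⟨key.1, fun w δ hδ h => key.2 _ δ hδ (weightLaplacian_transpose ℝ w) (hWJ w) h⟩

end CayleyPreconditioner

section Greedy

set_option linter.unusedSectionVars false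

open Matrix
open scoped MatrixOrder

variable {G : Type u} [Group G] [Fintype G] [DecidableEq G]

/-! ## The greedy algorithm over the integers -/

/-- The numerator of the Neumann sum for `Cay(G, S)` over the common denominator
`(4 |G|) ^ j`. -/
def intPreconditioner (S : Finset G) : ℕ → Matrix G G ℤ
  | 0 => 0
  | j + 1 => ((4 * Fintype.card G : ℤ) • 1 - doubleLaplacian ℤ S) * intPreconditioner S j
      + ((4 * Fintype.card G : ℤ) ^ j) • 1

theorem map_generatorLaplacian (g : G) :
    (generatorLaplacian ℤ g).map (Int.cast : ℤ → ℝ) = generatorLaplacian ℝ g := by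
  ext i j
  simp [generatorLaplacian]

theorem map_weightLaplacian (w : G → ℤ) :
    (weightLaplacian ℤ w).map (Int.cast : ℤ → ℝ) = weightLaplacian ℝ fun g => (w g : ℝ) := by
  ext i j
  simp only [weightLaplacian, map_apply, Matrix.sum_apply, Matrix.smul_apply, smul_eq_mul,
    Int.cast_sum, Int.cast_mul, ← map_generatorLaplacian]

theorem map_zsmul_one (z : ℤ) :
    ((z • 1 : Matrix G G ℤ)).map (Int.cast : ℤ → ℝ) = (z : ℝ) • 1 := by
  ext a b
  rw [map_apply, Matrix.smul_apply, Matrix.smul_apply, one_apply, one_apply]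
  split_ifs <;> simp

theorem map_intCast_mul (A B : Matrix G G ℤ) : (A * B).map (Int.cast : ℤ → ℝ)
    = A.map (Int.cast : ℤ → ℝ) * B.map (Int.cast : ℤ → ℝ) :=
  Matrix.map_mul (f := Int.castRingHom ℝ)

theorem map_doubleLaplacian (S : Finset G) :
    (doubleLaplacian ℤ S).map (Int.cast : ℤ → ℝ) = doubleLaplacian ℝ S := by
  rw [doubleLaplacian, map_weightLaplacian, doubleLaplacian]
  congr 1
  ext g
  simp [finsetIndicator]

/-- Multiplying the Neumann recursion at j + 1 by (4N)^(j+1) clears its denominators and gives the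
integer recursion. -/
theorem map_intPreconditioner (S : Finset G) (j : ℕ) :
    (intPreconditioner S j).map (Int.cast : ℤ → ℝ) = (4 * Fintype.card G : ℝ) ^ j •
      neumannSum (4 * Fintype.card G : ℝ)⁻¹ (doubleLaplacian ℝ S) j := by
  have hN : (4 * Fintype.card G : ℝ) ≠ 0 := by
    have : (0 : ℝ) < Fintype.card G := by exact_mod_cast Fintype.card_pos
    positivity
  induction j with
  | zero => ext; simp [intPreconditioner, neumannSum]
  | succ j ih =>
    have h1 : (intPreconditioner S (j + 1)).map (Int.cast : ℤ → ℝ)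
        = ((4 * Fintype.card G : ℝ) • 1 - doubleLaplacian ℝ S)
          * (intPreconditioner S j).map (Int.cast : ℤ → ℝ) + (4 * Fintype.card G : ℝ) ^ j • 1 := by
      rw [intPreconditioner, Matrix.map_add _ Int.cast_add, map_intCast_mul,
        Matrix.map_sub _ Int.cast_sub, map_zsmul_one, map_zsmul_one, map_doubleLaplacian]
      push_cast
      rfl
    have h2 : (4 * Fintype.card G : ℝ) • 1 - doubleLaplacian ℝ S = (4 * Fintype.card G : ℝ) •
        (1 - (4 * Fintype.card G : ℝ)⁻¹ • doubleLaplacian ℝ S) := by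
      rw [smul_sub, smul_smul, mul_inv_cancel₀ hN, one_smul]
    rw [h1, ih, neumannSum, smul_add, smul_smul, pow_succ, mul_assoc, mul_inv_cancel₀ hN, mul_one,
      h2, smul_mul_smul_comm, mul_comm (4 * Fintype.card G : ℝ)]

/-- The number of rounds of the greedy algorithm. -/
def greedyRounds (l h E : ℕ) : ℕ := 4096 * l ^ 3 * h * E ^ 2

/-- The exponent in the potential of the greedy algorithm. -/
def greedyExponent (l E : ℕ) : ℕ := 32 * l * E

/-- The signed weights in the deviation from `Cay(G, S)` after `t` rounds. -/
def deviationWeight (S : Finset G) (l h : ℕ) (V : G → ℤ) (t : ℕ) (g : G) : ℤ :=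
  l * h * V g - t * finsetIndicator ℤ S g

/-- The preconditioned deviation from `Cay(G, S)` after `t` rounds. -/
def intDeviation (S : Finset G) (l h : ℕ) (V : G → ℤ) (t : ℕ) : Matrix G G ℤ :=
  intPreconditioner S (2 * Fintype.card G ^ 3) * weightLaplacian ℤ (deviationWeight S l h V t)

/-- The common denominator of the entries of the deviation matrix. -/
def intScale (G : Type u) [Fintype G] (l h E : ℕ) : ℤ :=
  2 * greedyRounds l h E * (4 * Fintype.card G : ℤ) ^ (2 * Fintype.card G ^ 3)

/-- The potential of the greedy algorithm, multiplied by its denominator. -/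
def intPotential (S : Finset G) (l h E : ℕ) (V : G → ℤ) (t : ℕ) : ℤ :=
  ((intScale G l h E • 1 + intDeviation S l h V t) ^ greedyExponent l E).trace
    + ((intScale G l h E • 1 - intDeviation S l h V t) ^ greedyExponent l E).trace

/-- The multiplicities `V` after adding `c` copies of the generator `s`. -/
def addGenerator (S : Finset G) (V : G → ℤ) (s : G) (c : ℕ) (g : G) : ℤ :=
  V g + if g = s then c * finsetIndicator ℤ S s else 0

/-- One round of the greedy algorithm: `V'` minimizes the potential among the candidates. -/
def IsGreedyStep (S : Finset G) (l h E t : ℕ) (V V' : G → ℤ) : Prop :=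
  (∃ s c, c ≤ Fintype.card G ∧ V' = addGenerator S V s c) ∧
    ∀ s c, c ≤ Fintype.card G →
      intPotential S l h E V' (t + 1) ≤ intPotential S l h E (addGenerator S V s c) (t + 1)

/-- Validity of the parameters of the greedy algorithm. -/
structure IsGreedyParam (S : Finset G) (l h E : ℕ) : Prop where
  card_le : 2 * Fintype.card G ≤ 2 ^ l
  card_lt : S.card < 2 ^ h
  pos : 0 < E
  exponent : ∃ q, greedyExponent l E = 2 ^ q

namespace IsGreedyParam

variable {S : Finset G} {l h E : ℕ} (H : IsGreedyParam S l h E)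
include H

theorem l_pos : 0 < l := by
  have h1 := H.card_le
  have h2 : 0 < Fintype.card G := Fintype.card_pos
  rcases Nat.eq_zero_or_pos l with rfl | h3
  · simp at h1; omega
  · exact h3

end IsGreedyParam

/-- The square root of the preconditioner. -/
noncomputable def sqrtPreconditioner (S : Finset G) : Matrix G G ℝ :=
  CFC.sqrt (cayleyPreconditioner S)

/-- The normalized deviation matrix of weights `w`. -/
noncomputable def normalizedLaplacian (S : Finset G) (w : G → ℝ) : Matrix G G ℝ :=
  sqrtPreconditioner S * weightLaplacian ℝ w * sqrtPreconditioner S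

theorem sqrtPreconditioner_transpose (S : Finset G) :
    (sqrtPreconditioner S)ᵀ = sqrtPreconditioner S :=
  transpose_eq_of_nonneg (CFC.sqrt_nonneg _)

theorem sqrtPreconditioner_mul_self (S : Finset G) :
    sqrtPreconditioner S * sqrtPreconditioner S = cayleyPreconditioner S :=
  CFC.sqrt_mul_sqrt_self _ (cayleyPreconditioner_posDef S).posSemidef.nonneg

theorem isUnit_det_sqrtPreconditioner (S : Finset G) : IsUnit (sqrtPreconditioner S).det := by
  have h1 : IsUnit (sqrtPreconditioner S * sqrtPreconditioner S).det := by
    rw [sqrtPreconditioner_mul_self]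
    exact (isUnit_iff_isUnit_det _).1 (cayleyPreconditioner_posDef S).isUnit
  rw [det_mul] at h1
  exact isUnit_of_mul_isUnit_left h1

theorem sqrtPreconditioner_inv_mul_inv (S : Finset G) :
    (sqrtPreconditioner S)⁻¹ * (sqrtPreconditioner S)⁻¹ = (cayleyPreconditioner S)⁻¹ := by
  rw [← Matrix.mul_inv_rev, sqrtPreconditioner_mul_self]

theorem normalizedLaplacian_transpose (S : Finset G) (w : G → ℝ) :
    (normalizedLaplacian S w)ᵀ = normalizedLaplacian S w := by
  simp only [normalizedLaplacian, transpose_mul, sqrtPreconditioner_transpose,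
    weightLaplacian_transpose, mul_assoc]

theorem weightLaplacian_le_of_normalized_le {S : Finset G} {w : G → ℝ} {δ : ℝ}
    (h : normalizedLaplacian S w ≤ δ • 1) :
    weightLaplacian ℝ w ≤ δ • (cayleyPreconditioner S)⁻¹ := by
  have hdet := isUnit_det_sqrtPreconditioner S
  have h1 := conj_le_conj_of_symm h (C := (sqrtPreconditioner S)⁻¹)
    (by rw [transpose_nonsing_inv, sqrtPreconditioner_transpose])
  rw [mul_smul_comm, mul_one, smul_mul_assoc, sqrtPreconditioner_inv_mul_inv] at h1
  have h2 : (sqrtPreconditioner S)⁻¹ * normalizedLaplacian S w * (sqrtPreconditioner S)⁻¹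
      = weightLaplacian ℝ w := by
    rw [normalizedLaplacian, ← mul_assoc, ← mul_assoc, nonsing_inv_mul _ hdet, one_mul, mul_assoc,
      mul_nonsing_inv _ hdet, mul_one]
  rwa [h2] at h1

/-- QL and Q^{1/2} L Q^{1/2} are similar through Q^{1/2}. The left side is rational and computable,
while the right side is symmetric and accessible to the potential argument. -/
theorem trace_precond_pow (S : Finset G) (c : ℝ) (w : G → ℝ) (p : ℕ) :
    ((1 + c • (cayleyPreconditioner S * weightLaplacian ℝ w)) ^ p).trace
      = ((1 + c • normalizedLaplacian S w) ^ p).trace := by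
  have hdet := isUnit_det_sqrtPreconditioner S
  set R := sqrtPreconditioner S with hR
  have h1 : 1 + c • (cayleyPreconditioner S * weightLaplacian ℝ w)
      = (R * (1 + c • normalizedLaplacian S w)) * R⁻¹ := by
    rw [mul_add, mul_one, add_mul, mul_nonsing_inv _ hdet, normalizedLaplacian, ← hR,
      mul_smul_comm, smul_mul_assoc, ← sqrtPreconditioner_mul_self, ← hR]
    simp only [mul_assoc, mul_nonsing_inv _ hdet, mul_one]
  rw [h1, trace_mul_pow_comm, ← mul_assoc, nonsing_inv_mul _ hdet, one_mul]

theorem weightLaplacian_smul (c : ℝ) (w : G → ℝ) :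
    weightLaplacian ℝ (fun g => c * w g) = c • weightLaplacian ℝ w := by
  simp only [weightLaplacian, Finset.smul_sum, smul_smul]

/-- The integer potential is the real one times a positive constant that does not depend on the
candidate, so minimizing one minimizes the other. -/
theorem intPotential_cast {S : Finset G} {l h E : ℕ} (V : G → ℤ) (t : ℕ)
    (hK : 0 < greedyRounds l h E) :
    (intPotential S l h E V t : ℝ) = (intScale G l h E : ℝ) ^ greedyExponent l E *
      potential (greedyExponent l E) (normalizedLaplacian S fun g =>
        (greedyRounds l h E : ℝ)⁻¹ * (deviationWeight S l h V t g : ℝ)) := by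
  have hN : (0 : ℝ) < Fintype.card G := by exact_mod_cast Fintype.card_pos
  have hK' : (0 : ℝ) < greedyRounds l h E := by exact_mod_cast hK
  set z := intScale G l h E with hz
  set p := greedyExponent l E with hp
  set w : G → ℝ := fun g => (greedyRounds l h E : ℝ)⁻¹ * (deviationWeight S l h V t g : ℝ) with hw
  -- The scale 2K(4N)^(2N³) combines the factor 1/2 of the potential, the division by the number K
  -- of rounds, and the denominator of the preconditioner.
  have hF : (intDeviation S l h V t).map (Int.cast : ℤ → ℝ)
      = (z : ℝ) • ((1 / 2 : ℝ) • (cayleyPreconditioner S * weightLaplacian ℝ w)) := by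
    have h1 : (intDeviation S l h V t).map (Int.cast : ℤ → ℝ)
        = (intPreconditioner S (2 * Fintype.card G ^ 3)).map (Int.cast : ℤ → ℝ)
          * (weightLaplacian ℤ (deviationWeight S l h V t)).map (Int.cast : ℤ → ℝ) := by
      rw [intDeviation, map_intCast_mul]
    rw [h1, map_intPreconditioner, map_weightLaplacian, hw, weightLaplacian_smul, hz, intScale,
      cayleyPreconditioner, smul_mul_assoc, mul_smul_comm, smul_smul, smul_smul]
    congr 1
    push_cast
    field_simp
  have hcast : ∀ M : Matrix G G ℤ, ((M ^ p).trace : ℝ)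
      = ((M.map (Int.cast : ℤ → ℝ)) ^ p).trace := by
    intro M
    have h1 : (M ^ p).map (Int.castRingHom ℝ) = (M.map (Int.castRingHom ℝ)) ^ p :=
      (Matrix.map_pow M _ p)
    have h2 := (AddMonoidHom.map_trace (Int.castRingHom ℝ).toAddMonoidHom (M ^ p))
    change (Int.castRingHom ℝ) (M ^ p).trace = _
    change ((Int.castRingHom ℝ)) _ = _ at h2
    rw [h2]
    exact congrArg trace h1
  rw [intPotential, Int.cast_add, ← hz, ← hp, hcast, hcast, Matrix.map_add _ Int.cast_add,
    Matrix.map_sub _ Int.cast_sub, map_zsmul_one, hF, ← smul_add, ← smul_sub, smul_pow, smul_pow,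
    trace_smul, trace_smul, smul_eq_mul, smul_eq_mul, trace_precond_pow, potential, mul_add]
  congr 2
  rw [sub_eq_add_neg, ← neg_smul, trace_precond_pow, neg_smul, ← sub_eq_add_neg]

theorem weightLaplacian_add (v w : G → ℝ) :
    weightLaplacian ℝ (fun g => v g + w g) = weightLaplacian ℝ v + weightLaplacian ℝ w := by
  simp only [weightLaplacian, add_smul, Finset.sum_add_distrib]

theorem weightLaplacian_single (s : G) (c : ℝ) :
    weightLaplacian ℝ (fun g => if g = s then c else 0) = c • generatorLaplacian ℝ s := by
  simp [weightLaplacian, ite_smul]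

theorem generatorLaplacian_one (R : Type*) [CommRing R] : generatorLaplacian R (1 : G) = 0 := by
  ext i j
  simp only [generatorLaplacian, of_apply, mul_one, eq_comm (a := j) (b := i), Matrix.zero_apply]
  ring

/-- The identity contributes only loops; it has to be discarded because the layering applies to sets
without it. -/
theorem doubleLaplacian_eq_sum_erase (S : Finset G) :
    doubleLaplacian ℝ S = ∑ s ∈ S.erase 1, generatorLaplacian ℝ s := by
  have h1 : doubleLaplacian ℝ S = ∑ s ∈ S, generatorLaplacian ℝ s := by
    simp [doubleLaplacian, weightLaplacian, finsetIndicator, ite_smul]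
  rw [h1, Finset.sum_erase _ (generatorLaplacian_one ℝ)]

/-- Some candidate increases the potential by at most the expected factor. -/
theorem exists_intPotential_le {S : Finset G} {l h E : ℕ} (H : IsGreedyParam S l h E)
    (hS : ∀ s ∈ S, s⁻¹ ∈ S) (hgen : Subgroup.closure (S : Set G) = ⊤) (hh : 0 < h)
    (V : G → ℤ) (t : ℕ)
    (hY1 : normalizedLaplacian S (fun g =>
        (greedyRounds l h E : ℝ)⁻¹ * (deviationWeight S l h V t g : ℝ)) ≤ 1)
    (hY2 : -1 ≤ normalizedLaplacian S fun g =>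
        (greedyRounds l h E : ℝ)⁻¹ * (deviationWeight S l h V t g : ℝ)) :
    ∃ s c, c ≤ Fintype.card G ∧
      (intPotential S l h E (addGenerator S V s c) (t + 1) : ℝ)
        ≤ (1 + l / greedyRounds l h E) * intPotential S l h E V t := by
  have hl := H.l_pos
  have hE := H.pos
  have hK : 0 < greedyRounds l h E := by unfold greedyRounds; positivity
  have hK' : (0 : ℝ) < greedyRounds l h E := by exact_mod_cast hK
  have hl' : (1 : ℝ) ≤ l := by exact_mod_cast hl
  have hh' : (1 : ℝ) ≤ h := by exact_mod_cast hh
  have hE' : (1 : ℝ) ≤ E := by exact_mod_cast hE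
  set K : ℝ := (greedyRounds l h E : ℝ) with hKdef
  have hKval : K = 4096 * (l : ℝ) ^ 3 * h * E ^ 2 := by
    rw [hKdef, greedyRounds]; push_cast; ring
  set R := sqrtPreconditioner S with hR
  have hRt : Rᵀ = R := sqrtPreconditioner_transpose S
  set A := S.erase 1 with hA
  have hcardA : A.card ≤ S.card := Finset.card_le_card (Finset.erase_subset _ _)
  have hpos : 0 < Fintype.card G := Fintype.card_pos
  obtain ⟨c, hc1, hc2, hc3⟩ := exists_layering (l := l)
    (lt_of_lt_of_le (by omega) H.card_le) A (Finset.notMem_erase 1 S)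
  have hsum := sum_inv_layer_le A c hc1 hc2 (hcardA.trans_lt H.card_lt)
  have h1A : (1 : G) ∉ A := Finset.notMem_erase 1 S
  -- The identity serves as the null candidate: it has multiplicity 0 and absorbs the probability
  -- left over by the other generators.
  set c' : G → ℕ := fun s => if s = 1 then 0 else c s with hc'
  have hc'A : ∀ s ∈ A, c' s = c s := fun s hs => if_neg (Finset.ne_of_mem_erase hs)
  -- Probability 1/(c(s)lh) against increment lh c(s)/K makes each generator contribute its
  -- Laplacian over K to the mean, so the mean increment is T/K. The probabilities sum to at most 1
  -- by `sum_inv_layer_le`.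
  set π : G → ℝ := fun s => if s = 1 then 1 - ∑ s ∈ A, ((c s : ℝ)⁻¹ * (l * h : ℝ)⁻¹)
    else (c s : ℝ)⁻¹ * (l * h : ℝ)⁻¹ with hπ
  have hπA : ∀ s ∈ A, π s = (c s : ℝ)⁻¹ * (l * h : ℝ)⁻¹ :=
    fun s hs => if_neg (Finset.ne_of_mem_erase hs)
  have hlh : (0 : ℝ) < l * h := by positivity
  set X : G → Matrix G G ℝ := fun s =>
    (l * h * c' s * K⁻¹ : ℝ) • (R * generatorLaplacian ℝ s * R) with hX
  have hRTR : R * doubleLaplacian ℝ S * R ≤ 1 := by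
    have hdet := isUnit_det_sqrtPreconditioner S
    have h1 := conj_le_conj_of_symm (cayleyPreconditioner_spec hS hgen).1 hRt
    rwa [← sqrtPreconditioner_inv_mul_inv, ← hR, ← mul_assoc, mul_nonsing_inv _ hdet, one_mul,
      nonsing_inv_mul _ hdet] at h1
  have hD0 : ∀ s : G, 0 ≤ generatorLaplacian ℝ s := fun s => by
    refine le_of_quadratic (by simp) (generatorLaplacian_transpose ℝ s) fun x => ?_
    rw [generatorLaplacian_dotProduct, zero_mulVec, dotProduct_zero]
    exact translationEnergy_nonneg s x
  have hprob : ∑ s ∈ A, ((c s : ℝ)⁻¹ * (l * h : ℝ)⁻¹) ≤ 1 := by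
    rw [← Finset.sum_mul, ← div_eq_mul_inv, div_le_one hlh]
    exact hsum
  have hT : doubleLaplacian ℝ S = ∑ s ∈ A, generatorLaplacian ℝ s := doubleLaplacian_eq_sum_erase S
  have hex : ∃ s ∈ insert 1 A, potential (greedyExponent l E)
      (normalizedLaplacian S (fun g => K⁻¹ * (deviationWeight S l h V t g : ℝ))
        + (X s - K⁻¹ • (R * doubleLaplacian ℝ S * R)))
      ≤ (1 + (greedyExponent l E : ℝ) ^ 2 * (4 * l * (l * h) * K⁻¹ * K⁻¹)) *
        potential (greedyExponent l E)
          (normalizedLaplacian S fun g => K⁻¹ * (deviationWeight S l h V t g : ℝ)) := by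
    refine exists_potential_add_le (insert 1 A) π X H.exponent ?_ ?_ hY1 hY2 ?_ ?_ ?_ ?_ ?_ ?_ ?_
    · intro s hs
      rcases Finset.mem_insert.1 hs with rfl | hsA
      · simp only [hπ, if_true]; linarith
      · rw [hπA s hsA]; positivity
    · rw [Finset.sum_insert h1A, Finset.sum_congr rfl hπA]
      simp [hπ]
    · intro s _
      exact smul_nonneg (by positivity) (conj_nonneg_of_symm (hD0 s) hRt)
    · intro s hs
      rcases Finset.mem_insert.1 hs with rfl | hsA
      · simp only [hX, hc', if_true, Nat.cast_zero, mul_zero, zero_mul, zero_smul]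
        exact smul_nonneg (by positivity) zero_le_one
      · have h1 : (c s : ℝ) • generatorLaplacian ℝ s ≤ (4 * l : ℝ) • doubleLaplacian ℝ S := by
          refine le_of_quadratic (by rw [transpose_smul, generatorLaplacian_transpose])
            (by rw [transpose_smul, doubleLaplacian, weightLaplacian_transpose]) fun x => ?_
          rw [smul_mulVec, smul_mulVec, dotProduct_smul, dotProduct_smul,
            generatorLaplacian_dotProduct, doubleLaplacian_dotProduct, smul_eq_mul, smul_eq_mul]
          refine (hc3 s hsA x).trans ?_
          gcongr
          · exact fun t _ _ => translationEnergy_nonneg t x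
          · exact Finset.erase_subset _ _
        have h2 := conj_le_conj_of_symm h1 hRt
        rw [mul_smul_comm, smul_mul_assoc, mul_smul_comm, smul_mul_assoc] at h2
        have h3 := h2.trans (smul_le_smul_of_nonneg_left hRTR (by positivity : (0 : ℝ) ≤ 4 * l))
        have h4 := smul_le_smul_of_nonneg_left h3 (by positivity : (0 : ℝ) ≤ l * h * K⁻¹)
        rw [smul_smul, smul_smul] at h4
        simp only [hX, hc'A s hsA]
        calc (l * h * c s * K⁻¹ : ℝ) • (R * generatorLaplacian ℝ s * R)
            = (l * h * K⁻¹ * c s : ℝ) • (R * generatorLaplacian ℝ s * R) := by congr 1; ring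
          _ ≤ _ := h4
          _ = _ := by congr 1; ring
    · positivity
    · calc K⁻¹ = 1 * K⁻¹ := (one_mul _).symm
        _ ≤ 4 * l * (l * h) * K⁻¹ := by
          gcongr
          nlinarith [mul_le_mul hl' hh' zero_le_one (by linarith)]
    -- Here pβ = 1/(32E), well below the required 1.
    · rw [hKval, greedyExponent]
      push_cast
      have : (32 * l * E : ℝ) * (4 * l * (l * h) * (4096 * (l : ℝ) ^ 3 * h * E ^ 2)⁻¹)
        = (32 * E : ℝ)⁻¹ := by field_simp; norm_num
      rw [this]
      exact inv_le_one_of_one_le₀ (by linarith)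
    · rw [Finset.sum_insert h1A]
      have h1 : X 1 = 0 := by simp [hX, hc']
      rw [h1, smul_zero, zero_add, hT, Finset.mul_sum, Finset.sum_mul, Finset.smul_sum]
      refine Finset.sum_congr rfl fun s hs => ?_
      have hcs : (0 : ℝ) < c s := by exact_mod_cast (hc1 s hs).1
      simp only [hX]
      rw [hπA s hs, hc'A s hs, smul_smul]
      congr 1
      field_simp
    · exact smul_le_smul_of_nonneg_left hRTR (by positivity)
  obtain ⟨s, hs, hpot⟩ := hex
  have hsS : s = 1 ∨ s ∈ A := Finset.mem_insert.1 hs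
  refine ⟨s, c' s, ?_, ?_⟩
  · rcases hsS with rfl | hsA
    · simp [hc']
    · rw [hc'A s hsA]
      exact (hc1 s hsA).2.trans (Finset.card_le_univ A)
  · have hnew : normalizedLaplacian S (fun g => K⁻¹ *
        (deviationWeight S l h (addGenerator S V s (c' s)) (t + 1) g : ℝ))
        = normalizedLaplacian S (fun g => K⁻¹ * (deviationWeight S l h V t g : ℝ))
          + (X s - K⁻¹ • (R * doubleLaplacian ℝ S * R)) := by
      have h1 : (fun g => K⁻¹ *
          (deviationWeight S l h (addGenerator S V s (c' s)) (t + 1) g : ℝ))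
          = fun g => K⁻¹ * (deviationWeight S l h V t g : ℝ) +
            ((if g = s then (l * h * c' s * K⁻¹ : ℝ) else 0)
              + (-K⁻¹) * finsetIndicator ℝ S g) := by
        funext g
        have hind : (c' s : ℝ) * finsetIndicator ℝ S s = c' s := by
          rcases hsS with rfl | hsA
          · simp [hc']
          · rw [finsetIndicator, if_pos (Finset.mem_of_mem_erase hsA), mul_one]
        have hcast : ∀ g : G, ((finsetIndicator ℤ S g : ℤ) : ℝ) = finsetIndicator ℝ S g := by
          intro g; simp [finsetIndicator]
        by_cases hg : g = s
        · subst hg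
          simp only [deviationWeight, addGenerator, if_true]
          push_cast
          rw [hcast, hind]
          ring
        · simp only [deviationWeight, addGenerator, hg, if_false]
          push_cast
          rw [hcast]
          ring
      rw [h1, normalizedLaplacian, weightLaplacian_add, weightLaplacian_add,
        weightLaplacian_single, weightLaplacian_smul (-K⁻¹),
        show weightLaplacian ℝ (fun g => finsetIndicator ℝ S g) = doubleLaplacian ℝ S from rfl, ← hR,
        normalizedLaplacian, ← hR, mul_add, add_mul, mul_add, add_mul, hX]
      simp only [mul_smul_comm, smul_mul_assoc, neg_smul, mul_neg, neg_mul, sub_eq_add_neg]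
    rw [intPotential_cast _ _ hK, intPotential_cast _ _ hK, ← hKdef, hnew]
    have hz : (0 : ℝ) ≤ (intScale G l h E : ℝ) ^ greedyExponent l E := by
      refine pow_nonneg ?_ _
      rw [intScale]; push_cast; positivity
    -- The number of rounds is chosen for this identity: p²βv with v = 1/K equals 4096 l⁴hE²/K² =
    -- l/K, so K rounds cost a total factor of at most e^l.
    have hfac : (greedyExponent l E : ℝ) ^ 2 * (4 * l * (l * h) * K⁻¹ * K⁻¹) = l / K := by
      rw [hKval, greedyExponent]; push_cast; field_simp; norm_num
    rw [hfac] at hpot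
    calc _ ≤ (intScale G l h E : ℝ) ^ greedyExponent l E * _ :=
          mul_le_mul_of_nonneg_left hpot hz
      _ = _ := by ring

end Greedy

section GreedyAnalysis

set_option linter.unusedSectionVars false

open Matrix
open scoped MatrixOrder

variable {G : Type u} [Group G] [Fintype G] [DecidableEq G]

/-! ## Analysis of the greedy algorithm -/

/-- By Bernoulli (1 + 1/(4E))^(4E) ≥ 2, so the right side is at least 2^(8l), whereas 2^l e^l ≤ 6^l.
This is why the exponent 32lE suffices for the accuracy δ = 1/(2E). -/
theorem two_pow_mul_exp_le (l E : ℕ) (hE : 0 < E) :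
    (2 : ℝ) ^ l * Real.exp l ≤ (1 + (1 / (2 * E : ℝ)) / 2) ^ greedyExponent l E := by
  have hE' : (0 : ℝ) < E := by exact_mod_cast hE
  have h1 : (2 : ℝ) ≤ (1 + (1 / (2 * E : ℝ)) / 2) ^ (4 * E) := by
    have h0 : (0 : ℝ) ≤ (1 / (2 * E : ℝ)) / 2 := by positivity
    have := one_add_mul_le_pow (by linarith : (-2 : ℝ) ≤ (1 / (2 * E : ℝ)) / 2) (4 * E)
    have h2 : ((4 * E : ℕ) : ℝ) * ((1 / (2 * E : ℝ)) / 2) = 1 := by push_cast; field_simp; norm_num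
    linarith
  have h2 : Real.exp l ≤ 3 ^ l := by
    have := Real.exp_nat_mul 1 l
    rw [mul_one] at this
    rw [this]
    exact pow_le_pow_left₀ (Real.exp_pos 1).le (by linarith [Real.exp_one_lt_d9]) l
  calc (2 : ℝ) ^ l * Real.exp l ≤ 2 ^ l * 3 ^ l := by gcongr
    _ = 6 ^ l := by rw [← mul_pow]; norm_num
    _ ≤ (2 ^ 8) ^ l := pow_le_pow_left₀ (by norm_num) (by norm_num) l
    _ = 2 ^ (8 * l) := by rw [← pow_mul]
    _ ≤ ((1 + (1 / (2 * E : ℝ)) / 2) ^ (4 * E)) ^ (8 * l) := pow_le_pow_left₀ (by norm_num) h1 _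
    _ = _ := by rw [← pow_mul, greedyExponent]; congr 1; ring

variable {S : Finset G} {l h E : ℕ}

theorem IsGreedyParam.rounds_pos (H : IsGreedyParam S l h E) (hh : 0 < h) :
    0 < greedyRounds l h E := by
  have h1 := H.l_pos
  have h2 := H.pos
  unfold greedyRounds
  positivity

/-- The budget 2^l e^l lies below (1 + δ/2)^p for δ = 1/(2E). The conclusion is the final accuracy
and, since δ ≤ 1, also the hypothesis |Y| ≤ 1 needed to carry out the next round. -/
theorem normalizedLaplacian_bounds_of_intPotential_le (H : IsGreedyParam S l h E) (hh : 0 < h)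
    (V : G → ℤ) (t : ℕ)
    (hb : (intPotential S l h E V t : ℝ)
      ≤ (intScale G l h E : ℝ) ^ greedyExponent l E * (2 ^ l * Real.exp l)) :
    normalizedLaplacian S (fun g =>
        (greedyRounds l h E : ℝ)⁻¹ * (deviationWeight S l h V t g : ℝ)) ≤ (1 / (2 * E : ℝ)) • 1 ∧
    -((1 / (2 * E : ℝ)) • 1) ≤ normalizedLaplacian S (fun g =>
        (greedyRounds l h E : ℝ)⁻¹ * (deviationWeight S l h V t g : ℝ)) := by
  have hK := H.rounds_pos hh
  have hK' : (0 : ℝ) < greedyRounds l h E := by exact_mod_cast hK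
  have hN : (0 : ℝ) < Fintype.card G := by exact_mod_cast Fintype.card_pos
  have hl := H.l_pos
  have hE := H.pos
  rw [intPotential_cast V t hK] at hb
  have hz : (0 : ℝ) < (intScale G l h E : ℝ) ^ greedyExponent l E := by
    refine pow_pos ?_ _
    rw [intScale]; push_cast; positivity
  refine le_of_potential_le ?_ ?_ (normalizedLaplacian_transpose S _) (by positivity)
    ((le_of_mul_le_mul_left hb hz).trans (two_pow_mul_exp_le l E hE))
  · rw [greedyExponent]; exact ⟨16 * l * E, by ring⟩
  · rw [greedyExponent]; positivity

theorem intPotential_zero (hK : 0 < greedyRounds l h E) :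
    (intPotential S l h E 0 0 : ℝ)
      = (intScale G l h E : ℝ) ^ greedyExponent l E * (2 * Fintype.card G) := by
  rw [intPotential_cast _ _ hK]
  have h1 : normalizedLaplacian S (fun g =>
      (greedyRounds l h E : ℝ)⁻¹ * (deviationWeight S l h 0 0 g : ℝ)) = 0 := by
    simp [normalizedLaplacian, deviationWeight, weightLaplacian]
  rw [h1, potential]
  simp [two_mul]

/-- The potential starts at 2N ≤ 2^l and grows by at most 1 + l/K per round. Bound and norm control
must be proved together: the bound after t rounds gives |Y| ≤ 1, which makes a good candidate
available in round t + 1. -/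
theorem greedy_intPotential_le (H : IsGreedyParam S l h E) (hh : 0 < h)
    (hS : ∀ s ∈ S, s⁻¹ ∈ S) (hgen : Subgroup.closure (S : Set G) = ⊤) (V : ℕ → G → ℤ)
    (h0 : V 0 = 0) (hV : ∀ t < greedyRounds l h E, IsGreedyStep S l h E t (V t) (V (t + 1)))
    (t : ℕ) (ht : t ≤ greedyRounds l h E) :
    (intPotential S l h E (V t) t : ℝ)
      ≤ (intScale G l h E : ℝ) ^ greedyExponent l E * (2 ^ l * Real.exp l) := by
  have hK := H.rounds_pos hh
  have hK' : (0 : ℝ) < greedyRounds l h E := by exact_mod_cast hK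
  have hE : (1 : ℝ) ≤ E := by exact_mod_cast H.pos
  have hN : (0 : ℝ) < Fintype.card G := by exact_mod_cast Fintype.card_pos
  have hz : (0 : ℝ) < (intScale G l h E : ℝ) ^ greedyExponent l E := by
    refine pow_pos ?_ _
    rw [intScale]; push_cast; positivity
  have hcard : (2 * Fintype.card G : ℝ) ≤ 2 ^ l := by exact_mod_cast H.card_le
  have hfac : ∀ t ≤ greedyRounds l h E, (1 + l / greedyRounds l h E : ℝ) ^ t ≤ Real.exp l := by
    intro t ht
    calc (1 + l / greedyRounds l h E : ℝ) ^ t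
        ≤ (1 + l / greedyRounds l h E : ℝ) ^ greedyRounds l h E :=
          pow_le_pow_right₀ (le_add_of_nonneg_right (by positivity)) ht
      _ ≤ (Real.exp (l / greedyRounds l h E)) ^ greedyRounds l h E := by
          refine pow_le_pow_left₀ (by positivity) ?_ _
          linarith [Real.add_one_le_exp (l / greedyRounds l h E : ℝ)]
      _ = Real.exp l := by
          rw [← Real.exp_nat_mul, mul_div_cancel₀ _ hK'.ne']
  have hweak : ∀ t ≤ greedyRounds l h E, (1 + l / greedyRounds l h E : ℝ) ^ t *
      ((intScale G l h E : ℝ) ^ greedyExponent l E * (2 * Fintype.card G))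
      ≤ (intScale G l h E : ℝ) ^ greedyExponent l E * (2 ^ l * Real.exp l) := by
    intro t ht
    have h1 := hfac t ht
    have h2 : (2 * Fintype.card G : ℝ) * (1 + l / greedyRounds l h E : ℝ) ^ t
        ≤ 2 ^ l * Real.exp l := by gcongr
    calc _ = (intScale G l h E : ℝ) ^ greedyExponent l E *
          ((2 * Fintype.card G : ℝ) * (1 + l / greedyRounds l h E : ℝ) ^ t) := by ring
      _ ≤ _ := by gcongr
  have main : ∀ t ≤ greedyRounds l h E, (intPotential S l h E (V t) t : ℝ)
      ≤ (1 + l / greedyRounds l h E : ℝ) ^ t *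
        ((intScale G l h E : ℝ) ^ greedyExponent l E * (2 * Fintype.card G)) := by
    intro t
    induction t with
    | zero => intro _; rw [h0, intPotential_zero hK]; simp
    | succ t ih =>
      intro ht
      have ih' := ih (Nat.le_of_succ_le ht)
      obtain ⟨hY1, hY2⟩ := normalizedLaplacian_bounds_of_intPotential_le H hh (V t) t
        (ih'.trans (hweak t (Nat.le_of_succ_le ht)))
      have hδ : (1 / (2 * E : ℝ)) • (1 : Matrix G G ℝ) ≤ 1 := by
        have : (1 / (2 * E : ℝ)) ≤ 1 := by
          rw [div_le_one (by positivity)]; linarith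
        calc (1 / (2 * E : ℝ)) • (1 : Matrix G G ℝ) ≤ (1 : ℝ) • 1 :=
              smul_le_smul_of_nonneg_right this zero_le_one
          _ = 1 := one_smul _ _
      obtain ⟨s, c, hc, hle⟩ := exists_intPotential_le H hS hgen hh (V t) t (hY1.trans hδ)
        ((neg_le_neg hδ).trans hY2)
      have hmin : (intPotential S l h E (V (t + 1)) (t + 1) : ℝ)
          ≤ intPotential S l h E (addGenerator S (V t) s c) (t + 1) := by
        exact_mod_cast (hV t ht).2 s c hc
      calc _ ≤ _ := hmin
        _ ≤ _ := hle
        _ ≤ (1 + l / greedyRounds l h E : ℝ) * ((1 + l / greedyRounds l h E : ℝ) ^ t *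
            ((intScale G l h E : ℝ) ^ greedyExponent l E * (2 * Fintype.card G))) := by gcongr
        _ = _ := by rw [pow_succ]; ring
  exact (main t ht).trans (hweak t ht)

theorem greedy_support (V : ℕ → G → ℤ) (h0 : V 0 = 0)
    (hV : ∀ t < greedyRounds l h E, IsGreedyStep S l h E t (V t) (V (t + 1)))
    (t : ℕ) (ht : t ≤ greedyRounds l h E) :
    (∀ g, 0 ≤ V t g) ∧ (∀ g, g ∉ S → V t g = 0) ∧
      (Finset.univ.filter fun g => V t g ≠ 0).card ≤ t := by
  induction t with
  | zero => simp [h0]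
  | succ t ih =>
    obtain ⟨ih1, ih2, ih3⟩ := ih (Nat.le_of_succ_le ht)
    obtain ⟨⟨s, c, _, hs⟩, _⟩ := hV t ht
    rw [hs]
    refine ⟨fun g => ?_, fun g hg => ?_, ?_⟩
    · rw [addGenerator]
      have : (0 : ℤ) ≤ if g = s then c * finsetIndicator ℤ S s else 0 := by
        rw [finsetIndicator]; split_ifs <;> simp
      linarith [ih1 g]
    · rw [addGenerator, ih2 g hg]
      by_cases hgs : g = s
      · subst hgs; simp [finsetIndicator, hg]
      · simp [hgs]
    · calc _ ≤ (insert s (Finset.univ.filter fun g => V t g ≠ 0)).card := by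
            refine Finset.card_le_card fun g hg => ?_
            simp only [Finset.mem_filter, Finset.mem_univ, true_and, Finset.mem_insert] at hg ⊢
            by_contra! hcon
            rw [addGenerator, if_neg hcon.1, hcon.2] at hg
            exact hg rfl
        _ ≤ t + 1 := (Finset.card_insert_le _ _).trans (Nat.succ_le_succ ih3)

/-- The sum of generator Laplacians runs over all g, and each of its terms already contains both g
and g⁻¹, so for symmetric weights every edge is counted twice. -/
theorem cayleyLaplacian_eq_weightLaplacian (μ : S → ℝ≥0) (w : G → ℝ)
    (hw : ∀ g (hg : g ∈ S), w g = μ ⟨g, hg⟩) (hw0 : ∀ g, g ∉ S → w g = 0)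
    (hsym : ∀ g, w g⁻¹ = w g) :
    cayleyLaplacian S μ = (1 / 2 : ℝ) • weightLaplacian ℝ w := by
  have hadj : ∀ i j, cayleyAdjacency S μ i j = w (i⁻¹ * j) := by
    intro i j
    rw [cayleyAdjacency, of_apply]
    split_ifs with hs
    · rw [hw _ hs]
    · rw [hw0 _ hs]
  ext i j
  have hrow : ∑ j, cayleyAdjacency S μ i j = ∑ g, w g := by
    simp only [hadj]
    exact Equiv.sum_comp (Equiv.mulLeft i⁻¹) w
  have h1 : ∀ g, i * g = j ↔ g = i⁻¹ * j := fun g => by rw [eq_inv_mul_iff_mul_eq]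
  have h2 : ∀ g, j * g = i ↔ g = j⁻¹ * i := fun g => by rw [eq_inv_mul_iff_mul_eq]
  have h3 : w (j⁻¹ * i) = w (i⁻¹ * j) := by rw [← hsym (i⁻¹ * j)]; simp
  rw [cayleyLaplacian, weightedLaplacian, Matrix.sub_apply, diagonal_apply, hrow, hadj,
    Matrix.smul_apply, weightLaplacian, Matrix.sum_apply]
  simp only [Matrix.smul_apply, generatorLaplacian, of_apply, h1, h2, smul_eq_mul, mul_sub,
    Finset.sum_sub_distrib, mul_ite, mul_one, mul_zero, Finset.sum_ite_eq', Finset.mem_univ,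
    if_true, h3]
  split_ifs
  · rw [← Finset.sum_mul]; ring
  · simp; ring

/-- The weights computed by the greedy algorithm from the final multiplicities `V`. -/
noncomputable def greedyWeight (S : Finset G) (l h E : ℕ) (V : G → ℤ) (s : S) : ℝ≥0 :=
  Real.toNNReal ((l * h * (V s + V (s : G)⁻¹) : ℤ) / (2 * greedyRounds l h E : ℤ))

theorem cayleyLaplacian_one (hS : ∀ s ∈ S, s⁻¹ ∈ S) :
    cayleyLaplacian S 1 = (1 / 2 : ℝ) • doubleLaplacian ℝ S := by
  refine cayleyLaplacian_eq_weightLaplacian 1 _ ?_ ?_ ?_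
  · intro g hg; simp [finsetIndicator, hg]
  · intro g hg; simp [finsetIndicator, hg]
  · intro g
    have : g⁻¹ ∈ S ↔ g ∈ S := ⟨fun h => by simpa using hS _ h, hS g⟩
    simp [finsetIndicator, this]

/-- The second size bound follows from the first because |S| ≤ |G|. -/
theorem isCayleySparsifier_of_support_le {μ : S → ℝ≥0} {ε C : ℝ} (hC : 0 ≤ C)
    (hsym : ∀ s t : S, (t : G) = (s : G)⁻¹ → μ t = μ s)
    (hsupp : ((Function.support μ).ncard : ℝ) ≤
      C * (ε⁻¹ ^ 2 * logOne (Fintype.card G) ^ 3 * logOne S.card))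
    (happrox : SpectralApprox ε (cayleyLaplacian S μ) (cayleyLaplacian S 1)) :
    IsCayleySparsifier C S ε μ := by
  refine ⟨hsym, hsupp, hsupp.trans ?_, happrox⟩
  have h0 : 0 ≤ logOne (Fintype.card G) := zero_le_one.trans (le_max_left _ _)
  have h1 : logOne S.card ≤ logOne (Fintype.card G) := by
    rcases Nat.eq_zero_or_pos S.card with h | h
    · rw [h]; simp [logOne]
    · refine max_le_max le_rfl (Real.log_le_log (by exact_mod_cast h) ?_)
      exact_mod_cast Finset.card_le_univ S
  calc _ ≤ C * (ε⁻¹ ^ 2 * logOne (Fintype.card G) ^ 3 * logOne (Fintype.card G)) := by gcongr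
    _ = _ := by ring

/-- The constant in the size bound of the sparsifiers. -/
def sparsifierConstant : ℝ := 8192 * 8 ^ 3 * 4 * 4

/-- The trivial sparsifier, for small `ε`. -/
theorem isCayleySparsifier_one (hS : ∀ s ∈ S, s⁻¹ ∈ S) {ε : ℝ} (hε : 0 < ε) (hε1 : Fintype.card G * ε ≤ 2) :
    IsCayleySparsifier sparsifierConstant S ε (1 : S → ℝ≥0) := by
  have hlog : ∀ x, 1 ≤ logOne x := fun x => le_max_left _ _
  have hN : (1 : ℝ) ≤ Fintype.card G := by exact_mod_cast (Fintype.card_pos : 0 < Fintype.card G)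
  refine isCayleySparsifier_of_support_le (by norm_num [sparsifierConstant]) (fun _ _ _ => rfl) ?_ ?_
  · have h1 : (Function.support (1 : S → ℝ≥0)).ncard ≤ Fintype.card G := by
      refine (Set.ncard_le_ncard (Set.subset_univ _)).trans ?_
      rw [Set.ncard_univ, Nat.card_eq_fintype_card, Fintype.card_coe]
      exact Finset.card_le_univ S
    have h2 : (Fintype.card G : ℝ) ≤ 2 * ε⁻¹ := by
      rw [← div_eq_mul_inv, le_div_iff₀ hε]; exact hε1
    -- Squaring N ≤ 2/ε and using N ≤ N²: for such small ε even all of S meets the size bound.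
    have h3 : (Fintype.card G : ℝ) ≤ 4 * ε⁻¹ ^ 2 := by nlinarith
    have h4 : (1 : ℝ) ≤ logOne (Fintype.card G) ^ 3 * logOne S.card :=
      one_le_mul_of_one_le_of_one_le (one_le_pow₀ (hlog _)) (hlog _)
    calc ((Function.support (1 : S → ℝ≥0)).ncard : ℝ) ≤ Fintype.card G := by exact_mod_cast h1
      _ ≤ 4 * ε⁻¹ ^ 2 := h3
      _ ≤ sparsifierConstant * (ε⁻¹ ^ 2 * (logOne (Fintype.card G) ^ 3 * logOne S.card)) := by
          have h5 : (0 : ℝ) ≤ ε⁻¹ ^ 2 := by positivity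
          rw [sparsifierConstant]
          nlinarith [mul_le_mul_of_nonneg_left h4 h5]
      _ = _ := by ring
  · have hL0 : 0 ≤ ε • cayleyLaplacian S 1 := by
      rw [cayleyLaplacian_one hS]
      exact smul_nonneg hε.le (smul_nonneg (by norm_num) (doubleLaplacian_nonneg S))
    constructor
    · rw [sub_smul, one_smul, sub_sub_cancel]
      exact hL0.posSemidef
    · rw [add_smul, one_smul, add_sub_cancel_left]
      exact hL0.posSemidef

/-- The deviation Y is at most 1/(2E) in norm. Undoing the normalization and comparing the
preconditioner with T doubles this to a relative error 1/E, which is at most ε. For the size, every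
round adds at most one generator, and symmetrization at most doubles the support. -/
theorem isCayleySparsifier_greedy (H : IsGreedyParam S l h E) (hh : 0 < h) {ε : ℝ} (hε : 0 < ε)
    (hl : (l : ℝ) ≤ 8 * logOne (Fintype.card G)) (hh2 : (h : ℝ) ≤ 4 * logOne S.card)
    (hE1 : E * ε ≤ 2) (hE2 : 1 ≤ E * ε)
    (hS : ∀ s ∈ S, s⁻¹ ∈ S) (hgen : Subgroup.closure (S : Set G) = ⊤) (V : ℕ → G → ℤ)
    (h0 : V 0 = 0) (hV : ∀ t < greedyRounds l h E, IsGreedyStep S l h E t (V t) (V (t + 1))) :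
    IsCayleySparsifier sparsifierConstant S ε
      (greedyWeight S l h E (V (greedyRounds l h E))) := by
  have hK := H.rounds_pos hh
  have hK' : (0 : ℝ) < greedyRounds l h E := by exact_mod_cast hK
  have hE' : (0 : ℝ) < E := by exact_mod_cast H.pos
  obtain ⟨hnn, hsup, hcard⟩ := greedy_support V h0 hV _ le_rfl
  obtain ⟨hb1, hb2⟩ := normalizedLaplacian_bounds_of_intPotential_le H hh _ _
    (greedy_intPotential_le H hh hS hgen V h0 hV _ le_rfl)
  set U := V (greedyRounds l h E) with hU
  set K : ℝ := (greedyRounds l h E : ℝ) with hKdef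
  have hsupinv : ∀ g, g ∉ S → U g⁻¹ = 0 := fun g hg =>
    hsup _ fun hg' => hg (by simpa using hS _ hg')
  refine isCayleySparsifier_of_support_le (by norm_num [sparsifierConstant]) ?_ ?_ ?_
  · intro s t hst
    simp only [greedyWeight, hst, inv_inv, add_comm]
  -- A nonzero weight at s requires that s or s⁻¹ was chosen in some round, hence the factor 2.
  · have h1 : (Function.support (greedyWeight S l h E U)).ncard ≤ 2 * greedyRounds l h E := by
      set F := Finset.univ.filter fun g => U g ≠ 0 with hF
      have h2 : (Function.support (greedyWeight S l h E U)).ncard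
          ≤ ((F ∪ F.image (·⁻¹) : Finset G) : Set G).ncard := by
        refine Set.ncard_le_ncard_of_injOn (fun s : S => (s : G)) (fun s hs => ?_)
          (Subtype.val_injective.injOn) (Finset.finite_toSet _)
        rw [Finset.mem_coe, Finset.mem_union, Finset.mem_image]
        by_contra! hcon
        have e1 : U s = 0 := by
          by_contra hne
          exact hcon.1 (by simp [hF, hne])
        have e2 : U (s : G)⁻¹ = 0 := by
          by_contra hne
          exact hcon.2 (s : G)⁻¹ (by simp [hF, hne]) (inv_inv _)
        apply hs
        simp [greedyWeight, e1, e2]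
      rw [Set.ncard_coe_finset] at h2
      refine h2.trans ((Finset.card_union_le _ _).trans ?_)
      have := Finset.card_image_le (s := F) (f := (·⁻¹))
      omega
    have h2 : (E : ℝ) ≤ 2 * ε⁻¹ := by rw [← div_eq_mul_inv, le_div_iff₀ hε]; exact hE1
    have h3 : (0 : ℝ) ≤ logOne (Fintype.card G) := zero_le_one.trans (le_max_left _ _)
    have h4 : (0 : ℝ) ≤ logOne S.card := zero_le_one.trans (le_max_left _ _)
    calc ((Function.support (greedyWeight S l h E U)).ncard : ℝ)
        ≤ (2 * greedyRounds l h E : ℕ) := by exact_mod_cast h1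
      _ = 8192 * (l : ℝ) ^ 3 * h * E ^ 2 := by rw [greedyRounds]; push_cast; ring
      -- The bounds l ≤ 8 log N, h ≤ 4 log |S| and E ≤ 2/ε produce the factors 8³, 4 and 4 of
      -- `sparsifierConstant`.
      _ ≤ 8192 * (8 * logOne (Fintype.card G)) ^ 3 * (4 * logOne S.card) * (2 * ε⁻¹) ^ 2 := by
          gcongr
      _ = _ := by rw [sparsifierConstant]; ring
  · set w : G → ℝ := fun g => K⁻¹ * (deviationWeight S l h U (greedyRounds l h E) g : ℝ) with hw
    have hδ0 : (0 : ℝ) ≤ 1 / (2 * E) := by positivity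
    obtain ⟨-, hspec⟩ := cayleyPreconditioner_spec hS hgen
    have hup := hspec w _ hδ0 (weightLaplacian_le_of_normalized_le hb1)
    have hneg : ∀ v : G → ℝ, weightLaplacian ℝ (fun g => -1 * v g) = -weightLaplacian ℝ v :=
      fun v => by rw [weightLaplacian_smul, neg_one_smul]
    have hdown := hspec (fun g => -1 * w g) _ hδ0 (weightLaplacian_le_of_normalized_le (by
      rw [normalizedLaplacian, hneg, mul_neg, neg_mul]
      exact neg_le.1 hb2))
    rw [hneg] at hdown
    have hind : ∀ g, ((finsetIndicator ℤ S g : ℤ) : ℝ) = finsetIndicator ℝ S g := fun g => by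
      simp [finsetIndicator]
    -- Averaging the multiplicities of g and g⁻¹ makes the weights symmetric without changing the
    -- Laplacian, since g and g⁻¹ have the same generator Laplacian.
    have hinv : ∀ c : ℝ, weightLaplacian ℝ (fun g => c * ((U g : ℝ) + U g⁻¹))
        = (2 * c) • weightLaplacian ℝ (fun g => (U g : ℝ)) := by
      intro c
      rw [weightLaplacian_smul, weightLaplacian_add]
      have : weightLaplacian ℝ (fun g => (U g⁻¹ : ℝ)) = weightLaplacian ℝ (fun g => (U g : ℝ)) := by
        rw [weightLaplacian, ← Equiv.sum_comp (Equiv.inv G), weightLaplacian]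
        refine Finset.sum_congr rfl fun g _ => ?_
        simp only [Equiv.inv_apply, inv_inv, generatorLaplacian_inv]
      rw [this, ← two_smul ℝ (weightLaplacian ℝ _), smul_smul, mul_comm]
    have hL1 := cayleyLaplacian_one hS
    have hL : cayleyLaplacian S (greedyWeight S l h E U)
        = cayleyLaplacian S 1 + (1 / 2 : ℝ) • weightLaplacian ℝ w := by
      rw [cayleyLaplacian_eq_weightLaplacian (greedyWeight S l h E U)
        (fun g => (l * h / (2 * K) : ℝ) * ((U g : ℝ) + U g⁻¹)) ?_ ?_ ?_, hinv, hL1]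
      · have h1 : w = fun g => (l * h / K : ℝ) * (U g : ℝ) + (-1) * finsetIndicator ℝ S g := by
          funext g
          rw [hw]
          simp only [deviationWeight]
          push_cast
          rw [hind, ← hKdef]
          field_simp
          ring
        rw [h1, weightLaplacian_add, hneg, weightLaplacian_smul, smul_add, ← doubleLaplacian]
        rw [show (2 * (l * h / (2 * K)) : ℝ) = l * h / K by field_simp]
        simp
      · intro g hg
        rw [greedyWeight, Real.coe_toNNReal _ (by
          have h1 := hnn g
          have h2 := hnn g⁻¹
          have h3 : (0 : ℤ) ≤ l * h * (U g + U g⁻¹) := by positivity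
          have h4 : (0 : ℝ) ≤ ((l * h * (U g + U g⁻¹) : ℤ) : ℝ) := by exact_mod_cast h3
          exact div_nonneg h4 (by push_cast; positivity))]
        push_cast
        rw [hKdef]
        ring
      · intro g hg
        simp only [hsup g hg, hsupinv g hg]; simp
      · intro g
        simp only [inv_inv]; ring
    have hL0 : 0 ≤ cayleyLaplacian S 1 := by
      rw [hL1]; exact smul_nonneg (by norm_num) (doubleLaplacian_nonneg S)
    have hT : doubleLaplacian ℝ S = (2 : ℝ) • cayleyLaplacian S 1 := by
      rw [hL1, smul_smul]; norm_num
    -- The factors are 1/2 from the double counting of edges, 2/(2E) from the preconditioned bound,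
    -- and 2 from T being twice the Laplacian.
    have hcoef : (1 / 2 * (2 * (1 / (2 * E)) * 2) : ℝ) ≤ ε := by
      have : (1 / 2 * (2 * (1 / (2 * E)) * 2) : ℝ) = 1 / E := by field_simp; try norm_num
      rw [this, div_le_iff₀ hE']
      linarith
    have hup' : (1 / 2 : ℝ) • weightLaplacian ℝ w ≤ ε • cayleyLaplacian S 1 := by
      have h1 := smul_le_smul_of_nonneg_left hup (by norm_num : (0 : ℝ) ≤ 1 / 2)
      rw [hT, smul_smul, smul_smul] at h1
      exact h1.trans (smul_le_smul_of_nonneg_right (by rw [mul_assoc] at hcoef; simpa [mul_assoc] using hcoef) hL0)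
    have hdown' : -((1 / 2 : ℝ) • weightLaplacian ℝ w) ≤ ε • cayleyLaplacian S 1 := by
      have h1 := smul_le_smul_of_nonneg_left hdown (by norm_num : (0 : ℝ) ≤ 1 / 2)
      rw [hT, smul_smul, smul_smul, smul_neg] at h1
      exact h1.trans (smul_le_smul_of_nonneg_right (by rw [mul_assoc] at hcoef; simpa [mul_assoc] using hcoef) hL0)
    constructor
    · have h1 : cayleyLaplacian S (greedyWeight S l h E U) - (1 - ε) • cayleyLaplacian S 1
          = ε • cayleyLaplacian S 1 - -((1 / 2 : ℝ) • weightLaplacian ℝ w) := by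
        rw [hL, sub_smul, one_smul]; abel
      rw [h1]
      exact hdown'
    · have h1 : (1 + ε) • cayleyLaplacian S 1 - cayleyLaplacian S (greedyWeight S l h E U)
          = ε • cayleyLaplacian S 1 - (1 / 2 : ℝ) • weightLaplacian ℝ w := by
        rw [hL, add_smul, one_smul]; abel
      rw [h1]
      exact hup'

end GreedyAnalysis

/-! ## A language of deterministic loop programs -/

/-- The array numbers that occur in an expression. -/
def Expr.reads : Expr → List ℕ
  | .const _ => []
  | .get a i => a :: i.reads
  | .add x y => x.reads ++ y.reads
  | .sub x y => x.reads ++ y.reads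
  | .mul x y => x.reads ++ y.reads
  | .div x y => x.reads ++ y.reads

theorem Expr.eval_congr {m m' : Mem} (e : Expr) (h : ∀ a ∈ e.reads, m a = m' a) :
    e.eval m = e.eval m' := by
  induction e with
  | const n => rfl
  | get a i ih =>
    simp only [Expr.reads, List.mem_cons, forall_eq_or_imp] at h
    simp only [Expr.eval, ih h.2, h.1]
  | add x y ihx ihy | sub x y ihx ihy | mul x y ihx ihy | div x y ihx ihy =>
    simp only [Expr.reads, List.mem_append] at h
    simp only [Expr.eval, ihx fun a ha => h a (Or.inl ha), ihy fun a ha => h a (Or.inr ha)]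

/-- Deterministic programs with counting loops. -/
inductive LoopProg where
  /-- `a[i] := e` -/
  | assign (a : ℕ) (i e : Expr)
  | seq (p q : LoopProg)
  /-- `if e > 0 then p else q` -/
  | ite (e : Expr) (p q : LoopProg)
  /-- `for c[0] := 0 to e - 1 do p` -/
  | loop (c : ℕ) (e : Expr) (p : LoopProg)

/-- Cell `0` of array `a`. -/
def Expr.var (a : ℕ) : Expr := .get a (.const 0)

theorem Mem.set_same (m : Mem) (a : ℕ) (i v : ℤ) : m.set a i v a i = v := by simp [Mem.set]

theorem Mem.set_of_ne (m : Mem) {a b : ℕ} (i v : ℤ) (h : b ≠ a) : m.set a i v b = m b := by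
  funext j; simp [Mem.set, h]

theorem Mem.set_apply (m : Mem) (a : ℕ) (i v j : ℤ) :
    m.set a i v a j = if j = i then v else m a j := by simp [Mem.set]

/-- The memory before pass `j` of a counting loop with body `f`. -/
def loopState (f : Mem → Mem) (c : ℕ) (m : Mem) : ℕ → Mem
  | 0 => m.set c 0 0
  | j + 1 => (f (loopState f c m j)).set c 0 (j + 1)

namespace LoopProg

/-- A counting loop becomes a while loop that tests whether bound minus counter is positive. The
bound is evaluated anew in each test, so this agrees with `run` only if the body modifies neither
bound nor counter, which `wellFormed` checks. -/
def compile : LoopProg → Prog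
  | assign a i e => .assign a i e
  | seq p q => .seq p.compile q.compile
  | ite e p q => .ifPos e p.compile q.compile
  | loop c e p => .seq (.assign c (.const 0) (.const 0)) (.whilePos (.sub e (.var c))
      (.seq p.compile (.assign c (.const 0) (.add (.var c) (.const 1)))))

/-- The effect of a program on the memory. -/
def run : LoopProg → Mem → Mem
  | assign a i e, m => m.set a (i.eval m) (e.eval m)
  | seq p q, m => q.run (p.run m)
  | ite e p q, m => if 0 < e.eval m then p.run m else q.run m
  | loop c e p, m => loopState p.run c m (e.eval m).toNat

/-- The number of assignments and tests in a run. -/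
def steps : LoopProg → Mem → ℕ
  | assign _ _ _, _ => 1
  | seq p q, m => p.steps m + q.steps (p.run m)
  | ite e p q, m => 1 + if 0 < e.eval m then p.steps m else q.steps m
  | loop c e p, m =>
      2 + ∑ j ∈ Finset.range (e.eval m).toNat, (p.steps (loopState p.run c m j) + 2)

/-- The logarithmic cost of a run. -/
def cost : LoopProg → Mem → ℕ
  | assign _ i e, m => i.cost m + e.cost m
  | seq p q, m => p.cost m + q.cost (p.run m)
  | ite e p q, m => e.cost m + if 0 < e.eval m then p.cost m else q.cost m
  | loop c e p, m =>
      ((Expr.const 0).cost m + (Expr.const 0).cost m) +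
        (∑ j ∈ Finset.range (e.eval m).toNat,
          ((Expr.sub e (.var c)).cost (loopState p.run c m j)
            + (p.cost (loopState p.run c m j) +
              ((Expr.const 0).cost (p.run (loopState p.run c m j)) +
                (Expr.add (.var c) (.const 1)).cost (p.run (loopState p.run c m j)))))
          + (Expr.sub e (.var c)).cost (loopState p.run c m (e.eval m).toNat))

/-- The arrays that a program may modify. -/
def writes : LoopProg → List ℕ
  | assign a _ _ => [a]
  | seq p q => p.writes ++ q.writes
  | ite _ p q => p.writes ++ q.writes
  | loop c _ p => c :: p.writes

/-- Loop bodies modify neither the counter nor the bound of the loop. -/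
def wellFormed : LoopProg → Bool
  | assign _ _ _ => true
  | seq p q => p.wellFormed && q.wellFormed
  | ite _ p q => p.wellFormed && q.wellFormed
  | loop c e p => p.wellFormed && !p.writes.contains c && !e.reads.contains c
      && e.reads.all fun a => !p.writes.contains a

theorem run_of_notMem_writes (p : LoopProg) (m : Mem) {a : ℕ} (ha : a ∉ p.writes) :
    p.run m a = m a := by
  induction p generalizing m with
  | assign b i e =>
    simp only [writes, List.mem_singleton] at ha
    exact Mem.set_of_ne m _ _ ha
  | seq p q ihp ihq =>
    simp only [writes, List.mem_append, not_or] at ha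
    rw [run, ihq _ ha.2, ihp _ ha.1]
  | ite e p q ihp ihq =>
    simp only [writes, List.mem_append, not_or] at ha
    rw [run]
    split_ifs
    · exact ihp _ ha.1
    · exact ihq _ ha.2
  | loop c e p ih =>
    simp only [writes, List.mem_cons, not_or] at ha
    rw [run]
    generalize (e.eval m).toNat = n
    induction n with
    | zero => exact Mem.set_of_ne m _ _ ha.1
    | succ n ihn => rw [loopState, Mem.set_of_ne _ _ _ ha.1, ih _ ha.2, ihn]

theorem loopState_counter (f : Mem → Mem) (c : ℕ) (m : Mem) (j : ℕ) :
    loopState f c m j c 0 = j := by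
  cases j with
  | zero => exact Mem.set_same m c 0 0
  | succ j => rw [loopState, Mem.set_same]; push_cast; rfl

theorem loopState_of_notMem (p : LoopProg) (c : ℕ) (m : Mem) (j : ℕ) {a : ℕ} (hc : a ≠ c)
    (ha : a ∉ p.writes) : loopState p.run c m j a = m a := by
  induction j with
  | zero => exact Mem.set_of_ne m _ _ hc
  | succ j ih => rw [loopState, Mem.set_of_ne _ _ _ hc, run_of_notMem_writes _ _ ha, ih]

theorem eval_bound_loopState {c : ℕ} {e : Expr} {p : LoopProg}
    (h : (loop c e p).wellFormed = true) (m : Mem) (j : ℕ) :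
    e.eval (loopState p.run c m j) = e.eval m := by
  simp only [wellFormed, Bool.and_eq_true, Bool.not_eq_true', List.contains_eq_mem,
    decide_eq_false_iff_not, List.all_eq_true] at h
  refine Expr.eval_congr e fun a ha => loopState_of_notMem p c m j ?_ (h.2 a ha)
  rintro rfl
  exact h.1.2 ha

/-- The coin sequence is arbitrary and the number of coins used does not change: compiled programs
are deterministic. -/
theorem exec_compile (p : LoopProg) (h : p.wellFormed = true) (ω : ℕ → Bool) (m : Mem) (k : ℕ) :
    Exec ω p.compile m k (p.run m) k (p.cost m) := by
  induction p generalizing m with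
  | assign a i e => exact Exec.assign a i e m k
  | seq p q ihp ihq =>
    simp only [wellFormed, Bool.and_eq_true] at h
    exact Exec.seq (ihp h.1 m) (ihq h.2 _)
  | ite e p q ihp ihq =>
    simp only [wellFormed, Bool.and_eq_true] at h
    rw [run, cost]
    split_ifs with he
    · exact Exec.ifPos_pos he (ihp h.1 m)
    · exact Exec.ifPos_nonpos (not_lt.1 he) (ihq h.2 m)
  | loop c e p ih =>
    have hb := eval_bound_loopState h m
    have hcp : c ∉ p.writes := by
      simp only [wellFormed, Bool.and_eq_true, Bool.not_eq_true', List.contains_eq_mem,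
        decide_eq_false_iff_not] at h
      exact h.1.1.2
    have hp : p.wellFormed = true := by
      simp only [wellFormed, Bool.and_eq_true] at h
      exact h.1.1.1
    rw [compile, run, cost]
    refine Exec.seq (Exec.assign c (.const 0) (.const 0) m k) ?_
    change Exec ω _ (loopState p.run c m 0) k _ k _
    set n := (e.eval m).toNat with hn
    have htest : ∀ j, (Expr.sub e (.var c)).eval (loopState p.run c m j) = e.eval m - j := by
      intro j
      have h1 := loopState_counter p.run c m j
      simp only [Expr.eval, Expr.var, hb, h1]
    -- Induction on the number r of passes that remain, since the derivation of a while loop is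
    -- built from its end.
    have key : ∀ r j, j + r = n →
        Exec ω (.whilePos (.sub e (.var c))
          (.seq p.compile (.assign c (.const 0) (.add (.var c) (.const 1)))))
          (loopState p.run c m j) k (loopState p.run c m n) k
          (∑ j ∈ Finset.Ico j n,
          ((Expr.sub e (.var c)).cost (loopState p.run c m j)
            + (p.cost (loopState p.run c m j) +
              ((Expr.const 0).cost (p.run (loopState p.run c m j)) +
                (Expr.add (.var c) (.const 1)).cost (p.run (loopState p.run c m j)))))
          + (Expr.sub e (.var c)).cost (loopState p.run c m n)) := by
      intro r
      induction r with
      | zero =>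
        intro j hj
        obtain rfl : j = n := by omega
        rw [Finset.Ico_self, Finset.sum_empty, zero_add]
        refine Exec.whilePos_nonpos ?_
        rw [htest]
        have := Int.self_le_toNat (e.eval m)
        omega
      | succ r ihr =>
        intro j hj
        have hpos : 0 < (Expr.sub e (.var c)).eval (loopState p.run c m j) := by
          rw [htest]
          omega
        have hstep : Exec ω (.seq p.compile (.assign c (.const 0) (.add (.var c) (.const 1))))
            (loopState p.run c m j) k (loopState p.run c m (j + 1)) k
            (p.cost (loopState p.run c m j) +
              ((Expr.const 0).cost (p.run (loopState p.run c m j)) +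
                (Expr.add (.var c) (.const 1)).cost (p.run (loopState p.run c m j)))) := by
          have h1 := Exec.assign (ω := ω) c (.const 0) (.add (.var c) (.const 1))
            (p.run (loopState p.run c m j)) k
          have h2 : (Expr.add (.var c) (.const 1)).eval (p.run (loopState p.run c m j))
              = j + 1 := by
            have h3 := loopState_counter p.run c m j
            simp only [Expr.eval, Expr.var, run_of_notMem_writes p _ hcp, h3]
          rw [h2] at h1
          exact Exec.seq (ih hp _) h1
        have := Exec.whilePos_pos hpos hstep (ihr (j + 1) (by omega))
        rw [Finset.sum_eq_sum_Ico_succ_bot (by omega : j < n), add_assoc]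
        rwa [add_assoc] at this ⊢
    have := key n 0 (by omega)
    rwa [← Finset.range_eq_Ico] at this

/-! ## Reasoning about loops -/

/-- Besides the invariant, each pass may use that arrays outside the write set still have their
initial contents. Invariants therefore mention only what the loop changes. -/
theorem loop_induction {c : ℕ} {e : Expr} {p : LoopProg} {m : Mem} {n : ℕ}
    (hn : e.eval m = n) (Inv : ℕ → Mem → Prop) (h0 : Inv 0 (m.set c 0 0))
    (hstep : ∀ j < n, ∀ m' : Mem, (∀ a, a ≠ c → a ∉ p.writes → m' a = m a) → m' c 0 = (j : ℤ) →
      Inv j m' →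
      Inv (j + 1) ((p.run m').set c 0 (j + 1))) :
    Inv n ((loop c e p).run m) := by
  have h1 : ∀ j ≤ n, Inv j (loopState p.run c m j) := by
    intro j
    induction j with
    | zero => exact fun _ => h0
    | succ j ih =>
      intro hj
      exact hstep j hj _ (fun a hc ha => loopState_of_notMem p c m j hc ha)
        (loopState_counter _ _ _ _) (ih (Nat.le_of_succ_le hj))
  have hn' : (e.eval m).toNat = n := by rw [hn]; exact Int.toNat_natCast n
  rw [run, hn']
  exact h1 n le_rfl

/-- The bounds of the loops in a program. -/
def loopBounds : LoopProg → List Expr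
  | assign _ _ _ => []
  | seq p q => p.loopBounds ++ q.loopBounds
  | ite _ p q => p.loopBounds ++ q.loopBounds
  | loop _ e p => e :: p.loopBounds

/-- The nesting depth of the loops in a program. -/
def depth : LoopProg → ℕ
  | assign _ _ _ => 0
  | seq p q => max p.depth q.depth
  | ite _ p q => max p.depth q.depth
  | loop _ _ p => p.depth + 1

/-- The number of instructions in a program. -/
def length : LoopProg → ℕ
  | assign _ _ _ => 1
  | seq p q => p.length + q.length
  | ite _ p q => p.length + q.length + 1
  | loop _ _ p => p.length + 2

/-- The number of steps of a program whose loop bounds are at most `A` and never modified. -/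
theorem steps_le {A : ℕ} (p : LoopProg) (m : Mem)
    (hw : ∀ e ∈ p.loopBounds, ∀ a ∈ e.reads, a ∉ p.writes)
    (hA : ∀ e ∈ p.loopBounds, e.eval m ≤ A) : p.steps m ≤ p.length * (A + 2) ^ p.depth := by
  have hmono : ∀ (q : LoopProg) {d : ℕ}, q.depth ≤ d →
      q.length * (A + 2) ^ q.depth ≤ q.length * (A + 2) ^ d := fun q d hd =>
    Nat.mul_le_mul_left _ (Nat.pow_le_pow_right (by omega) hd)
  have hone : ∀ d, 1 ≤ (A + 2) ^ d := fun d => Nat.one_le_pow _ _ (by omega)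
  induction p generalizing m with
  | assign a i e => simp [steps, length, depth]
  | seq p q ihp ihq =>
    simp only [loopBounds, writes, List.mem_append, not_or] at hw hA
    have h1 := ihp m (fun e he a ha => (hw e (Or.inl he) a ha).1) fun e he => hA e (Or.inl he)
    have h2 := ihq (p.run m) (fun e he a ha => (hw e (Or.inr he) a ha).2) fun e he => by
      rw [Expr.eval_congr (m' := m) e fun a ha =>
        run_of_notMem_writes p m (hw e (Or.inr he) a ha).1]
      exact hA e (Or.inr he)
    rw [steps, length, depth, add_mul]
    exact Nat.add_le_add (h1.trans (hmono p (le_max_left _ _)))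
      (h2.trans (hmono q (le_max_right _ _)))
  | ite e p q ihp ihq =>
    simp only [loopBounds, writes, List.mem_append, not_or] at hw hA
    have h1 := ihp m (fun e he a ha => (hw e (Or.inl he) a ha).1) fun e he => hA e (Or.inl he)
    have h2 := ihq m (fun e he a ha => (hw e (Or.inr he) a ha).2) fun e he => hA e (Or.inr he)
    have h3 := hmono p (le_max_left p.depth q.depth)
    have h4 := hmono q (le_max_right p.depth q.depth)
    have h5 := hone (max p.depth q.depth)
    rw [steps, length, depth, add_mul, add_mul, one_mul]
    split_ifs <;> omega
  | loop c e p ih =>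
    simp only [loopBounds, writes, List.mem_cons, forall_eq_or_imp, not_or] at hw hA
    have hn : (e.eval m).toNat ≤ A := by omega
    rw [steps, length, depth]
    have h1 : ∀ j ∈ Finset.range (e.eval m).toNat,
        p.steps (loopState p.run c m j) + 2 ≤ p.length * (A + 2) ^ p.depth + 2 := fun j _ => by
      refine Nat.add_le_add_right (ih _ (fun e he a ha => (hw.2 e he a ha).2) fun e he => ?_) 2
      rw [Expr.eval_congr (m' := m) e fun a ha =>
        loopState_of_notMem p c m j (hw.2 e he a ha).1 (hw.2 e he a ha).2]
      exact hA.2 e he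
    have h2 := Finset.sum_le_card_nsmul _ _ _ h1
    rw [Finset.card_range, smul_eq_mul] at h2
    have h3 := hone p.depth
    calc _ ≤ 2 + A * (p.length * (A + 2) ^ p.depth + 2) :=
          Nat.add_le_add_left (h2.trans (Nat.mul_le_mul_right _ hn)) 2
      _ ≤ _ := by rw [pow_succ]; nlinarith [Nat.zero_le (p.length * (A + 2) ^ p.depth)]

end LoopProg

/-! ## Static bounds on the size of numbers

Arrays are assigned levels. In an assignment to an array of level `k` the assigned expression may
contain arrays of level `k` only linearly, and no arrays of higher level. Then the bit lengths of
all numbers are bounded by a polynomial in the number of steps. -/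

/-- A bound for the size of an expression, including its constants. -/
def Expr.size : Expr → ℕ
  | .const n => n.natAbs.size + 1
  | .get _ i => i.size + 1
  | .add x y => x.size + y.size + 1
  | .sub x y => x.size + y.size + 1
  | .mul x y => x.size + y.size + 1
  | .div x y => x.size + y.size + 1

/-- The degree of an expression in the arrays of level `k`; arrays of higher level count as `2`. -/
def Expr.degree (lev : ℕ → ℕ) (k : ℕ) : Expr → ℕ
  | .const _ => 0
  | .get a _ => if lev a < k then 0 else if lev a = k then 1 else 2
  | .add x y => max (x.degree lev k) (y.degree lev k)
  | .sub x y => max (x.degree lev k) (y.degree lev k)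
  | .mul x y => x.degree lev k + y.degree lev k
  | .div x _ => x.degree lev k

/-- Only working arrays of level at most `d` occur. -/
def Expr.allowed (lev : ℕ → ℕ) (d : ℕ) (e : Expr) : Bool :=
  e.reads.all fun a => decide (4 ≤ a) && decide (lev a ≤ d)

theorem Int.natAbs_add_le_two_pow {x y : ℤ} {a b : ℕ} (hx : x.natAbs ≤ 2 ^ a)
    (hy : y.natAbs ≤ 2 ^ b) : (x + y).natAbs ≤ 2 ^ (max a b + 1) := by
  have h1 : 2 ^ a ≤ 2 ^ max a b := Nat.pow_le_pow_right (by norm_num) (le_max_left a b)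
  have h2 : 2 ^ b ≤ 2 ^ max a b := Nat.pow_le_pow_right (by norm_num) (le_max_right a b)
  have := Int.natAbs_add_le x y
  rw [pow_succ]
  omega

theorem Int.natAbs_ediv_le (x y : ℤ) : (x / y).natAbs ≤ x.natAbs := by
  have := Int.abs_ediv_le_abs x y
  rw [Int.abs_eq_natAbs, Int.abs_eq_natAbs] at this
  exact_mod_cast this

/-- Degree at most 1 in level k lets the large exponent I enter at most once; everything else costs
a multiple of Y. A repeated assignment therefore adds to the bit length instead of multiplying it.
Division never increases the absolute value, so divisors do not count towards the degree. -/
theorem Expr.natAbs_eval_le_of_degree {lev : ℕ → ℕ} {k I Y : ℕ} (hY : 1 ≤ Y) {m : Mem} (e : Expr)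
    (hlow : ∀ a ∈ e.reads, lev a < k → ∀ i, (m a i).natAbs ≤ 2 ^ Y)
    (hk : ∀ a ∈ e.reads, lev a = k → ∀ i, (m a i).natAbs ≤ 2 ^ I)
    (hdeg : e.degree lev k ≤ 1) :
    (e.eval m).natAbs ≤ 2 ^ (e.degree lev k * I + e.size * Y) := by
  induction e with
  | const n =>
    rw [Expr.eval, Expr.degree, Expr.size]
    refine (Nat.lt_size_self _).le.trans (Nat.pow_le_pow_right (by norm_num) ?_)
    nlinarith [Nat.zero_le n.natAbs.size]
  | get a i _ =>
    have ha : a ∈ (Expr.get a i).reads := by simp [Expr.reads]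
    rw [Expr.degree] at hdeg ⊢
    rw [Expr.size]
    split_ifs at hdeg ⊢ with h1 h2
    · refine (hlow a ha h1 _).trans (Nat.pow_le_pow_right (by norm_num) ?_)
      nlinarith [Nat.zero_le (i.size * Y)]
    · refine (hk a ha h2 _).trans (Nat.pow_le_pow_right (by norm_num) ?_)
      omega
    · omega
  | add x y ihx ihy | sub x y ihx ihy =>
    rw [Expr.degree] at hdeg ⊢
    rw [Expr.size]
    simp only [Expr.reads, List.mem_append] at hlow hk
    have hx := ihx (fun a ha => hlow a (Or.inl ha)) (fun a ha => hk a (Or.inl ha))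
      ((le_max_left _ _).trans hdeg)
    have hy := ihy (fun a ha => hlow a (Or.inr ha)) (fun a ha => hk a (Or.inr ha))
      ((le_max_right _ _).trans hdeg)
    have hle : max (x.degree lev k * I + x.size * Y) (y.degree lev k * I + y.size * Y) + 1
        ≤ max (x.degree lev k) (y.degree lev k) * I + (x.size + y.size + 1) * Y := by
      have h1 : x.degree lev k * I ≤ max (x.degree lev k) (y.degree lev k) * I :=
        Nat.mul_le_mul_right _ (le_max_left _ _)
      have h2 : y.degree lev k * I ≤ max (x.degree lev k) (y.degree lev k) * I :=
        Nat.mul_le_mul_right _ (le_max_right _ _)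
      rw [add_mul, add_mul, one_mul]
      rcases max_cases (x.degree lev k * I + x.size * Y) (y.degree lev k * I + y.size * Y) with
        ⟨h3, _⟩ | ⟨h3, _⟩ <;> rw [h3] <;> omega
    first
    | exact (Int.natAbs_add_le_two_pow hx hy).trans (Nat.pow_le_pow_right (by norm_num) hle)
    | exact (Int.natAbs_add_le_two_pow hx (y := -y.eval m) (by rwa [Int.natAbs_neg])).trans
        (Nat.pow_le_pow_right (by norm_num) hle)
  | mul x y ihx ihy =>
    rw [Expr.degree] at hdeg ⊢
    rw [Expr.size, Expr.eval, Int.natAbs_mul]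
    simp only [Expr.reads, List.mem_append] at hlow hk
    have hx := ihx (fun a ha => hlow a (Or.inl ha)) (fun a ha => hk a (Or.inl ha)) (by omega)
    have hy := ihy (fun a ha => hlow a (Or.inr ha)) (fun a ha => hk a (Or.inr ha)) (by omega)
    refine (Nat.mul_le_mul hx hy).trans ?_
    rw [← pow_add]
    refine Nat.pow_le_pow_right (by norm_num) ?_
    ring_nf
    omega
  | div x y ihx _ =>
    rw [Expr.degree] at hdeg ⊢
    rw [Expr.size, Expr.eval]
    simp only [Expr.reads, List.mem_append] at hlow hk
    have hx := ihx (fun a ha => hlow a (Or.inl ha)) (fun a ha => hk a (Or.inl ha)) hdeg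
    refine (Int.natAbs_ediv_le _ _).trans (hx.trans (Nat.pow_le_pow_right (by norm_num) ?_))
    nlinarith [Nat.zero_le (y.size * Y)]

theorem bitLength_le_of_natAbs_le {z : ℤ} {B : ℕ} (h : z.natAbs ≤ 2 ^ B) : bitLength z ≤ B + 2 := by
  have : z.natAbs.size ≤ B + 1 := by
    rw [Nat.size_le, pow_succ]
    have := Nat.one_le_two_pow (n := B)
    omega
  rw [bitLength]
  omega

theorem Expr.natAbs_eval_le {W : ℕ} (hW : 1 ≤ W) {m : Mem} (e : Expr)
    (h : ∀ a ∈ e.reads, ∀ i, (m a i).natAbs ≤ 2 ^ W) : (e.eval m).natAbs ≤ 2 ^ (e.size * W) := by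
  induction e with
  | const n =>
    rw [Expr.eval, Expr.size]
    refine (Nat.lt_size_self _).le.trans (Nat.pow_le_pow_right (by norm_num) ?_)
    nlinarith [Nat.zero_le n.natAbs.size]
  | get a i _ =>
    refine (h a (by simp [Expr.reads]) _).trans (Nat.pow_le_pow_right (by norm_num) ?_)
    rw [Expr.size]
    nlinarith [Nat.zero_le (i.size * W)]
  | add x y ihx ihy | sub x y ihx ihy =>
    rw [Expr.size]
    simp only [Expr.reads, List.mem_append] at h
    have hx := ihx (fun a ha => h a (Or.inl ha))
    have hy := ihy (fun a ha => h a (Or.inr ha))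
    have hle : max (x.size * W) (y.size * W) + 1 ≤ (x.size + y.size + 1) * W := by
      rw [add_mul, add_mul, one_mul]
      rcases max_cases (x.size * W) (y.size * W) with ⟨h3, _⟩ | ⟨h3, _⟩ <;> rw [h3] <;> omega
    first
    | exact (Int.natAbs_add_le_two_pow hx hy).trans (Nat.pow_le_pow_right (by norm_num) hle)
    | exact (Int.natAbs_add_le_two_pow hx (y := -y.eval m) (by rwa [Int.natAbs_neg])).trans
        (Nat.pow_le_pow_right (by norm_num) hle)
  | mul x y ihx ihy =>
    rw [Expr.size, Expr.eval, Int.natAbs_mul]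
    simp only [Expr.reads, List.mem_append] at h
    refine (Nat.mul_le_mul (ihx fun a ha => h a (Or.inl ha))
      (ihy fun a ha => h a (Or.inr ha))).trans ?_
    rw [← pow_add]
    refine Nat.pow_le_pow_right (by norm_num) ?_
    ring_nf
    omega
  | div x y ihx _ =>
    rw [Expr.size, Expr.eval]
    simp only [Expr.reads, List.mem_append] at h
    refine (Int.natAbs_ediv_le _ _).trans ((ihx fun a ha => h a (Or.inl ha)).trans
      (Nat.pow_le_pow_right (by norm_num) ?_))
    nlinarith [Nat.zero_le (y.size * W)]

theorem Expr.cost_le {W : ℕ} (hW : 1 ≤ W) {m : Mem} (e : Expr)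
    (h : ∀ a ∈ e.reads, ∀ i, (m a i).natAbs ≤ 2 ^ W) : e.cost m ≤ e.size * (e.size * W + 2) := by
  have hval := bitLength_le_of_natAbs_le (Expr.natAbs_eval_le hW e h)
  induction e with
  | const n =>
    rw [Expr.cost]
    refine hval.trans (Nat.le_mul_of_pos_left _ ?_)
    rw [Expr.size]; omega
  | get a i ih =>
    simp only [Expr.reads, List.mem_cons] at h
    have hi := ih (fun a ha => h a (Or.inr ha))
      (bitLength_le_of_natAbs_le (Expr.natAbs_eval_le hW i fun a ha => h a (Or.inr ha)))
    rw [Expr.cost]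
    rw [Expr.eval] at hval
    have hmono : i.size * (i.size * W + 2) ≤ i.size * ((Expr.get a i).size * W + 2) := by
      rw [Expr.size]; gcongr; omega
    calc _ ≤ i.size * ((Expr.get a i).size * W + 2) + ((Expr.get a i).size * W + 2) := by omega
      _ = _ := by conv_rhs => rw [Expr.size]
                  rw [Expr.size]; ring
  | add x y ihx ihy | sub x y ihx ihy | mul x y ihx ihy | div x y ihx ihy =>
    simp only [Expr.reads, List.mem_append] at h
    have hx := ihx (fun a ha => h a (Or.inl ha))
      (bitLength_le_of_natAbs_le (Expr.natAbs_eval_le hW x fun a ha => h a (Or.inl ha)))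
    have hy := ihy (fun a ha => h a (Or.inr ha))
      (bitLength_le_of_natAbs_le (Expr.natAbs_eval_le hW y fun a ha => h a (Or.inr ha)))
    rw [Expr.cost]
    rw [Expr.eval] at hval
    rw [Expr.size] at hval ⊢
    have hmx : x.size * (x.size * W + 2) ≤ x.size * ((x.size + y.size + 1) * W + 2) := by
      gcongr; omega
    have hmy : y.size * (y.size * W + 2) ≤ y.size * ((x.size + y.size + 1) * W + 2) := by
      gcongr; omega
    calc _ ≤ x.size * ((x.size + y.size + 1) * W + 2) + y.size * ((x.size + y.size + 1) * W + 2)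
          + ((x.size + y.size + 1) * W + 2) := by omega
      _ = _ := by ring

namespace LoopProg

/-- A bound for the size of all expressions in a program. -/
def size : LoopProg → ℕ
  | assign _ i e => i.size + e.size
  | seq p q => p.size + q.size
  | ite e p q => e.size + p.size + q.size
  | loop _ e p => e.size + p.size + 8

/-- The level condition. -/
def leveled (lev : ℕ → ℕ) (d : ℕ) : LoopProg → Bool
  | assign a i e => decide (4 ≤ a) && decide (lev a ≤ d) && i.allowed lev d && e.allowed lev d
      && decide (e.degree lev (lev a) ≤ 1)
  | seq p q => p.leveled lev d && q.leveled lev d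
  | ite e p q => e.allowed lev d && p.leveled lev d && q.leveled lev d
  | loop c e p => decide (4 ≤ c) && decide (lev c ≤ d) && e.allowed lev d && p.leveled lev d

end LoopProg

/-- The bound on the working arrays after `s` steps. -/
def LevelBound (lev : ℕ → ℕ) (d b σ y s : ℕ) (m : Mem) : Prop :=
  ∀ a, 4 ≤ a → lev a ≤ d → ∀ i, (m a i).natAbs ≤ 2 ^ ((b + s * σ) * y ^ lev a)

namespace LevelBound

variable {lev : ℕ → ℕ} {d b σ y s n : ℕ} {m : Mem}

theorem mono (h : LevelBound lev d b σ y s m) {s' : ℕ} (hs : s ≤ s') :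
    LevelBound lev d b σ y s' m := fun a ha hd i =>
  (h a ha hd i).trans (Nat.pow_le_pow_right (by norm_num) (by gcongr))

theorem le_top (h : LevelBound lev d b σ y s m) (hs : b + s * σ ≤ y) (hy : 1 ≤ y) {a : ℕ}
    (ha : 4 ≤ a) (hd : lev a ≤ d) (i : ℤ) : (m a i).natAbs ≤ 2 ^ (y ^ (d + 1)) := by
  refine (h a ha hd i).trans (Nat.pow_le_pow_right (by norm_num) ?_)
  calc (b + s * σ) * y ^ lev a ≤ y * y ^ d := Nat.mul_le_mul hs (Nat.pow_le_pow_right hy hd)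
    _ = y ^ (d + 1) := by rw [pow_succ, mul_comm]

/-- As long as b + sσ ≤ y, the exponent (b + sσ) y^j of any level j below the target level k is at
most y^k. An assignment to level k thus adds at most σ y^k to its exponent, which is exactly the
increase allowed for one step. -/
theorem set (h : LevelBound lev d b σ y s m) (hs : b + s * σ ≤ y) (hy : 1 ≤ y) {a : ℕ} (i : ℤ)
    {e : Expr} (he : e.allowed lev d = true) (hdeg : e.degree lev (lev a) ≤ 1)
    (hσ : e.size ≤ σ) : LevelBound lev d b σ y (s + 1) (m.set a i (e.eval m)) := by
  simp only [Expr.allowed, List.all_eq_true, Bool.and_eq_true, decide_eq_true_eq] at he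
  intro c hc hdc j
  by_cases hca : c = a ∧ j = i
  · obtain ⟨rfl, rfl⟩ := hca
    rw [Mem.set_same]
    have hY : 1 ≤ y ^ lev c := Nat.one_le_pow _ _ hy
    refine (Expr.natAbs_eval_le_of_degree (k := lev c) (I := (b + s * σ) * y ^ lev c) hY e
      (fun a' ha' hlt i' => ?_) (fun a' ha' heq i' => ?_) hdeg).trans
      (Nat.pow_le_pow_right (by norm_num) ?_)
    · refine (h a' (he a' ha').1 (he a' ha').2 i').trans (Nat.pow_le_pow_right (by norm_num) ?_)
      calc (b + s * σ) * y ^ lev a' ≤ y * y ^ lev a' := Nat.mul_le_mul_right _ hs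
        _ = y ^ (lev a' + 1) := by rw [pow_succ, mul_comm]
        _ ≤ y ^ lev c := Nat.pow_le_pow_right hy hlt
    · rw [← heq]
      exact h a' (he a' ha').1 (he a' ha').2 i'
    · calc e.degree lev (lev c) * ((b + s * σ) * y ^ lev c) + e.size * y ^ lev c
          ≤ 1 * ((b + s * σ) * y ^ lev c) + σ * y ^ lev c := by gcongr
        _ = (b + (s + 1) * σ) * y ^ lev c := by ring
  · have : m.set a i (e.eval m) c j = m c j := by simp [Mem.set, hca]
    rw [this]
    exact h.mono (Nat.le_succ s) c hc hdc j

theorem cost_le (h : LevelBound lev d b σ y s m) (hs : b + s * σ ≤ y) (hy : 1 ≤ y)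
    {e : Expr} (he : e.allowed lev d = true) (hσ : e.size ≤ σ) :
    e.cost m ≤ σ * (σ * y ^ (d + 1) + 2) := by
  simp only [Expr.allowed, List.all_eq_true, Bool.and_eq_true, decide_eq_true_eq] at he
  refine (Expr.cost_le (Nat.one_le_pow _ _ hy) e fun a ha i =>
    h.le_top hs hy (he a ha).1 (he a ha).2 i).trans ?_
  gcongr

end LevelBound

namespace LoopProg

/-- The cost of a run is bounded by a polynomial in the number of steps. -/
theorem cost_le_of_leveled {lev : ℕ → ℕ} {d b σ y : ℕ} (hy : 1 ≤ y) (p : LoopProg)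
    (hw : p.wellFormed = true) (hp : p.leveled lev d = true) (hσ : p.size ≤ σ) (m : Mem) (s : ℕ)
    (hm : LevelBound lev d b σ y s m) (hs : b + (s + p.steps m) * σ ≤ y) :
    LevelBound lev d b σ y (s + p.steps m) (p.run m) ∧
      p.cost m ≤ p.steps m * (2 * (σ * (σ * y ^ (d + 1) + 2))) := by
  have hmono : ∀ {s' S' : ℕ}, b + S' * σ ≤ y → s' ≤ S' → b + s' * σ ≤ y := fun h1 h2 =>
    (Nat.add_le_add_left (Nat.mul_le_mul_right σ h2) b).trans h1
  have hcost : ∀ {s' : ℕ} {m' : Mem} {e : Expr}, LevelBound lev d b σ y s' m' →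
      b + s' * σ ≤ y → e.allowed lev d = true → e.size ≤ σ →
      e.cost m' ≤ σ * (σ * y ^ (d + 1) + 2) := fun h1 h2 h3 h4 => h1.cost_le h2 hy h3 h4
  -- Q bounds the cost of one expression. Counted over whole constructs, there are never more than
  -- two evaluations per step: an assignment has two, a loop three for its two overhead steps and
  -- three for the two extra steps of each pass.
  generalize σ * (σ * y ^ (d + 1) + 2) = Q at hcost ⊢
  induction p generalizing m s with
  | assign a i e =>
    simp only [leveled, Bool.and_eq_true, decide_eq_true_eq] at hp
    rw [size] at hσ
    rw [steps] at hs ⊢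
    have hs' := hmono hs (Nat.le_succ s)
    refine ⟨hm.set hs' hy _ hp.1.2 hp.2 (by omega), ?_⟩
    rw [cost]
    have h1 := hcost hm hs' hp.1.1.2 (by omega : i.size ≤ σ)
    have h2 := hcost hm hs' hp.1.2 (by omega : e.size ≤ σ)
    omega
  | seq p q ihp ihq =>
    simp only [leveled, Bool.and_eq_true] at hp
    simp only [wellFormed, Bool.and_eq_true] at hw
    rw [size] at hσ
    rw [steps] at hs ⊢
    obtain ⟨h1, h2⟩ := ihp hw.1 hp.1 (by omega) m s hm (hmono hs (by omega))
    obtain ⟨h3, h4⟩ := ihq hw.2 hp.2 (by omega) _ _ h1 (hmono hs (by omega))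
    refine ⟨by rw [← add_assoc]; exact h3, ?_⟩
    rw [cost, add_mul]
    exact Nat.add_le_add h2 h4
  | ite e p q ihp ihq =>
    simp only [leveled, Bool.and_eq_true] at hp
    simp only [wellFormed, Bool.and_eq_true] at hw
    rw [size] at hσ
    rw [steps] at hs ⊢
    rw [run, cost]
    have h1 := hcost hm (hmono hs (by omega)) hp.1.1 (by omega : e.size ≤ σ)
    split_ifs at hs ⊢ with he
    · obtain ⟨h3, h4⟩ := ihp hw.1 hp.1.2 (by omega) m (s + 1) (hm.mono (Nat.le_succ s))
        (hmono hs (by omega))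
      refine ⟨by rw [← add_assoc]; exact h3, ?_⟩
      rw [add_mul, one_mul]
      exact Nat.add_le_add (by omega) h4
    · obtain ⟨h3, h4⟩ := ihq hw.2 hp.2 (by omega) m (s + 1) (hm.mono (Nat.le_succ s))
        (hmono hs (by omega))
      refine ⟨by rw [← add_assoc]; exact h3, ?_⟩
      rw [add_mul, one_mul]
      exact Nat.add_le_add (by omega) h4
  | loop c e p ih =>
    have hcounter := loopState_counter p.run c m
    have hcp : c ∉ p.writes := by
      simp only [wellFormed, Bool.and_eq_true, Bool.not_eq_true', List.contains_eq_mem,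
        decide_eq_false_iff_not] at hw
      exact hw.1.1.2
    simp only [leveled, Bool.and_eq_true, decide_eq_true_eq] at hp
    simp only [wellFormed, Bool.and_eq_true] at hw
    rw [size] at hσ
    rw [steps] at hs ⊢
    set n := (e.eval m).toNat with hn
    have hvar : (Expr.var c).allowed lev d = true := by
      simp [Expr.allowed, Expr.var, Expr.reads, hp.1.1.1, hp.1.1.2]
    have hdeg1 : (Expr.add (.var c) (.const 1)).degree lev (lev c) ≤ 1 := by
      simp [Expr.degree, Expr.var]
    have hall1 : (Expr.add (.var c) (.const 1)).allowed lev d = true := by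
      simp [Expr.allowed, Expr.var, Expr.reads, hp.1.1.1, hp.1.1.2]
    have hall2 : (Expr.sub e (.var c)).allowed lev d = true := by
      have := hp.1.2
      simp only [Expr.allowed, Expr.reads, List.all_append, Bool.and_eq_true] at this hvar ⊢
      exact ⟨this, hvar⟩
    have hsz0 : (Expr.const 0).size ≤ σ := by simp only [Expr.size]; simp; omega
    have hsz1 : (Expr.add (.var c) (.const 1)).size ≤ σ := by
      have : (Expr.add (.var c) (.const 1)).size = 5 := by simp [Expr.size, Expr.var]
      omega
    have hsz2 : (Expr.sub e (.var c)).size ≤ σ := by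
      have : (Expr.sub e (.var c)).size = e.size + 3 := by simp [Expr.size, Expr.var]
      omega
    have hall0 : (Expr.const 0).allowed lev d = true := by simp [Expr.allowed, Expr.reads]
    have key : ∀ j ≤ n,
        LevelBound lev d b σ y
          (s + (1 + ∑ j ∈ Finset.range j, (p.steps (loopState p.run c m j) + 2)))
          (loopState p.run c m j) ∧
        ∑ j ∈ Finset.range j,
          ((Expr.sub e (.var c)).cost (loopState p.run c m j)
            + (p.cost (loopState p.run c m j) +
              ((Expr.const 0).cost (p.run (loopState p.run c m j)) +
                (Expr.add (.var c) (.const 1)).cost (p.run (loopState p.run c m j)))))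
          ≤ (∑ j ∈ Finset.range j, (p.steps (loopState p.run c m j) + 2)) * (2 * Q) := by
      intro j
      induction j with
      | zero =>
        intro _
        have h1 := hm.set (hmono hs (by omega)) hy (a := c) 0 hall0
          (by simp [Expr.degree]) hsz0
        simp only [Finset.range_zero, Finset.sum_empty]
        exact ⟨h1, Nat.zero_le _⟩
      | succ j ihj =>
        intro hj
        obtain ⟨hb, hc⟩ := ihj (Nat.le_of_succ_le hj)
        have hsum : ∑ j ∈ Finset.range (j + 1), (p.steps (loopState p.run c m j) + 2)
            ≤ ∑ j ∈ Finset.range n, (p.steps (loopState p.run c m j) + 2) :=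
          Finset.sum_le_sum_of_subset (Finset.range_mono hj)
        rw [Finset.sum_range_succ] at hsum
        rw [Finset.sum_range_succ, Finset.sum_range_succ]
        set T := ∑ j ∈ Finset.range j, (p.steps (loopState p.run c m j) + 2) with hT
        set mj := loopState p.run c m j with hmj
        obtain ⟨h3, h4⟩ := ih hw.1.1.1 hp.2 (by omega) mj _ hb (hmono hs (by omega))
        have hs3 : b + (s + (1 + T) + p.steps mj) * σ ≤ y := hmono hs (by omega)
        have h5 := h3.set hs3 hy (a := c) 0 hall1 hdeg1 hsz1
        have h6 : (Expr.add (.var c) (.const 1)).eval (p.run mj) = j + 1 := by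
          have h7 := hcounter j
          simp only [Expr.eval, Expr.var, run_of_notMem_writes p _ hcp, hmj, h7]
        rw [h6] at h5
        refine ⟨h5.mono (by omega), ?_⟩
        have c1 := hcost hb (hmono hs (by omega)) hall2 hsz2
        have c2 := hcost h3 hs3 hall0 hsz0
        have c3 := hcost h3 hs3 hall1 hsz1
        rw [add_mul T, add_mul (p.steps mj)]
        refine Nat.add_le_add hc ?_
        omega
    obtain ⟨h1, h2⟩ := key n le_rfl
    rw [run, ← hn]
    refine ⟨h1.mono (by omega), ?_⟩
    rw [cost, ← hn]
    have c1 := hcost hm (hmono hs (by omega)) hall0 hsz0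
    have c2 := hcost h1 (hmono hs (by omega)) hall2 hsz2
    rw [add_mul]
    refine (Nat.add_le_add (Nat.add_le_add c1 c1) (Nat.add_le_add h2 c2)).trans ?_
    omega

end LoopProg

/-! ## The sparsification program -/

/-- Entry `(i, j)` of a matrix with `N` columns, where `N` is stored in array `6`. -/
def Expr.entry (a : ℕ) (i j : Expr) : Expr := .get a (.add (.mul i (.var 6)) j)

/-- The indicator of `x = y`. -/
def Expr.indicator (x y : Expr) : Expr :=
  .div (.const 1) (.add (.const 1) (.mul (.sub x y) (.sub x y)))

theorem Expr.eval_indicator (x y : Expr) (m : Mem) :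
    (Expr.indicator x y).eval m = if x.eval m = y.eval m then 1 else 0 := by
  simp only [Expr.indicator, Expr.eval]
  split_ifs with h
  · simp [h]
  · refine Int.ediv_eq_zero_of_lt (by norm_num) ?_
    have : 0 < (x.eval m - y.eval m) * (x.eval m - y.eval m) :=
      mul_self_pos.2 (sub_ne_zero.2 h)
    omega

/-- Entry `(i, j)` of the Laplacian of the generator with number `k`, where `i`, `j`, `k` are
stored in arrays `10`, `11`, `12`. -/
def Expr.laplacianEntry : Expr :=
  .sub (.sub (.mul (.const 2) (.indicator (.var 10) (.var 11)))
    (.indicator (.entry 7 (.var 10) (.var 12)) (.var 11)))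
    (.indicator (.entry 7 (.var 11) (.var 12)) (.var 10))

namespace LoopProg

/-- Stores the matrix with entries `∑ k, x i j k` in array `C`. -/
def tab (C : ℕ) (x : Expr) : LoopProg :=
  loop 10 (.var 6) (loop 11 (.var 6)
    (seq (assign C (.add (.mul (.var 10) (.var 6)) (.var 11)) (.const 0))
      (loop 12 (.var 6) (assign C (.add (.mul (.var 10) (.var 6)) (.var 11))
        (.add (.entry C (.var 10) (.var 11)) x)))))

/-- Stores the matrix with entries `x i j` in array `C`. -/
def store (C : ℕ) (x : Expr) : LoopProg := tab C (.mul x (.indicator (.var 12) (.var 10)))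

/-- Starting with `A = 0` and `T = 1`, increases `A` by one and doubles `T` while `e > 0`. -/
def search (A T : ℕ) (e : Expr) : LoopProg :=
  seq (assign A (.const 0) (.const 0)) (seq (assign T (.const 0) (.const 1))
    (loop 12 (.add (.var 6) (.const 1))
      (ite e (seq (assign T (.const 0) (.mul (.const 2) (.var T)))
        (assign A (.const 0) (.add (.var A) (.const 1)))) (assign 16 (.const 0) (.const 0)))))

/-- Copies the first cells of array `a` to array `b`. -/
def copy (a b : ℕ) (x : Expr) : LoopProg := loop 10 x (assign b (.var 10) (.get a (.var 10)))

/-- Copies the input to working arrays. -/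
def copyInput : LoopProg :=
  seq (assign 6 (.const 0) (.get 0 (.const 0)))
    (seq (copy 1 7 (.mul (.var 6) (.var 6)))
      (seq (copy 2 8 (.var 6)) (copy 3 9 (.add (.var 6) (.const 1)))))

/-- Computes the parameters of the greedy algorithm. -/
def parameters : LoopProg :=
  seq (loop 12 (.var 6) (assign 13 (.const 0) (.add (.var 13) (.get 8 (.var 12)))))
    (seq (search 14 15 (.sub (.mul (.const 2) (.var 6)) (.var 15)))
      (seq (search 18 17 (.sub (.var 14) (.var 17)))
        (seq (search 19 20 (.sub (.add (.var 13) (.const 2)) (.var 20)))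
          (search 23 21 (.sub (.const 1) (.get 9 (.var 23)))))))

/-- Computes the numbers of iterations. -/
def iterations : LoopProg :=
  seq (assign 24 (.const 0) (.mul (.mul (.mul (.const 4096) (.mul (.mul (.var 17) (.var 17))
      (.var 17))) (.var 19)) (.mul (.var 21) (.var 21))))
    (seq (assign 25 (.const 0) (.mul (.mul (.const 32) (.var 17)) (.var 21)))
      (assign 26 (.const 0) (.mul (.const 2) (.mul (.mul (.var 6) (.var 6)) (.var 6)))))

/-- One step in the computation of the preconditioner. -/
def preconditionerStep : LoopProg :=
  seq (tab 33 (.add (.mul (.sub (.mul (.mul (.const 4) (.var 6)) (.indicator (.var 10) (.var 12)))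
      (.entry 30 (.var 10) (.var 12))) (.entry 31 (.var 12) (.var 11)))
      (.mul (.mul (.var 32) (.indicator (.var 10) (.var 11))) (.indicator (.var 12) (.var 10)))))
    (seq (store 31 (.entry 33 (.var 10) (.var 11)))
      (assign 32 (.const 0) (.mul (.mul (.const 4) (.var 6)) (.var 32))))

/-- Computes the preconditioner and the scale. -/
def preconditioner : LoopProg :=
  seq (tab 30 (.mul (.get 8 (.var 12)) .laplacianEntry))
    (seq (store 31 (.const 0))
      (seq (assign 32 (.const 0) (.const 1))
        (seq (loop 27 (.var 26) preconditionerStep)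
          (assign 34 (.const 0) (.mul (.mul (.const 2) (.var 24)) (.var 32))))))

/-- Stores the trace of the `p`-th power of the matrix in array `38` in array `D`, where `p` is
stored in array `25`. -/
def powerTrace (D : ℕ) : LoopProg :=
  seq (store 39 (.indicator (.var 10) (.var 11)))
    (seq (loop 44 (.var 25)
        (seq (tab 45 (.mul (.entry 39 (.var 10) (.var 12)) (.entry 38 (.var 12) (.var 11))))
          (store 39 (.entry 45 (.var 10) (.var 11)))))
      (tab D (.entry 39 (.var 12) (.var 12))))

/-- Splits the candidate number in array `a` into a multiplicity and a generator. -/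
def decode (a : ℕ) : LoopProg :=
  seq (assign 48 (.const 0) (.div (.var a) (.var 6)))
    (assign 49 (.const 0) (.sub (.var a) (.mul (.var 48) (.var 6))))

/-- The potential after adding the candidate whose number is stored in array `43`. -/
def candidatePotential : LoopProg :=
  seq (decode 43)
    (seq (tab 36 (.mul (.sub (.mul (.mul (.var 17) (.var 19)) (.add (.get 35 (.var 12))
          (.mul (.indicator (.var 12) (.var 49)) (.mul (.var 48) (.get 8 (.var 49))))))
          (.mul (.add (.var 28) (.const 1)) (.get 8 (.var 12)))) .laplacianEntry))
      (seq (tab 37 (.mul (.entry 31 (.var 10) (.var 12)) (.entry 36 (.var 12) (.var 11))))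
        (seq (store 38 (.add (.mul (.var 34) (.indicator (.var 10) (.var 11)))
            (.entry 37 (.var 10) (.var 11))))
          (seq (powerTrace 46)
            (seq (store 38 (.sub (.mul (.var 34) (.indicator (.var 10) (.var 11)))
                (.entry 37 (.var 10) (.var 11))))
              (seq (powerTrace 47)
                (assign 50 (.const 0) (.add (.var 46) (.var 47)))))))))

/-- Keeps the better of the present candidate and the best previous one. -/
def improve : LoopProg :=
  ite (.add (.sub (.var 40) (.var 50)) (.mul (.var 41)
      (.sub (.add (.const 1) (.var 50)) (.var 40))))
    (seq (assign 40 (.const 0) (.var 50)) (seq (assign 42 (.const 0) (.var 43))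
      (assign 41 (.const 0) (.const 0))))
    (assign 16 (.const 0) (.const 0))

/-- One round of the greedy algorithm. -/
def greedyRound : LoopProg :=
  seq (assign 41 (.const 0) (.const 1))
    (seq (loop 43 (.mul (.var 6) (.add (.var 6) (.const 1))) (seq candidatePotential improve))
      (seq (decode 42)
        (assign 35 (.var 49) (.add (.get 35 (.var 49)) (.mul (.var 48) (.get 8 (.var 49)))))))

/-- Writes the weights to the output arrays. -/
def writeWeights : LoopProg :=
  seq (tab 4 (.mul (.mul (.mul (.var 17) (.var 19)) (.add (.get 35 (.var 11)) (.get 35 (.var 12))))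
      (.indicator (.entry 7 (.entry 7 (.var 11) (.var 12)) (.var 11)) (.var 11))))
    (store 5 (.mul (.const 2) (.var 24)))

/-- Outputs the weights `1`. -/
def writeOnes : LoopProg :=
  seq (store 4 (.const 1)) (store 5 (.const 1))

/-- The greedy algorithm. -/
def greedy : LoopProg :=
  seq preconditioner (seq (loop 28 (.var 24) greedyRound) writeWeights)

/-- Computes the sparsifier from the copied input. -/
def sparsify : LoopProg :=
  seq parameters (ite (.sub (.var 21) (.var 6)) writeOnes (seq iterations greedy))

/-- The levels of the working arrays. -/
def arrayLevel (a : ℕ) : ℕ :=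
  if a ∈ [24, 25, 26, 30, 35, 49] then 1 else if a ∈ [4, 5, 31, 32, 33, 34, 36] then 2
  else if a ∈ [37, 38] then 3 else if a ∈ [39, 40, 45, 46, 47, 50] then 4 else 0

/-- Every quantity that is iterated depends linearly on itself, with coefficients of lower level:
the multiplicities have level 1, the preconditioner level 2, and the matrix powers level 4, their
base having level 3. -/
theorem leveled_sparsify : sparsify.leveled arrayLevel 4 = true := by decide

theorem wellFormed_sparsify : sparsify.wellFormed = true := by decide

/-- Programs that do not modify the bounds of their loops. -/
def boundsFixed (p : LoopProg) : Bool :=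
  p.loopBounds.all fun e => e.reads.all fun a => !p.writes.contains a

theorem boundsFixed_greedy : greedy.boundsFixed = true := by decide

theorem boundsFixed_parameters : parameters.boundsFixed = true := by decide

end LoopProg

section Correctness

set_option linter.unusedSectionVars false

open Matrix LoopProg

variable {G : Type u} [Group G] [Fintype G] [DecidableEq G] (e : G ≃ Fin (Fintype.card G))

/-! ## Matrices in memory -/

/-- The matrix stored in array `a`. -/
def Mem.matrix (m : Mem) (a : ℕ) : Matrix G G ℤ :=
  of fun g h => m a (((e g : ℕ) : ℤ) * (Fintype.card G : ℤ) + ((e h : ℕ) : ℤ))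

/-- The element with number `i`. -/
def element (i : ℕ) : G := e.symm ⟨i % Fintype.card G, Nat.mod_lt _ Fintype.card_pos⟩

theorem element_apply (g : G) : element e (e g) = g := by
  have : (⟨(e g : ℕ) % Fintype.card G, Nat.mod_lt _ Fintype.card_pos⟩ : Fin (Fintype.card G)) = e g :=
    Fin.ext (Nat.mod_eq_of_lt (e g).2)
  rw [element, this, e.symm_apply_apply]

theorem apply_element (i : ℕ) : (e (element e i) : ℕ) = i % Fintype.card G := by
  rw [element, e.apply_symm_apply]

theorem apply_element_of_lt {i : ℕ} (hi : i < Fintype.card G) : (e (element e i) : ℕ) = i := by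
  rw [apply_element, Nat.mod_eq_of_lt hi]

theorem sum_range_element (f : G → ℤ) :
    ∑ i ∈ Finset.range (Fintype.card G), f (element e i) = ∑ g, f g := by
  rw [← Fin.sum_univ_eq_sum_range (fun i => f (element e i)), ← e.sum_comp]
  exact Finset.sum_congr rfl fun g _ => by rw [element_apply]

theorem natCast_eq_iff (g h : G) : (((e g : ℕ) : ℤ) = ((e h : ℕ) : ℤ)) ↔ g = h := by
  rw [Nat.cast_inj, Fin.val_inj, e.apply_eq_iff_eq]

theorem mul_add_injective {n i j i' j' : ℕ} (hj : j < n) (hj' : j' < n)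
    (h : (i : ℤ) * n + j = (i' : ℤ) * n + j') : i = i' ∧ j = j' := by
  have h' : i * n + j = i' * n + j' := by exact_mod_cast h
  have h1 : (i * n + j) % n = (i' * n + j') % n := by rw [h']
  rw [Nat.mul_add_mod_self_right, Nat.mul_add_mod_self_right, Nat.mod_eq_of_lt hj,
    Nat.mod_eq_of_lt hj'] at h1
  subst h1
  exact ⟨Nat.eq_of_mul_eq_mul_right (by omega) (Nat.add_right_cancel h'), rfl⟩

namespace LoopProg

theorem tab_run_of_ne {C : ℕ} (x : Expr) (m : Mem) {a : ℕ} (h10 : a ≠ 10) (h11 : a ≠ 11)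
    (h12 : a ≠ 12) (hC : a ≠ C) : (tab C x).run m a = m a :=
  run_of_notMem_writes _ m (by simp [tab, writes, *])

/-- The effect of `tab`. -/
theorem tab_run {C : ℕ} {x : Expr} {m : Mem} (f : G → G → G → ℤ)
    (hC : C ≠ 6 ∧ C ≠ 10 ∧ C ≠ 11 ∧ C ≠ 12) (hN : m 6 0 = Fintype.card G)
    (hx : ∀ g h k (m' : Mem), (∀ a, a ≠ 10 → a ≠ 11 → a ≠ 12 → a ≠ C → m' a = m a) →
      m' 10 0 = ((e g : ℕ) : ℤ) → m' 11 0 = ((e h : ℕ) : ℤ) → m' 12 0 = ((e k : ℕ) : ℤ) →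
      x.eval m' = f g h k) :
    ((tab C x).run m).matrix e C = of fun g h => ∑ k, f g h k := by
  obtain ⟨hC6, hC10, hC11, hC12⟩ := hC
  set F : ℕ → ℕ → ℕ → ℤ := fun i j k => f (element e i) (element e j) (element e k) with hF
  have main : ∀ i < Fintype.card G, ∀ j < Fintype.card G, (tab C x).run m C ((i : ℤ) * Fintype.card G + j)
      = ∑ k ∈ Finset.range (Fintype.card G), F i j k := by
    refine loop_induction (n := Fintype.card G) (by simp [Expr.eval, Expr.var, hN])
      (fun i m' => ∀ i' < i, ∀ j < Fintype.card G, m' C ((i' : ℤ) * Fintype.card G + j) = ∑ k ∈ Finset.range (Fintype.card G), F i' j k)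
      (by simp) ?_
    intro i hi m1 hf1 h10 hI1
    simp only [writes, List.mem_append, List.mem_cons, List.not_mem_nil, or_false,
      not_or] at hf1
    have h61 : m1 6 0 = Fintype.card G := by
      rw [hf1 6 (by norm_num) ⟨by norm_num, hC6.symm, by norm_num, hC6.symm⟩, hN]
    -- The invariants of the three nested loops say that the rows before i are complete, that row i
    -- is complete before column j, and that cell (i, j) holds a partial sum while the other cells
    -- of C are untouched.
    have inner := loop_induction (c := 11) (e := .var 6) (m := m1) (n := Fintype.card G)
      (p := seq (assign C (.add (.mul (.var 10) (.var 6)) (.var 11)) (.const 0))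
      (loop 12 (.var 6) (assign C (.add (.mul (.var 10) (.var 6)) (.var 11))
        (.add (.entry C (.var 10) (.var 11)) x)))) (by simp [Expr.eval, Expr.var, h61])
      (fun j m' => (∀ i' < i, ∀ j < Fintype.card G, m' C ((i' : ℤ) * Fintype.card G + j) = ∑ k ∈ Finset.range (Fintype.card G), F i' j k)
        ∧ ∀ j' < j, m' C ((i : ℤ) * Fintype.card G + j') = ∑ k ∈ Finset.range (Fintype.card G), F i j' k) ?_ ?_
    · intro i' hi' j hj
      rw [Mem.set_of_ne _ _ _ hC10]
      rcases Nat.lt_succ_iff_lt_or_eq.1 hi' with h | rfl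
      · exact inner.1 i' h j hj
      · exact inner.2 j hj
    · rw [Mem.set_of_ne _ _ _ hC11]
      exact ⟨hI1, by simp⟩
    · intro j hj m2 hf2 h11 hI2
      simp only [writes, List.mem_append, List.mem_cons, List.not_mem_nil, or_false,
        not_or] at hf2
      have h62 : m2 6 0 = Fintype.card G := by rw [hf2 6 (by norm_num) ⟨hC6.symm, by norm_num, hC6.symm⟩, h61]
      have h102 : m2 10 0 = i := by
        rw [hf2 10 (by norm_num) ⟨hC10.symm, by norm_num, hC10.symm⟩, h10]
      set m3 := m2.set C ((i : ℤ) * Fintype.card G + j) 0 with hm3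
      have hrun : (seq (assign C (.add (.mul (.var 10) (.var 6)) (.var 11)) (.const 0))
          (loop 12 (.var 6) (assign C (.add (.mul (.var 10) (.var 6)) (.var 11))
          (.add (.entry C (.var 10) (.var 11)) x)))).run m2 =
          (loop 12 (.var 6) (assign C (.add (.mul (.var 10) (.var 6)) (.var 11))
          (.add (.entry C (.var 10) (.var 11)) x))).run m3 := by
        simp only [run, Expr.eval, Expr.var, h102, h11, h62, hm3]
      have h63 : m3 6 0 = Fintype.card G := by rw [hm3, Mem.set_of_ne _ _ _ hC6.symm, h62]
      have inner2 := loop_induction (c := 12) (e := .var 6) (m := m3) (n := Fintype.card G)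
        (p := assign C (.add (.mul (.var 10) (.var 6)) (.var 11))
          (.add (.entry C (.var 10) (.var 11)) x)) (by simp [Expr.eval, Expr.var, h63])
        (fun k m' => (∀ z, z ≠ (i : ℤ) * Fintype.card G + j → m' C z = m2 C z)
          ∧ m' C ((i : ℤ) * Fintype.card G + j) = ∑ k ∈ Finset.range k, F i j k) ?_ ?_
      · rw [hrun, Mem.set_of_ne _ _ _ hC11]
        refine ⟨fun i' hi' j' hj' => ?_, fun j' hj' => ?_⟩
        · rw [inner2.1 _ fun h => by have := (mul_add_injective hj' hj h).1; omega]
          exact hI2.1 i' hi' j' hj'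
        · rcases Nat.lt_succ_iff_lt_or_eq.1 hj' with h | rfl
          · rw [inner2.1 _ fun h' => by have := (mul_add_injective (by omega) hj h').2; omega]
            exact hI2.2 j' h
          · exact inner2.2
      · rw [Mem.set_of_ne _ _ _ hC12, hm3]
        refine ⟨fun z hz => ?_, ?_⟩
        · rw [Mem.set_apply, if_neg hz]
        · rw [Mem.set_same]; simp
      · intro k hk m4 hf4 h12 hI4
        simp only [writes, List.mem_cons, List.not_mem_nil, or_false] at hf4
        have h104 : m4 10 0 = i := by
          rw [hf4 10 (by norm_num) hC10.symm, hm3, Mem.set_of_ne _ _ _ hC10.symm, h102]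
        have h114 : m4 11 0 = j := by
          rw [hf4 11 (by norm_num) hC11.symm, hm3, Mem.set_of_ne _ _ _ hC11.symm, h11]
        have h64 : m4 6 0 = Fintype.card G := by rw [hf4 6 (by norm_num) hC6.symm, h63]
        have hval : x.eval m4 = F i j k := by
          refine hx _ _ _ m4 (fun a a1 a2 a3 a4 => ?_) ?_ ?_ ?_
          · rw [hf4 a a3 a4, hm3, Mem.set_of_ne _ _ _ a4, hf2 a a2 ⟨a4, a3, a4⟩,
              hf1 a a1 ⟨a2, a4, a3, a4⟩]
          · rw [h104, apply_element_of_lt e hi]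
          · rw [h114, apply_element_of_lt e hj]
          · rw [h12, apply_element_of_lt e hk]
        rw [Mem.set_of_ne _ _ _ hC12]
        simp only [run, Expr.eval, Expr.entry, Expr.var, h104, h114, h64, hval]
        refine ⟨fun z hz => ?_, ?_⟩
        · rw [Mem.set_apply, if_neg hz]
          exact hI4.1 z hz
        · rw [Mem.set_same, hI4.2, Finset.sum_range_succ]
  ext g h
  rw [Mem.matrix, of_apply, of_apply, main _ (e g).2 _ (e h).2]
  simp only [hF, element_apply]
  exact sum_range_element e fun k => f g h k

theorem store_run_of_ne {C : ℕ} (x : Expr) (m : Mem) {a : ℕ} (h10 : a ≠ 10) (h11 : a ≠ 11)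
    (h12 : a ≠ 12) (hC : a ≠ C) : (store C x).run m a = m a :=
  tab_run_of_ne _ m h10 h11 h12 hC

/-- The effect of `store`. -/
theorem store_run {C : ℕ} {x : Expr} {m : Mem} (A : Matrix G G ℤ)
    (hC : C ≠ 6 ∧ C ≠ 10 ∧ C ≠ 11 ∧ C ≠ 12) (hN : m 6 0 = Fintype.card G)
    (hx : ∀ g h (m' : Mem), (∀ a, a ≠ 10 → a ≠ 11 → a ≠ 12 → a ≠ C → m' a = m a) →
      m' 10 0 = ((e g : ℕ) : ℤ) → m' 11 0 = ((e h : ℕ) : ℤ) → x.eval m' = A g h) :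
    ((store C x).run m).matrix e C = A := by
  -- The indicator of k = g leaves a single term of the sum over k.
  rw [store, tab_run e (fun g h k => A g h * if k = g then 1 else 0) hC hN]
  · ext g h; simp
  · intro g h k m' hf h10 h11 h12
    simp only [Expr.eval, hx g h m' hf h10 h11, Expr.eval_indicator, Expr.var, h12, h10,
      natCast_eq_iff]

/-- The effect of `search`. -/
theorem search_run {A T : ℕ} {x : Expr} {m : Mem} {n : ℕ} (P : ℕ → Prop)
    (hA : A ≠ 6 ∧ A ≠ 12 ∧ A ≠ 16) (hT : T ≠ 6 ∧ T ≠ 12 ∧ T ≠ 16) (hAT : A ≠ T) (hN : m 6 0 = n)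
    (hx : ∀ r ≤ n, ∀ m' : Mem, (∀ a, a ≠ A → a ≠ T → a ≠ 12 → a ≠ 16 → m' a = m a) →
      m' A 0 = (r : ℤ) → m' T 0 = 2 ^ r → (0 < x.eval m' ↔ P r)) :
    ∃ r ≤ n + 1, (search A T x).run m A 0 = (r : ℤ) ∧ (search A T x).run m T 0 = 2 ^ r ∧
      (∀ i < r, P i) ∧ (r = n + 1 ∨ ¬ P r) := by
  obtain ⟨hA6, hA12, hA16⟩ := hA
  obtain ⟨hT6, hT12, hT16⟩ := hT
  set m1 := (m.set A 0 0).set T 0 1 with hm1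
  have h6 : m1 6 0 = n := by
    rw [hm1, Mem.set_of_ne _ _ _ hT6.symm, Mem.set_of_ne _ _ _ hA6.symm, hN]
  -- Once the test has failed, neither A nor T changes, so it keeps failing; thus either all passes
  -- so far succeeded or r is a point of failure.
  have key := loop_induction (c := 12) (e := .add (.var 6) (.const 1)) (m := m1) (n := n + 1)
      (p := ite x (seq (assign T (.const 0) (.mul (.const 2) (.var T)))
        (assign A (.const 0) (.add (.var A) (.const 1)))) (assign 16 (.const 0) (.const 0)))
      (by simp [Expr.eval, Expr.var, h6])
      (fun j m' => ∃ r ≤ j, m' A 0 = (r : ℤ) ∧ m' T 0 = 2 ^ r ∧ (∀ i < r, P i) ∧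
        (r = j ∨ ¬ P r)) ?_ ?_
  · exact key
  · refine ⟨0, le_rfl, ?_, ?_, by simp, Or.inl rfl⟩
    · rw [Mem.set_of_ne _ _ _ hA12, hm1, Mem.set_of_ne _ _ _ hAT, Mem.set_same]; rfl
    · rw [Mem.set_of_ne _ _ _ hT12, hm1, Mem.set_same, pow_zero]
  · rintro j hj m2 hf - ⟨r, hr, hrA, hrT, hrP, hrj⟩
    simp only [writes, List.mem_append, List.mem_cons, List.not_mem_nil, or_false, not_or] at hf
    have hxr := hx r (by omega) m2 (fun a a1 a2 a3 a4 => by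
      rw [hf a a3 ⟨⟨a2, a1⟩, a4⟩, hm1, Mem.set_of_ne _ _ _ a2, Mem.set_of_ne _ _ _ a1]) hrA hrT
    rw [Mem.set_of_ne _ _ _ hA12, Mem.set_of_ne _ _ _ hT12, run]
    split_ifs with h
    · have hP := hxr.1 h
      obtain rfl : r = j := hrj.resolve_right (not_not.2 hP)
      refine ⟨r + 1, le_rfl, ?_, ?_, ?_, Or.inl rfl⟩
      · simp [run, Expr.eval, Expr.var, Mem.set, hAT, hrA]
      · simp [run, Expr.eval, Expr.var, Mem.set, hAT.symm, hrT, pow_succ, mul_comm]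
      · intro i hi
        rcases Nat.lt_succ_iff_lt_or_eq.1 hi with h | rfl
        · exact hrP i h
        · exact hP
    · refine ⟨r, by omega, ?_, ?_, hrP, Or.inr fun hP => h (hxr.2 hP)⟩
      · simp [run, Mem.set, hA16, hrA]
      · simp [run, Mem.set, hT16, hrT]

end LoopProg

end Correctness

/-! ### The group in memory, and traces of matrix powers. -/

section Correctness

set_option linter.unusedSectionVars false

open Matrix LoopProg

variable {G : Type u} [Group G] [Fintype G] [DecidableEq G] (e : G ≃ Fin (Fintype.card G))

/-- The working arrays `6`, `7` and `8` hold the group and the generators. -/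
structure HoldsGroup (S : Finset G) (m : Mem) : Prop where
  order : m 6 0 = (Fintype.card G : ℤ)
  table : ∀ g h : G, m 7 (((e g : ℕ) : ℤ) * (Fintype.card G : ℤ) + ((e h : ℕ) : ℤ))
    = ((e (g * h) : ℕ) : ℤ)
  gens : ∀ g : G, m 8 ((e g : ℕ) : ℤ) = finsetIndicator ℤ S g

variable {e}

theorem HoldsGroup.congr {S : Finset G} {m m' : Mem} (h : HoldsGroup e S m)
    (hm : ∀ a ∈ [6, 7, 8], m' a = m a) : HoldsGroup e S m' where
  order := by rw [hm 6 (by decide)]; exact h.order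
  table := by rw [hm 7 (by decide)]; exact h.table
  gens := by rw [hm 8 (by decide)]; exact h.gens

theorem Mem.matrix_congr {m m' : Mem} {a : ℕ} (h : m a = m' a) :
    m.matrix e a = m'.matrix e a := by
  ext; simp [Mem.matrix, h]

theorem Mem.apply_entry {m : Mem} {a : ℕ} {A : Matrix G G ℤ} (h : m.matrix e a = A) (g k : G) :
    m a (((e g : ℕ) : ℤ) * (Fintype.card G : ℤ) + ((e k : ℕ) : ℤ)) = A g k := by
  rw [← h]; rfl

theorem eval_laplacianEntry {S : Finset G} {m : Mem} (h : HoldsGroup e S m) {i j g : G}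
    (hi : m 10 0 = ((e i : ℕ) : ℤ)) (hj : m 11 0 = ((e j : ℕ) : ℤ))
    (hg : m 12 0 = ((e g : ℕ) : ℤ)) :
    Expr.laplacianEntry.eval m = generatorLaplacian ℤ g i j := by
  simp only [Expr.laplacianEntry, Expr.eval, Expr.eval_indicator, Expr.entry, Expr.var, hi, hj, hg,
    h.order, h.table, natCast_eq_iff, generatorLaplacian, of_apply]

namespace LoopProg

theorem powerTrace_run {D : ℕ} {m : Mem} {p : ℕ} {M : Matrix G G ℤ}
    (hD : D ≠ 6 ∧ D ≠ 10 ∧ D ≠ 11 ∧ D ≠ 12 ∧ D ≠ 39) (hN : m 6 0 = Fintype.card G)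
    (hp : m 25 0 = p) (hM : m.matrix e 38 = M) : (powerTrace D).run m D 0 = (M ^ p).trace := by
  change (tab D _).run ((loop 44 _ _).run ((store 39 _).run m)) D 0 = _
  have h1 := store_run (C := 39) (x := .indicator (.var 10) (.var 11)) e 1 (by norm_num) hN (by
    intro g h m' hf h10 h11
    simp only [Expr.eval, Expr.eval_indicator, Expr.var, h10, h11, natCast_eq_iff, one_apply])
  have hf1 : ∀ a, a ≠ 10 → a ≠ 11 → a ≠ 12 → a ≠ 39 →
      (store 39 (.indicator (.var 10) (.var 11))).run m a = m a :=
    fun a h1 h2 h3 h4 => store_run_of_ne _ _ h1 h2 h3 h4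
  generalize (store 39 (.indicator (.var 10) (.var 11))).run m = m1 at *
  have hloop := loop_induction (c := 44) (e := .var 25) (m := m1) (n := p)
    (p := seq (tab 45 (.mul (.entry 39 (.var 10) (.var 12)) (.entry 38 (.var 12) (.var 11))))
      (store 39 (.entry 45 (.var 10) (.var 11))))
    (by simp [Expr.eval, Expr.var, hf1, hp]) (fun j m' => m'.matrix e 39 = M ^ j)
    (by rw [pow_zero, ← h1]; exact Mem.matrix_congr (Mem.set_of_ne _ _ _ (by norm_num))) (by
      intro j hj m2 hf _ hI
      have h6 : m2 6 0 = Fintype.card G := by rw [hf 6 (by decide) (by decide), hf1] <;> norm_num [hN]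
      have h38 : m2.matrix e 38 = M := by
        rw [← hM]; exact Mem.matrix_congr (by rw [hf 38 (by decide) (by decide), hf1] <;> norm_num)
      rw [Mem.matrix_congr (Mem.set_of_ne _ _ _ (by norm_num))]
      change ((store 39 _).run ((tab 45 _).run m2)).matrix e 39 = _
      have h45 := tab_run (C := 45) (x := .mul (.entry 39 (.var 10) (.var 12))
          (.entry 38 (.var 12) (.var 11))) e (fun g h k => (M ^ j) g k * M k h) (by norm_num) h6 (by
        intro g h k m' hf' h10 h11 h12
        simp (disch := decide) only [Expr.eval, Expr.entry, Expr.var, h10, h11, h12, hf', h6,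
          Mem.apply_entry hI, Mem.apply_entry h38])
      have hf2 := fun a h1 h2 h3 h4 => tab_run_of_ne (C := 45) (.mul (.entry 39 (.var 10) (.var 12))
          (.entry 38 (.var 12) (.var 11))) m2 (a := a) h1 h2 h3 h4
      generalize (tab 45 _).run m2 = m3 at *
      refine store_run e _ (by norm_num) (by rw [hf2 6] <;> norm_num [h6]) ?_
      intro g h m' hf' h10 h11
      simp (disch := decide) only [Expr.eval, Expr.entry, Expr.var, h10, h11, hf', hf2, h6,
        Mem.apply_entry h45]
      rw [pow_succ]; rfl)
  have h63 := run_of_notMem_writes (loop 44 (.var 25)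
    (seq (tab 45 (.mul (.entry 39 (.var 10) (.var 12)) (.entry 38 (.var 12) (.var 11))))
      (store 39 (.entry 45 (.var 10) (.var 11))))) m1 (a := 6) (by decide)
  generalize (loop 44 _ _).run m1 = m4 at *
  have h64 : m4 6 0 = Fintype.card G := by rw [h63, hf1] <;> norm_num [hN]
  have hend := tab_run (C := D) (x := .entry 39 (.var 12) (.var 12)) (m := m4) e
    (fun _ _ k => (M ^ p) k k) ⟨hD.1, hD.2.1, hD.2.2.1, hD.2.2.2.1⟩ h64 (by
      intro g h k m' hf' h10 h11 h12
      simp only [Expr.eval, Expr.entry, Expr.var, h12,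
        hf' 39 (by norm_num) (by norm_num) (by norm_num) hD.2.2.2.2.symm,
        hf' 6 (by norm_num) (by norm_num) (by norm_num) hD.1.symm, h64, Mem.apply_entry hloop])
  -- All entries of the matrix in D equal the trace; the one in row 0 and column 0 occupies cell 0.
  have h0 := Mem.apply_entry hend (element e 0) (element e 0)
  rw [apply_element] at h0
  simpa [trace] using h0

end LoopProg

end Correctness

/-! ### Correctness of the preconditioner and of the candidate potential. -/

section Correctness

set_option linter.unusedSectionVars false

open Matrix LoopProg

variable {G : Type u} [Group G] [Fintype G] [DecidableEq G] {e : G ≃ Fin (Fintype.card G)}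
  {S : Finset G}

theorem weightLaplacian_apply (w : G → ℤ) (i j : G) :
    weightLaplacian ℤ w i j = ∑ g, w g * generatorLaplacian ℤ g i j := by
  simp only [weightLaplacian, Matrix.sum_apply, Matrix.smul_apply, smul_eq_mul]

namespace LoopProg

/-- The product is first built in array 33, since `tab_run` requires that the entry expression does
not depend on the array being filled. -/
theorem preconditionerStep_run {m : Mem} {z : ℤ} {L P : Matrix G G ℤ}
    (hN : m 6 0 = Fintype.card G) (hL : m.matrix e 30 = L) (hP : m.matrix e 31 = P)
    (hz : m 32 0 = z) :
    (preconditionerStep.run m).matrix e 31 = ((4 * Fintype.card G : ℤ) • 1 - L) * P + z • 1 ∧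
      preconditionerStep.run m 32 0 = 4 * Fintype.card G * z := by
  have h33 := tab_run (C := 33) (m := m) (x := .add (.mul (.sub (.mul (.mul (.const 4) (.var 6))
      (.indicator (.var 10) (.var 12))) (.entry 30 (.var 10) (.var 12)))
      (.entry 31 (.var 12) (.var 11))) (.mul (.mul (.var 32) (.indicator (.var 10) (.var 11)))
      (.indicator (.var 12) (.var 10)))) e
      (fun g h k => (4 * Fintype.card G * (if g = k then 1 else 0) - L g k) * P k h +
        z * (if g = h then 1 else 0) * (if k = g then 1 else 0)) (by norm_num) hN (by
    intro g h k m' hf h10 h11 h12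
    simp (disch := decide) only [Expr.eval, Expr.entry, Expr.var, Expr.eval_indicator, h10, h11,
      h12, hf, hN, hz, Mem.apply_entry hL, Mem.apply_entry hP, natCast_eq_iff])
  rw [preconditionerStep, run, run]
  have hf1 := fun a h1 h2 h3 h4 => tab_run_of_ne (C := 33) (.add (.mul (.sub (.mul
      (.mul (.const 4) (.var 6))
      (.indicator (.var 10) (.var 12))) (.entry 30 (.var 10) (.var 12)))
      (.entry 31 (.var 12) (.var 11))) (.mul (.mul (.var 32) (.indicator (.var 10) (.var 11)))
      (.indicator (.var 12) (.var 10)))) m (a := a) h1 h2 h3 h4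
  generalize (tab 33 _).run m = m1 at *
  have h61 : m1 6 0 = Fintype.card G := by rw [hf1 6] <;> norm_num [hN]
  have h31 := store_run (C := 31) (m := m1) (x := .entry 33 (.var 10) (.var 11)) e _ (by norm_num)
    h61 (by
      intro g h m' hf h10 h11
      simp (disch := decide) only [Expr.eval, Expr.entry, Expr.var, h10, h11, hf, h61]
      rw [Mem.apply_entry h33])
  have hf2 := fun a h1 h2 h3 h4 => store_run_of_ne (C := 31)
    (.entry 33 (.var 10) (.var 11)) m1 (a := a) h1 h2 h3 h4
  generalize (store 31 _).run m1 = m2 at *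
  constructor
  · rw [run, Mem.matrix_congr (Mem.set_of_ne _ _ _ (by norm_num)), h31]
    ext g h
    rw [of_apply, Finset.sum_add_distrib, Matrix.add_apply, mul_apply]
    congr 1
    · simp [one_apply]
  · rw [run]
    simp (disch := decide) only [Expr.eval, Expr.var, Mem.set_same, hf1, hf2, hN, hz]

theorem preconditioner_run {m : Mem} {K : ℤ} (hm : HoldsGroup e S m) (hK : m 24 0 = K)
    (h26 : m 26 0 = (2 * Fintype.card G ^ 3 : ℕ)) :
    (preconditioner.run m).matrix e 31 = intPreconditioner S (2 * Fintype.card G ^ 3) ∧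
      preconditioner.run m 34 0
        = 2 * K * (4 * Fintype.card G : ℤ) ^ (2 * Fintype.card G ^ 3) := by
  have h30 := tab_run (C := 30) (m := m) (x := .mul (.get 8 (.var 12)) .laplacianEntry) e
    (fun i j g => finsetIndicator ℤ S g * generatorLaplacian ℤ g i j) (by norm_num) hm.order (by
      intro i j g m' hf h10 h11 h12
      have hm' : HoldsGroup e S m' := hm.congr (by
        intro a ha
        refine hf a ?_ ?_ ?_ ?_ <;> rintro rfl <;> simp at ha)
      simp only [Expr.eval, Expr.var, h12, hm'.gens, eval_laplacianEntry hm' h10 h11 h12])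
  have h30' : (of fun i j => ∑ g, finsetIndicator ℤ S g * generatorLaplacian ℤ g i j)
      = doubleLaplacian ℤ S := by
    ext i j
    rw [of_apply, doubleLaplacian, weightLaplacian_apply]
  rw [h30'] at h30
  rw [preconditioner, run, run, run, run]
  have hf1 := fun a h1 h2 h3 h4 => tab_run_of_ne (C := 30) (.mul (.get 8 (.var 12))
    .laplacianEntry) m (a := a) h1 h2 h3 h4
  generalize (tab 30 _).run m = m1 at *
  have h61 : m1 6 0 = Fintype.card G := by rw [hf1 6] <;> norm_num [hm.order]
  have h31 := store_run (C := 31) (m := m1) (x := .const 0) e (0 : Matrix G G ℤ) (by norm_num) h61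
    (by intro g h m' _ _ _; rfl)
  have hf2 := fun a h1 h2 h3 h4 => store_run_of_ne (C := 31) (.const 0) m1 (a := a) h1 h2 h3 h4
  generalize (store 31 _).run m1 = m2 at *
  rw [run]
  simp only [Expr.eval]
  have hloop := loop_induction (c := 27) (e := .var 26) (m := m2.set 32 0 1)
    (n := 2 * Fintype.card G ^ 3) (p := preconditionerStep) (by
      simp (disch := decide) only [Expr.eval, Expr.var, Mem.set_of_ne, hf1, hf2, h26])
    (fun j m' => m'.matrix e 31 = intPreconditioner S j
      ∧ m' 32 0 = (4 * Fintype.card G : ℤ) ^ j) (by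
      constructor
      · rw [intPreconditioner, ← h31]
        exact Mem.matrix_congr (by simp (disch := decide) only [Mem.set_of_ne])
      · rw [Mem.set_of_ne _ _ _ (by norm_num), Mem.set_same, pow_zero]) (by
      rintro j - m3 hf - ⟨hI1, hI2⟩
      have h6 : m3 6 0 = Fintype.card G := by
        rw [hf 6 (by decide) (by decide), Mem.set_of_ne _ _ _ (by norm_num), hf2 6] <;>
          norm_num [h61]
      have h303 : m3.matrix e 30 = doubleLaplacian ℤ S := by
        rw [← h30]
        exact Mem.matrix_congr (by
          rw [hf 30 (by decide) (by decide), Mem.set_of_ne _ _ _ (by norm_num), hf2 30] <;>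
            norm_num)
      obtain ⟨h4, h5⟩ := preconditionerStep_run h6 h303 hI1 hI2
      rw [Mem.matrix_congr (Mem.set_of_ne _ _ _ (by norm_num)), h4,
        Mem.set_of_ne _ _ _ (by norm_num), h5, intPreconditioner, pow_succ']
      exact ⟨rfl, rfl⟩)
  have hf3 := run_of_notMem_writes (loop 27 (.var 26) preconditionerStep) (m2.set 32 0 1)
    (a := 24) (by decide)
  generalize (loop 27 _ _).run _ = m4 at *
  rw [run]
  refine ⟨?_, ?_⟩
  · rw [Mem.matrix_congr (Mem.set_of_ne _ _ _ (by norm_num)), hloop.1]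
  · have h24 : m4 24 0 = K := by
      rw [hf3, Mem.set_of_ne _ _ _ (by norm_num), hf2, hf1, hK] <;> norm_num
    simp only [Expr.eval, Expr.var, Mem.set_same, h24, hloop.2]

theorem decode_run {m : Mem} {a r : ℕ} (ha : a ≠ 48 ∧ a ≠ 49) (hN : m 6 0 = Fintype.card G)
    (hr : m a 0 = r) : (decode a).run m 48 0 = (r / Fintype.card G : ℕ) ∧
      (decode a).run m 49 0 = ((e (element e r) : ℕ) : ℤ) := by
  have h1 : (r : ℤ) - ((r / Fintype.card G : ℕ) : ℤ) * Fintype.card G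
      = ((r % Fintype.card G : ℕ) : ℤ) := by
    have := Nat.div_add_mod r (Fintype.card G)
    have h2 : (r : ℤ) = ((Fintype.card G * (r / Fintype.card G) + r % Fintype.card G : ℕ) : ℤ) := by
      rw [this]
    push_cast at h2 ⊢
    linarith
  rw [apply_element, ← h1]
  simp [decode, run, Expr.eval, Expr.var, Mem.set, ha.1, hN, hr]

end LoopProg

variable (e S)

/-- The memory holds the parameters and the preconditioner. -/
structure HoldsParameters (l h E : ℕ) (m : Mem) : Prop extends HoldsGroup e S m where
  l_eq : m 17 0 = l
  h_eq : m 19 0 = h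
  rounds_eq : m 24 0 = greedyRounds l h E
  exponent_eq : m 25 0 = greedyExponent l E
  preconditioner_eq : m.matrix e 31 = intPreconditioner S (2 * Fintype.card G ^ 3)
  scale_eq : m 34 0 = intScale G l h E

variable {e S} {l h E : ℕ}

theorem HoldsParameters.congr {m m' : Mem} (H : HoldsParameters e S l h E m)
    (hm : ∀ a ∈ [6, 7, 8, 17, 19, 24, 25, 31, 34], m' a = m a) :
    HoldsParameters e S l h E m' where
  toHoldsGroup := H.toHoldsGroup.congr fun a ha => hm a (by
    simp only [List.mem_cons, List.not_mem_nil, or_false] at ha ⊢; tauto)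
  l_eq := by rw [hm 17 (by decide)]; exact H.l_eq
  h_eq := by rw [hm 19 (by decide)]; exact H.h_eq
  rounds_eq := by rw [hm 24 (by decide)]; exact H.rounds_eq
  exponent_eq := by rw [hm 25 (by decide)]; exact H.exponent_eq
  preconditioner_eq := by rw [Mem.matrix_congr (hm 31 (by decide))]; exact H.preconditioner_eq
  scale_eq := by rw [hm 34 (by decide)]; exact H.scale_eq

namespace LoopProg

/-- The frame property in a form that is decided by evaluation. -/
theorem run_eq_of_writes {p : LoopProg} (m : Mem) {l : List ℕ}
    (h : (l.all fun a => !p.writes.contains a) = true) : ∀ a ∈ l, p.run m a = m a := by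
  intro a ha
  refine run_of_notMem_writes p m ?_
  have := List.all_eq_true.1 h a ha
  simpa using this

/-- Array 36 receives the Laplacian of the deviation weights, array 37 its preconditioned form, and
array 38 in turn the sum and the difference of the scaled identity and array 37; the traces of the
powers are collected in arrays 46 and 47. -/
theorem candidatePotential_run {m : Mem} {V : G → ℤ} {t r : ℕ}
    (H : HoldsParameters e S l h E m) (hV : ∀ g, m 35 ((e g : ℕ) : ℤ) = V g) (ht : m 28 0 = t)
    (hr : m 43 0 = r) : candidatePotential.run m 50 0
      = intPotential S l h E (addGenerator S V (element e r) (r / Fintype.card G)) (t + 1) := by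
  set V' := addGenerator S V (element e r) (r / Fintype.card G) with hV'
  rw [candidatePotential, run, run, run, run, run, run, run]
  obtain ⟨h48, h49⟩ := decode_run (e := e) (a := 43) (by norm_num) H.order hr
  have hf1 := run_eq_of_writes (p := decode 43) m
    (l := [6, 7, 8, 17, 19, 24, 25, 31, 34, 28, 35]) (by decide)
  generalize (decode 43).run m = m1 at *
  have H1 : HoldsParameters e S l h E m1 := H.congr fun a ha => hf1 a (by
    simp only [List.mem_cons, List.not_mem_nil, or_false] at ha ⊢; tauto)
  have hV1 : ∀ g, m1 35 ((e g : ℕ) : ℤ) = V g := by rw [hf1 35 (by decide)]; exact hV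
  have ht1 : m1 28 0 = t := by rw [hf1 28 (by decide)]; exact ht
  clear hf1 H hV ht hr m
  have h36 := tab_run (C := 36) (m := m1) (x := .mul (.sub (.mul (.mul (.var 17) (.var 19))
          (.add (.get 35 (.var 12))
          (.mul (.indicator (.var 12) (.var 49)) (.mul (.var 48) (.get 8 (.var 49))))))
          (.mul (.add (.var 28) (.const 1)) (.get 8 (.var 12)))) .laplacianEntry) e
    (fun i j g => deviationWeight S l h V' (t + 1) g * generatorLaplacian ℤ g i j)
    (by norm_num) H1.order (by
      intro i j g m' hf h10 h11 h12
      have hm' : HoldsParameters e S l h E m' := H1.congr (by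
        intro a ha
        refine hf a ?_ ?_ ?_ ?_ <;> rintro rfl <;> simp at ha)
      rw [Expr.eval, eval_laplacianEntry hm'.toHoldsGroup h10 h11 h12]
      congr 1
      simp (disch := decide) only [Expr.eval, Expr.var, Expr.eval_indicator, h12, hf, h48, h49,
        H1.gens, H1.l_eq, H1.h_eq, hV1, ht1, natCast_eq_iff, hV', deviationWeight, addGenerator]
      split_ifs <;> push_cast <;> ring)
  have h36' : (of fun i j => ∑ g, deviationWeight S l h V' (t + 1) g * generatorLaplacian ℤ g i j)
      = weightLaplacian ℤ (deviationWeight S l h V' (t + 1)) := by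
    ext i j
    rw [of_apply, weightLaplacian_apply]
  rw [h36'] at h36
  have hf2 := run_eq_of_writes (p := tab 36 (.mul (.sub (.mul (.mul (.var 17) (.var 19))
          (.add (.get 35 (.var 12))
          (.mul (.indicator (.var 12) (.var 49)) (.mul (.var 48) (.get 8 (.var 49))))))
          (.mul (.add (.var 28) (.const 1)) (.get 8 (.var 12)))) .laplacianEntry)) m1
    (l := [6, 7, 8, 17, 19, 24, 25, 31, 34]) (by decide)
  generalize (tab 36 _).run m1 = m2 at *
  have H2 : HoldsParameters e S l h E m2 := H1.congr hf2
  clear hf2 H1 hV1 ht1 h48 h49 m1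
  have h37 : ((tab 37 (.mul (.entry 31 (.var 10) (.var 12)) (.entry 36 (.var 12)
      (.var 11)))).run m2).matrix e 37 = intDeviation S l h V' (t + 1) := by
    rw [tab_run e (fun g h' k => intPreconditioner S (2 * Fintype.card G ^ 3) g k *
        weightLaplacian ℤ (deviationWeight S l h V' (t + 1)) k h') (by norm_num) H2.order]
    · ext g k; rw [of_apply, intDeviation, mul_apply]
    · intro i j k m' hf h10 h11 h12
      simp (disch := decide) only [Expr.eval, Expr.var, Expr.entry, h10, h11, h12, hf, H2.order,
        Mem.apply_entry H2.preconditioner_eq, Mem.apply_entry h36]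
  have hf3 := run_eq_of_writes (p := tab 37 (.mul (.entry 31 (.var 10) (.var 12))
    (.entry 36 (.var 12) (.var 11)))) m2 (l := [6, 7, 8, 17, 19, 24, 25, 31, 34]) (by decide)
  generalize (tab 37 _).run m2 = m3 at *
  have H3 : HoldsParameters e S l h E m3 := H2.congr hf3
  clear hf3 H2 h36 m2
  set F := intDeviation S l h V' (t + 1) with hF
  have h38 := store_run (C := 38) (m := m3) (x := .add (.mul (.var 34)
      (.indicator (.var 10) (.var 11))) (.entry 37 (.var 10) (.var 11))) e
    (intScale G l h E • 1 + F) (by norm_num) H3.order (by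
      intro i j m' hf h10 h11
      simp (disch := decide) only [Expr.eval, Expr.var, Expr.entry, Expr.eval_indicator, h10, h11,
        hf, H3.order, H3.scale_eq, Mem.apply_entry h37, natCast_eq_iff, Matrix.add_apply,
        Matrix.smul_apply, one_apply, smul_eq_mul])
  have hf4 := run_eq_of_writes (p := store 38 (.add (.mul (.var 34)
      (.indicator (.var 10) (.var 11))) (.entry 37 (.var 10) (.var 11)))) m3
      (l := [6, 7, 8, 17, 19, 24, 25, 31, 34, 37]) (by decide)
  generalize (store 38 _).run m3 = m4 at *
  have H4 : HoldsParameters e S l h E m4 := H3.congr fun a ha => hf4 a (by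
    simp only [List.mem_cons, List.not_mem_nil, or_false] at ha ⊢; tauto)
  have h374 : m4.matrix e 37 = F := by rw [Mem.matrix_congr (hf4 37 (by decide)), h37]
  clear hf4 H3 h37 m3
  have h46 := powerTrace_run (D := 46) (by norm_num) H4.order H4.exponent_eq h38
  have hf5 := run_eq_of_writes (p := powerTrace 46) m4
      (l := [6, 7, 8, 17, 19, 24, 25, 31, 34, 37]) (by decide)
  generalize (powerTrace 46).run m4 = m5 at *
  have H5 : HoldsParameters e S l h E m5 := H4.congr fun a ha => hf5 a (by
    simp only [List.mem_cons, List.not_mem_nil, or_false] at ha ⊢; tauto)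
  have h375 : m5.matrix e 37 = F := by rw [Mem.matrix_congr (hf5 37 (by decide)), h374]
  clear hf5 H4 h38 h374 m4
  have h38 := store_run (C := 38) (m := m5) (x := .sub (.mul (.var 34)
      (.indicator (.var 10) (.var 11))) (.entry 37 (.var 10) (.var 11))) e
    (intScale G l h E • 1 - F) (by norm_num) H5.order (by
      intro i j m' hf h10 h11
      simp (disch := decide) only [Expr.eval, Expr.var, Expr.entry, Expr.eval_indicator, h10, h11,
        hf, H5.order, H5.scale_eq, Mem.apply_entry h375, natCast_eq_iff, Matrix.sub_apply,
        Matrix.smul_apply, one_apply, smul_eq_mul])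
  have hf6 := run_eq_of_writes (p := store 38 (.sub (.mul (.var 34)
      (.indicator (.var 10) (.var 11))) (.entry 37 (.var 10) (.var 11)))) m5
      (l := [6, 7, 8, 17, 19, 24, 25, 31, 34, 46]) (by decide)
  generalize (store 38 _).run m5 = m6 at *
  have H6 : HoldsParameters e S l h E m6 := H5.congr fun a ha => hf6 a (by
    simp only [List.mem_cons, List.not_mem_nil, or_false] at ha ⊢; tauto)
  have h466 : m6 46 0 = _ := (congrFun (hf6 46 (by decide)) 0).trans h46
  clear hf6 H5 h46 h375 m5
  have h47 := powerTrace_run (D := 47) (by norm_num) H6.order H6.exponent_eq h38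
  have hf7 := run_eq_of_writes (p := powerTrace 47) m6 (l := [46]) (by decide)
  generalize (powerTrace 47).run m6 = m7 at *
  have h467 : m7 46 0 = _ := (congrFun (hf7 46 (by decide)) 0).trans h466
  rw [run]
  simp only [Expr.eval, Expr.var, Mem.set_same, h467, h47, intPotential, ← hF]

end LoopProg

end Correctness

/-! ### Correctness of the greedy rounds and of the output. -/

section Correctness

set_option linter.unusedSectionVars false

open Matrix LoopProg

variable {G : Type u} [Group G] [Fintype G] [DecidableEq G] {e : G ≃ Fin (Fintype.card G)}
  {S : Finset G} {l h E : ℕ}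

namespace LoopProg

theorem improve_run {m : Mem} {v : ℕ → ℤ} {j : ℕ} (h50 : m 50 0 = v j) (h43 : m 43 0 = j)
    (hm : (j = 0 ∧ m 41 0 = 1) ∨ (m 41 0 = 0 ∧ ∃ r < j, m 42 0 = (r : ℕ) ∧ m 40 0 = v r ∧
      ∀ r' < j, v r ≤ v r')) :
    improve.run m 41 0 = 0 ∧ ∃ r < j + 1, improve.run m 42 0 = (r : ℕ) ∧
      improve.run m 40 0 = v r ∧ ∀ r' < j + 1, v r ≤ v r' := by
  rw [improve, run]
  rcases hm with ⟨rfl, h41⟩ | ⟨h41, r, hr, h42, h40, hmin⟩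
  · rw [if_pos (by simp [Expr.eval, Expr.var, h41])]
    simp [run, Expr.eval, Expr.var, Mem.set, h50, h43]
  · have hval : (Expr.add (.sub (.var 40) (.var 50)) (.mul (.var 41)
        (.sub (.add (.const 1) (.var 50)) (.var 40)))).eval m = v r - v j := by
      simp [Expr.eval, Expr.var, h41, h40, h50]
    rw [hval]
    split_ifs with hlt
    · refine ⟨by simp [run, Expr.eval, Mem.set], j, by omega, ?_, ?_, ?_⟩
      · simp [run, Expr.eval, Expr.var, Mem.set, h43]
      · simp [run, Expr.eval, Expr.var, Mem.set, h50]
      · intro r' hr'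
        rcases Nat.lt_succ_iff_lt_or_eq.1 hr' with h | rfl
        · exact (by linarith : v j ≤ v r).trans (hmin r' h)
        · exact le_rfl
    · refine ⟨by simp [run, Mem.set, h41], r, by omega, ?_, ?_, ?_⟩
      · simp [run, Mem.set, h42]
      · simp [run, Mem.set, h40]
      · intro r' hr'
        rcases Nat.lt_succ_iff_lt_or_eq.1 hr' with h | rfl
        · exact hmin r' h
        · linarith

theorem greedyRound_run {m : Mem} {V : G → ℤ} {t : ℕ} (H : HoldsParameters e S l h E m)
    (hV : ∀ g, m 35 ((e g : ℕ) : ℤ) = V g) (ht : m 28 0 = t) :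
    ∃ V', IsGreedyStep S l h E t V V' ∧ ∀ g, greedyRound.run m 35 ((e g : ℕ) : ℤ) = V' g := by
  have hn0 : 0 < Fintype.card G := Fintype.card_pos
  set v : ℕ → ℤ := fun r => intPotential S l h E (addGenerator S V (element e r) (r / Fintype.card G)) (t + 1)
    with hv
  change ∃ V', IsGreedyStep S l h E t V V' ∧ ∀ g, (assign 35 _ _).run ((decode 42).run
    ((loop 43 _ _).run ((assign 41 _ _).run m))) 35 ((e g : ℕ) : ℤ) = V' g
  have hf1 := run_eq_of_writes (p := assign 41 (.const 0) (.const 1)) m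
    (l := [6, 7, 8, 17, 19, 24, 25, 31, 34, 28, 35]) (by decide)
  have h41 : (assign 41 (.const 0) (.const 1)).run m 41 0 = 1 := Mem.set_same m 41 0 1
  generalize (assign 41 (.const 0) (.const 1)).run m = m1 at *
  have H1 : HoldsParameters e S l h E m1 := H.congr fun a ha => hf1 a (by
    simp only [List.mem_cons, List.not_mem_nil, or_false] at ha ⊢; tauto)
  have hV1 : ∀ g, m1 35 ((e g : ℕ) : ℤ) = V g := by rw [hf1 35 (by decide)]; exact hV
  have ht1 : m1 28 0 = t := by rw [hf1 28 (by decide)]; exact ht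
  have hloop := loop_induction (c := 43) (e := .mul (.var 6) (.add (.var 6) (.const 1))) (m := m1)
    (n := Fintype.card G * (Fintype.card G + 1)) (p := seq candidatePotential improve)
    (by simp [Expr.eval, Expr.var, H1.order])
    (fun j m' => (j = 0 ∧ m' 41 0 = 1) ∨ (m' 41 0 = 0 ∧ ∃ r < j, m' 42 0 = (r : ℕ) ∧
      m' 40 0 = v r ∧ ∀ r' < j, v r ≤ v r'))
    (Or.inl ⟨rfl, by rw [Mem.set_of_ne _ _ _ (by norm_num)]; exact h41⟩) (by
      intro j hj m2 hf h43 hI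
      have hf' : ∀ a ∈ [6, 7, 8, 17, 19, 24, 25, 31, 34, 28, 35], m2 a = m1 a := by
        intro a ha
        have := List.all_eq_true.1 (by decide : ([6, 7, 8, 17, 19, 24, 25, 31, 34, 28, 35].all fun a =>
          !(43 :: (seq candidatePotential improve).writes).contains a) = true) a ha
        simp only [Bool.not_eq_true', List.contains_eq_mem, decide_eq_false_iff_not,
          List.mem_cons, not_or] at this
        exact hf a this.1 this.2
      have H2 : HoldsParameters e S l h E m2 := H1.congr fun a ha => hf' a (by
        simp only [List.mem_cons, List.not_mem_nil, or_false] at ha ⊢; tauto)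
      have h50 := candidatePotential_run H2 (V := V) (by rw [hf' 35 (by decide)]; exact hV1)
        (by rw [hf' 28 (by decide)]; exact ht1) h43
      have hf2 := run_eq_of_writes (p := candidatePotential) m2 (l := [40, 41, 42, 43]) (by decide)
      rw [run]
      generalize candidatePotential.run m2 = m3 at *
      rw [← hf2 41 (by decide), ← hf2 42 (by decide), ← hf2 40 (by decide)] at hI
      rw [← hf2 43 (by decide)] at h43
      right
      rw [Mem.set_of_ne _ _ _ (by norm_num), Mem.set_of_ne _ _ _ (by norm_num),
        Mem.set_of_ne _ _ _ (by norm_num)]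
      exact improve_run (v := v) h50 h43 hI)
  have hf2 := run_eq_of_writes (p := loop 43 (.mul (.var 6) (.add (.var 6) (.const 1)))
    (seq candidatePotential improve)) m1 (l := [6, 8, 35]) (by decide)
  generalize (loop 43 _ _).run m1 = m2 at *
  rcases hloop with ⟨h0, _⟩ | ⟨_, r, hr, h42, _, hmin⟩
  · exact absurd h0 (by positivity)
  have h62 : m2 6 0 = Fintype.card G := by rw [hf2 6 (by decide)]; exact H1.order
  obtain ⟨h48, h49⟩ := decode_run (e := e) (a := 42) (by norm_num) h62 h42
  have hf3 := run_eq_of_writes (p := decode 42) m2 (l := [6, 8, 35]) (by decide)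
  generalize (decode 42).run m2 = m3 at *
  have hV3 : ∀ g, m3 35 ((e g : ℕ) : ℤ) = V g := by
    rw [hf3 35 (by decide), hf2 35 (by decide)]; exact hV1
  have hS3 : ∀ g, m3 8 ((e g : ℕ) : ℤ) = finsetIndicator ℤ S g := by
    rw [hf3 8 (by decide), hf2 8 (by decide)]; exact H1.gens
  refine ⟨addGenerator S V (element e r) (r / Fintype.card G), ⟨⟨_, r / Fintype.card G, ?_, rfl⟩, ?_⟩, ?_⟩
  · exact Nat.lt_succ_iff.1 ((Nat.div_lt_iff_lt_mul hn0).2 (by rwa [mul_comm]))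
  · intro s c hc
    -- Every candidate occurs: generator s with multiplicity c ≤ N has number cN + e(s), and
    -- decoding is division with remainder by N.
    have h1 : c * Fintype.card G + e s < Fintype.card G * (Fintype.card G + 1) := by
      have := (e s).2
      nlinarith [Nat.mul_le_mul_right (Fintype.card G) hc]
    have h2 := hmin _ h1
    have h3 : element e (c * Fintype.card G + e s) = s := by
      have h4 : element e (c * Fintype.card G + e s) = element e (e s) := by
        simp only [element, Nat.mul_add_mod_self_right]
      rw [h4, element_apply]
    have h5 : (c * Fintype.card G + e s) / Fintype.card G = c := by
      rw [mul_comm, Nat.mul_add_div hn0, Nat.div_eq_of_lt (e s).2, add_zero]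
    simp only [hv, h3, h5] at h2
    exact h2
  · intro g
    rw [run]
    simp only [Expr.eval, Expr.var, h48, h49, hV3, hS3]
    simp only [Mem.set_apply, natCast_eq_iff, addGenerator]
    split_ifs with hg
    · rw [hg]
    · rw [hV3, add_zero]

theorem writeWeights_run {m : Mem} {V : G → ℤ} (H : HoldsParameters e S l h E m)
    (hV : ∀ g, m 35 ((e g : ℕ) : ℤ) = V g) (s : G) :
    writeWeights.run m 4 ((e s : ℕ) : ℤ) = l * h * (V s + V s⁻¹) ∧
      writeWeights.run m 5 ((e s : ℕ) : ℤ) = 2 * greedyRounds l h E := by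
  have h4 := tab_run (C := 4) (m := m) (x := .mul (.mul (.mul (.var 17) (.var 19))
      (.add (.get 35 (.var 11)) (.get 35 (.var 12))))
      (.indicator (.entry 7 (.entry 7 (.var 11) (.var 12)) (.var 11)) (.var 11))) e
    (fun _ j k => l * h * (V j + V k) * if k = j⁻¹ then 1 else 0) (by norm_num) H.order (by
      intro i j k m' hf h10 h11 h12
      -- The condition k = j⁻¹ is tested as jkj = j, which uses the multiplication table alone, with
      -- no need to locate the identity.
      have hk : j * k * j = j ↔ k = j⁻¹ := by
        rw [mul_eq_right, mul_eq_one_iff_eq_inv', eq_comm]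
      simp (disch := decide) only [Expr.eval, Expr.var, Expr.entry, Expr.eval_indicator, h11, h12,
        hf, H.order, H.table, H.l_eq, H.h_eq, hV, natCast_eq_iff, hk])
  rw [writeWeights, run]
  have hf1 := run_eq_of_writes (p := tab 4 (.mul (.mul (.mul (.var 17) (.var 19))
      (.add (.get 35 (.var 11)) (.get 35 (.var 12))))
      (.indicator (.entry 7 (.entry 7 (.var 11) (.var 12)) (.var 11)) (.var 11)))) m
    (l := [6, 24]) (by decide)
  generalize (tab 4 _).run m = m1 at *
  have h61 : m1 6 0 = Fintype.card G := by rw [hf1 6 (by decide)]; exact H.order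
  have h5 := store_run (C := 5) (m := m1) (x := .mul (.const 2) (.var 24)) e
    (of fun _ _ => 2 * greedyRounds l h E) (by norm_num) h61 (by
      intro i j m' hf h10 h11
      simp (disch := decide) only [Expr.eval, Expr.var, hf, hf1 24 (by decide), H.rounds_eq,
        of_apply])
  -- Every row of the stored matrices is the same; row 0 occupies the first N cells, where the
  -- output is expected.
  have a4 := Mem.apply_entry h4 (element e 0) s
  have a5 := Mem.apply_entry h5 (element e 0) s
  rw [apply_element] at a4 a5
  constructor
  · rw [store_run_of_ne _ _ (by norm_num) (by norm_num) (by norm_num) (by norm_num)]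
    simpa using a4
  · simpa using a5

theorem writeOnes_run {m : Mem} (hN : m 6 0 = Fintype.card G) (s : G) :
    writeOnes.run m 4 ((e s : ℕ) : ℤ) = 1 ∧ writeOnes.run m 5 ((e s : ℕ) : ℤ) = 1 := by
  have h4 := store_run (C := 4) (m := m) (x := .const 1) e (of fun _ _ => 1) (by norm_num) hN
    (by intro g h m' _ _ _; rfl)
  have hf1 := run_eq_of_writes (p := store 4 (.const 1)) m (l := [6]) (by decide)
  rw [writeOnes, run]
  generalize (store 4 _).run m = m1 at *
  have h5 := store_run (C := 5) (m := m1) (x := .const 1) e (of fun _ _ => 1) (by norm_num)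
    (by rw [hf1 6 (by decide), hN]) (by intro g h m' _ _ _; rfl)
  have a4 := Mem.apply_entry h4 (element e 0) s
  have a5 := Mem.apply_entry h5 (element e 0) s
  rw [apply_element] at a4 a5
  constructor
  · rw [store_run_of_ne _ _ (by norm_num) (by norm_num) (by norm_num) (by norm_num)]
    simpa using a4
  · simpa using a5

theorem greedy_run {m : Mem} (hm : HoldsGroup e S m) (hl : m 17 0 = l) (hh : m 19 0 = h)
    (h24 : m 24 0 = greedyRounds l h E) (h25 : m 25 0 = greedyExponent l E)
    (h26 : m 26 0 = (2 * Fintype.card G ^ 3 : ℕ)) (h35 : ∀ i, m 35 i = 0) :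
    ∃ V : ℕ → G → ℤ, V 0 = 0 ∧
      (∀ t < greedyRounds l h E, IsGreedyStep S l h E t (V t) (V (t + 1))) ∧
      ∀ s, greedy.run m 4 ((e s : ℕ) : ℤ)
          = l * h * (V (greedyRounds l h E) s + V (greedyRounds l h E) s⁻¹) ∧
        greedy.run m 5 ((e s : ℕ) : ℤ) = 2 * greedyRounds l h E := by
  obtain ⟨h31, h34⟩ := preconditioner_run hm h24 h26
  have hf1 := run_eq_of_writes (p := preconditioner) m
    (l := [6, 7, 8, 17, 19, 24, 25, 35]) (by decide)
  rw [greedy, run, run]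
  generalize preconditioner.run m = m1 at *
  have H1 : HoldsParameters e S l h E m1 :=
    { toHoldsGroup := hm.congr fun a ha => hf1 a (by
        simp only [List.mem_cons, List.not_mem_nil, or_false] at ha ⊢; tauto)
      l_eq := by rw [hf1 17 (by decide), hl]
      h_eq := by rw [hf1 19 (by decide), hh]
      rounds_eq := by rw [hf1 24 (by decide), h24]
      exponent_eq := by rw [hf1 25 (by decide), h25]
      preconditioner_eq := h31
      scale_eq := h34 }
  have hloop := loop_induction (c := 28) (e := .var 24) (p := greedyRound) (m := m1)
    (n := greedyRounds l h E) (by simp [Expr.eval, Expr.var, H1.rounds_eq])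
    (fun t m' => ∃ V : ℕ → G → ℤ, V 0 = 0 ∧
      (∀ t' < t, IsGreedyStep S l h E t' (V t') (V (t' + 1))) ∧
      ∀ g, m' 35 ((e g : ℕ) : ℤ) = V t g)
    ⟨fun _ => 0, rfl, by simp, fun g => by
      rw [Mem.set_of_ne _ _ _ (by norm_num), hf1 35 (by decide), h35]; rfl⟩ (by
      rintro t - m2 hf h28 ⟨V, hV0, hV1, hV2⟩
      have hf' : ∀ a ∈ [6, 7, 8, 17, 19, 24, 25, 31, 34], m2 a = m1 a := by
        intro a ha
        have := List.all_eq_true.1 (by decide : ([6, 7, 8, 17, 19, 24, 25, 31, 34].all fun a =>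
          !(28 :: greedyRound.writes).contains a) = true) a ha
        simp only [Bool.not_eq_true', List.contains_eq_mem, decide_eq_false_iff_not,
          List.mem_cons, not_or] at this
        exact hf a this.1 this.2
      obtain ⟨V', hV', hV'2⟩ := greedyRound_run (H1.congr hf') hV2 h28
      -- Only the current multiplicities are in memory, so the history is extended by the new round
      -- at index t + 1 (later values do not matter).
      refine ⟨fun t' => if t' ≤ t then V t' else V', by simp [hV0], ?_, ?_⟩
      · intro t' ht'
        rcases Nat.lt_succ_iff_lt_or_eq.1 ht' with h | rfl
        · simpa [h.le, Nat.succ_le_of_lt h] using hV1 t' h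
        · simpa using hV'
      · intro g
        rw [Mem.set_of_ne _ _ _ (by norm_num), hV'2]
        simp)
  obtain ⟨V, hV0, hV1, hV2⟩ := hloop
  have hf2 := run_eq_of_writes (p := loop 28 (.var 24) greedyRound) m1
    (l := [6, 7, 8, 17, 19, 24, 25, 31, 34]) (by decide)
  exact ⟨V, hV0, hV1, writeWeights_run (H1.congr hf2) hV2⟩

end LoopProg

end Correctness

/-! ### The choice of parameters and the correctness of the algorithm. -/

section Correctness

set_option linter.unusedSectionVars false

open Matrix LoopProg

theorem sub_one_mul_log_two_lt {r X : ℕ} (hr : r ≠ 0) (h : ∀ i < r, 2 ^ i < X) :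
    ((r : ℝ) - 1) * Real.log 2 < Real.log X := by
  have h1 := h (r - 1) (by omega)
  have h2 : ((2 : ℝ) ^ (r - 1)) < X := by exact_mod_cast h1
  have h3 := Real.log_lt_log (by positivity) h2
  rw [Real.log_pow, Nat.cast_sub (Nat.one_le_iff_ne_zero.2 hr), Nat.cast_one] at h3
  exact h3

theorem le_logOne (x : ℝ) : Real.log x ≤ logOne x := le_max_right _ _

theorem one_le_logOne (x : ℝ) : 1 ≤ logOne x := le_max_left _ _

/-- Minimality of the binary logarithm a of 2n gives a ≤ 2 + log n / log 2, and rounding a up to a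
power of two loses at most another factor 2. -/
theorem natCast_le_logOne_of_two_pow_lt {n a r : ℕ} (hn : 0 < n) (ha : ∀ i < a, 2 ^ i < 2 * n)
    (hr : ∀ i < r, 2 ^ i < a) : ((2 ^ r : ℕ) : ℝ) ≤ 8 * logOne n := by
  have hlog := Real.log_two_gt_d9
  have h1 := one_le_logOne n
  have hn' : (0 : ℝ) < n := by exact_mod_cast hn
  rcases Nat.eq_zero_or_pos r with rfl | hr0
  · norm_num; linarith
  have h2 : 2 ^ r < 2 * a := by
    have := hr (r - 1) (by omega)
    calc 2 ^ r = 2 * 2 ^ (r - 1) := by rw [← pow_succ']; congr 1; omega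
      _ < _ := by omega
  have h2' : ((2 ^ r : ℕ) : ℝ) < 2 * a := by exact_mod_cast h2
  have ha0 : a ≠ 0 := by rintro rfl; simp at h2
  have h3 := sub_one_mul_log_two_lt ha0 ha
  rw [Nat.cast_mul, Nat.cast_ofNat, Real.log_mul (by norm_num) hn'.ne'] at h3
  have h4 := le_logOne n
  have h5 : ((a : ℝ) - 2) * 0.69 ≤ logOne n := by
    rcases le_total (a : ℝ) 2 with h | h
    · nlinarith
    · nlinarith
  linarith

/-- For n ≥ 2 one has n + 2 ≤ 2n, which reduces to the logarithm of n; for n < 2 the exponent is at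
most 2 and `logOne` is at least 1. -/
theorem natCast_le_logOne_of_two_pow_lt_add_two {n r : ℕ} (hr : ∀ i < r, 2 ^ i < n + 2) :
    (r : ℝ) ≤ 4 * logOne n := by
  have hlog := Real.log_two_gt_d9
  have h1 := one_le_logOne n
  rcases Nat.lt_or_ge n 2 with hn | hn
  · have h2 : r ≤ 2 := by
      by_contra h
      have := hr 2 (by omega)
      omega
    have : (r : ℝ) ≤ 2 := by exact_mod_cast h2
    linarith
  · rcases Nat.eq_zero_or_pos r with rfl | hr0
    · norm_num; linarith
    have hn' : (0 : ℝ) < n := by exact_mod_cast (by omega : 0 < n)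
    have h3 := sub_one_mul_log_two_lt (X := 2 * n) hr0.ne' fun i hi => (hr i hi).trans_le (by omega)
    rw [Nat.cast_mul, Nat.cast_ofNat, Real.log_mul (by norm_num) hn'.ne'] at h3
    have h4 := le_logOne n
    have h5 : ((r : ℝ) - 2) * 0.69 ≤ logOne n := by
      rcases le_total (r : ℝ) 2 with h | h
      · nlinarith
      · nlinarith
    linarith

variable {G : Type u} [Group G] [Fintype G] [DecidableEq G] {e : G ≃ Fin (Fintype.card G)}
  {S : Finset G}

namespace LoopProg

theorem search_run_of_le {A T : ℕ} {x : Expr} {m : Mem} {n X : ℕ}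
    (hA : A ≠ 6 ∧ A ≠ 12 ∧ A ≠ 16) (hT : T ≠ 6 ∧ T ≠ 12 ∧ T ≠ 16) (hAT : A ≠ T) (hN : m 6 0 = n)
    (hX : X ≤ 2 ^ (n + 1))
    (hx : ∀ m' : Mem, (∀ a, a ≠ A → a ≠ T → a ≠ 12 → a ≠ 16 → m' a = m a) →
      x.eval m' = X - m' T 0) :
    ∃ r ≤ n + 1, (search A T x).run m A 0 = (r : ℤ) ∧ (search A T x).run m T 0 = ((2 ^ r : ℕ) : ℤ)
      ∧ X ≤ 2 ^ r ∧ ∀ i < r, 2 ^ i < X := by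
  obtain ⟨r, hr, h1, h2, h3, h4⟩ := search_run (x := x) (fun r => 2 ^ r < X) hA hT hAT hN (by
    intro r _ m' hf _ hT'
    have : x.eval m' = X - ((2 ^ r : ℕ) : ℤ) := by rw [hx m' hf, hT']; push_cast; rfl
    rw [this]
    omega)
  refine ⟨r, hr, h1, by rw [h2]; push_cast; rfl, ?_, h3⟩
  rcases h4 with rfl | h4
  · exact hX
  · exact not_lt.1 h4

/-- The properties of the parameters of the greedy algorithm. -/
structure GoodParameters (S : Finset G) (ε : ℝ) (l h E : ℕ) : Prop where
  two_mul_card_le : 2 * Fintype.card G ≤ 2 ^ l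
  isPow : ∃ q, l = 2 ^ q
  l_le : l ≤ 4 * Fintype.card G
  l_le_log : (l : ℝ) ≤ 8 * logOne (Fintype.card G)
  card_lt : S.card < 2 ^ h
  h_pos : 0 < h
  h_le : h ≤ 2 * Fintype.card G
  h_le_log : (h : ℝ) ≤ 4 * logOne S.card
  isPow' : ∃ q, E = 2 ^ q
  mul_le : (E : ℝ) * ε ≤ 2
  le_mul : E ≤ Fintype.card G → 1 ≤ (E : ℝ) * ε

theorem parameters_run {m : Mem} {ε : ℝ} (hm : HoldsGroup e S m)
    (h9 : ∀ i ≤ Fintype.card G, m 9 (i : ℤ) = ⌊2 ^ i * ε⌋) (h13 : m 13 0 = 0) (hε : 0 < ε)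
    (hε1 : ε < 1) :
    ∃ l h E : ℕ, parameters.run m 17 0 = l ∧ parameters.run m 19 0 = h ∧
      parameters.run m 21 0 = E ∧ GoodParameters S ε l h E := by
  have hn : 0 < Fintype.card G := Fintype.card_pos
  rw [parameters, run, run, run, run]
  have hcount := loop_induction (c := 12) (e := .var 6) (m := m) (n := Fintype.card G)
    (p := assign 13 (.const 0) (.add (.var 13) (.get 8 (.var 12))))
    (by simp [Expr.eval, Expr.var, hm.order])
    (fun j m' => m' 13 0 = ∑ i ∈ Finset.range j, finsetIndicator ℤ S (element e i))
    (by rw [Mem.set_of_ne _ _ _ (by norm_num), h13]; simp) (by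
      intro j hj m' hf h12 hI
      have h8 : m' 8 (j : ℤ) = finsetIndicator ℤ S (element e j) := by
        rw [hf 8 (by norm_num) (by decide), ← hm.gens, apply_element_of_lt e hj]
      rw [Mem.set_of_ne _ _ _ (by norm_num), Finset.sum_range_succ]
      simp only [run, Expr.eval, Expr.var, h12, hI, h8, Mem.set_same])
  have hcard : ∑ i ∈ Finset.range (Fintype.card G), finsetIndicator ℤ S (element e i)
      = (S.card : ℤ) := by
    rw [sum_range_element e fun g => finsetIndicator ℤ S g]
    simp [finsetIndicator]
  rw [hcard] at hcount
  have hf1 := run_eq_of_writes (p := loop 12 (.var 6)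
    (assign 13 (.const 0) (.add (.var 13) (.get 8 (.var 12))))) m (l := [6, 9]) (by decide)
  generalize (loop 12 _ _).run m = m1 at *
  have h61 : m1 6 0 = Fintype.card G := by rw [hf1 6 (by decide), hm.order]
  have hpow : Fintype.card G + 1 ≤ 2 ^ Fintype.card G := Nat.lt_two_pow_self
  have hpow' : 2 ^ (Fintype.card G + 1) = 2 * 2 ^ Fintype.card G := pow_succ' _ _
  obtain ⟨a, ha, h14, -, ha1, ha2⟩ := search_run_of_le (A := 14) (T := 15) (m := m1)
    (x := .sub (.mul (.const 2) (.var 6)) (.var 15)) (X := 2 * Fintype.card G)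
    (by norm_num) (by norm_num) (by norm_num) h61 (by omega) (by
      intro m' hf
      simp (disch := decide) only [Expr.eval, Expr.var, hf, h61]
      push_cast
      rfl)
  have hf2 := run_eq_of_writes (p := search 14 15 (.sub (.mul (.const 2) (.var 6)) (.var 15))) m1
    (l := [6, 9, 13]) (by decide)
  generalize (search 14 15 _).run m1 = m2 at *
  have h62 : m2 6 0 = Fintype.card G := by rw [hf2 6 (by decide), h61]
  obtain ⟨r, hr, -, h17, hr1, hr2⟩ := search_run_of_le (A := 18) (T := 17) (m := m2)
    (x := .sub (.var 14) (.var 17)) (X := a)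
    (by norm_num) (by norm_num) (by norm_num) h62 (by omega) (by
      intro m' hf
      simp (disch := decide) only [Expr.eval, Expr.var, hf, h14])
  have hf3 := run_eq_of_writes (p := search 18 17 (.sub (.var 14) (.var 17))) m2
    (l := [6, 9, 13]) (by decide)
  generalize (search 18 17 _).run m2 = m3 at *
  have h63 : m3 6 0 = Fintype.card G := by rw [hf3 6 (by decide), h62]
  have h133 : m3 13 0 = S.card := by rw [hf3 13 (by decide), hf2 13 (by decide), hcount]
  have hScard : S.card ≤ Fintype.card G := Finset.card_le_univ S
  -- Searching for |S| + 2 instead of |S| + 1 forces h ≥ 1 even when S is empty.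
  obtain ⟨h, hh, h19, -, hh1, hh2⟩ := search_run_of_le (A := 19) (T := 20) (m := m3)
    (x := .sub (.add (.var 13) (.const 2)) (.var 20)) (X := S.card + 2)
    (by norm_num) (by norm_num) (by norm_num) h63 (by omega) (by
      intro m' hf
      simp (disch := decide) only [Expr.eval, Expr.var, hf, h133]
      push_cast
      rfl)
  have hf4 := run_eq_of_writes (p := search 19 20 (.sub (.add (.var 13) (.const 2)) (.var 20))) m3
    (l := [6, 9, 17]) (by decide)
  generalize (search 19 20 _).run m3 = m4 at *
  have h64 : m4 6 0 = Fintype.card G := by rw [hf4 6 (by decide), h63]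
  have h94 : ∀ i ≤ Fintype.card G, m4 9 (i : ℤ) = ⌊2 ^ i * ε⌋ := by
    rw [hf4 9 (by decide), hf3 9 (by decide), hf2 9 (by decide), hf1 9 (by decide)]; exact h9
  obtain ⟨q, hq, -, h21, hq1, hq2⟩ := search_run (A := 23) (T := 21) (m := m4)
    (x := .sub (.const 1) (.get 9 (.var 23))) (n := Fintype.card G)
    (fun q => (2 : ℝ) ^ q * ε < 1) (by norm_num) (by norm_num) (by norm_num) h64 (by
      intro q hq m' hf h23 _
      simp (disch := decide) only [Expr.eval, Expr.var, hf, h23, h94 q hq]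
      have h1 : (0 : ℤ) < 1 - ⌊(2 : ℝ) ^ q * ε⌋ ↔ ⌊(2 : ℝ) ^ q * ε⌋ < 1 := by omega
      rw [h1, Int.floor_lt, Int.cast_one])
  have hf5 := run_eq_of_writes (p := search 23 21 (.sub (.const 1) (.get 9 (.var 23)))) m4
    (l := [17, 19]) (by decide)
  generalize (search 23 21 _).run m4 = m5 at *
  have ha0 : a ≠ 0 := by rintro rfl; simp at ha1; omega
  refine ⟨2 ^ r, h, 2 ^ q, ?_, ?_, ?_, ?_⟩
  · rw [hf5 17 (by decide), hf4 17 (by decide), h17]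
  · rw [hf5 19 (by decide), h19]
  · rw [h21]; push_cast; rfl
  · have hr3 : 2 ^ r ≤ 2 * a := by
      rcases Nat.eq_zero_or_pos r with rfl | hr0
      · rw [pow_zero]; omega
      · have := hr2 (r - 1) (by omega)
        calc 2 ^ r = 2 * 2 ^ (r - 1) := by rw [← pow_succ']; congr 1; omega
          _ ≤ _ := by omega
    exact
    { two_mul_card_le := ha1.trans (Nat.pow_le_pow_right (by norm_num) hr1)
      isPow := ⟨r, rfl⟩
      l_le := by omega
      l_le_log := natCast_le_logOne_of_two_pow_lt hn ha2 hr2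
      card_lt := by omega
      h_pos := by rcases Nat.eq_zero_or_pos h with rfl | h0; · simp at hh1
                  · exact h0
      h_le := by omega
      h_le_log := natCast_le_logOne_of_two_pow_lt_add_two hh2
      isPow' := ⟨q, rfl⟩
      mul_le := by
        push_cast
        rcases Nat.eq_zero_or_pos q with rfl | hq0
        · rw [pow_zero]; linarith
        · have := hq1 (q - 1) (by omega)
          have h2 : (2 : ℝ) ^ q = 2 * 2 ^ (q - 1) := by rw [← pow_succ']; congr 1; omega
          rw [h2]; linarith
      le_mul := by
        intro hE
        -- A search that ran out of passes ends with E = 2^(N+1), which is larger than N.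
        rcases hq2 with rfl | hq2
        · omega
        · push_cast; exact not_lt.1 hq2 }

/-- Rounding l and E to powers of two makes p = 32lE a power of two, as the Lieb–Thirring inequality
requires. -/
theorem GoodParameters.isGreedyParam {ε : ℝ} {l h E : ℕ} (H : GoodParameters S ε l h E) :
    IsGreedyParam S l h E where
  card_le := H.two_mul_card_le
  card_lt := H.card_lt
  pos := by obtain ⟨q, rfl⟩ := H.isPow'; positivity
  exponent := by
    obtain ⟨q, hq⟩ := H.isPow
    obtain ⟨q', hq'⟩ := H.isPow'
    exact ⟨5 + q + q', by rw [greedyExponent, hq, hq', pow_add, pow_add]; norm_num⟩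

theorem sparsify_run {m : Mem} {ε : ℝ} (hm : HoldsGroup e S m)
    (h9 : ∀ i ≤ Fintype.card G, m 9 (i : ℤ) = ⌊2 ^ i * ε⌋) (h13 : m 13 0 = 0)
    (h35 : ∀ i, m 35 i = 0) (hS : ∀ s ∈ S, s⁻¹ ∈ S)
    (hgen : Subgroup.closure (S : Set G) = ⊤) (hε : 0 < ε) (hε1 : ε < 1) :
    ∃ μ : S → ℝ≥0, IsOutput e S μ (sparsify.run m) ∧
      IsCayleySparsifier sparsifierConstant S ε μ := by
  obtain ⟨l, h, E, h17, h19, h21, H⟩ := parameters_run hm h9 h13 hε hε1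
  have hf1 := run_eq_of_writes (p := parameters) m (l := [6, 7, 8, 35]) (by decide)
  rw [sparsify, run]
  generalize parameters.run m = m1 at *
  have hm1 : HoldsGroup e S m1 := hm.congr fun a ha => hf1 a (by
    simp only [List.mem_cons, List.not_mem_nil, or_false] at ha ⊢; tauto)
  rw [run]
  simp only [Expr.eval, Expr.var, h21, hm1.order]
  split_ifs with hlt
  -- Here N < E, so Nε ≤ Eε ≤ 2 and the trivial weights meet the size bound. In the other case E ≤
  -- N, and the search for E has succeeded.
  · refine ⟨1, fun s => ?_, isCayleySparsifier_one hS hε ?_⟩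
    · obtain ⟨h1, h2⟩ := writeOnes_run (e := e) hm1.order (s : G)
      rw [h1, h2]
      simp
    · have : (Fintype.card G : ℝ) ≤ E := by
        exact_mod_cast (by omega : Fintype.card G ≤ E)
      exact (mul_le_mul_of_nonneg_right this hε.le).trans H.mul_le
  · rw [run]
    have e24 : iterations.run m1 24 0 = greedyRounds l h E := by
      simp [iterations, run, Expr.eval, Expr.var, Mem.set, h17, h19, h21, greedyRounds]
      ring
    have e25 : iterations.run m1 25 0 = greedyExponent l E := by
      simp [iterations, run, Expr.eval, Expr.var, Mem.set, h17, h21, greedyExponent]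
    have e26 : iterations.run m1 26 0 = (2 * Fintype.card G ^ 3 : ℕ) := by
      simp [iterations, run, Expr.eval, Expr.var, Mem.set, hm1.order]
      ring
    have hf2 := run_eq_of_writes (p := iterations) m1 (l := [6, 7, 8, 35, 17, 19]) (by decide)
    generalize iterations.run m1 = m2 at *
    obtain ⟨V, hV0, hV1, hV2⟩ := greedy_run (e := e) (m := m2) (l := l) (h := h) (E := E)
      (hm1.congr fun a ha => hf2 a (by
        simp only [List.mem_cons, List.not_mem_nil, or_false] at ha ⊢; tauto))
      (by rw [hf2 17 (by decide), h17]) (by rw [hf2 19 (by decide), h19]) e24 e25 e26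
      (by rw [hf2 35 (by decide), hf1 35 (by decide)]; exact h35)
    have hP := H.isGreedyParam
    have hK := hP.rounds_pos H.h_pos
    refine ⟨greedyWeight S l h E (V (greedyRounds l h E)), fun s => ?_,
      isCayleySparsifier_greedy hP H.h_pos hε H.l_le_log H.h_le_log H.mul_le (H.le_mul (by omega))
        hS hgen V hV0 hV1⟩
    obtain ⟨h4, h5⟩ := hV2 s
    obtain ⟨hnn, -, -⟩ := greedy_support V hV0 hV1 _ le_rfl
    rw [h4, h5]
    refine ⟨by positivity, ?_⟩
    have h1 : (0 : ℤ) ≤ l * h * (V (greedyRounds l h E) s + V (greedyRounds l h E) (s : G)⁻¹) :=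
      mul_nonneg (by positivity) (add_nonneg (hnn _) (hnn _))
    have h2 : (0 : ℝ) ≤ ((l * h * (V (greedyRounds l h E) s
        + V (greedyRounds l h E) (s : G)⁻¹) : ℤ) : ℝ) := by exact_mod_cast h1
    exact Real.coe_toNNReal _ (div_nonneg h2 (by positivity))

end LoopProg

end Correctness

section Correctness

set_option linter.unusedSectionVars false

open Matrix LoopProg

variable {G : Type u} [Group G] [Fintype G] [DecidableEq G] {e : G ≃ Fin (Fintype.card G)}
  {S : Finset G}

/-! ## Running time -/

theorem Expr.cost_congr {m m' : Mem} (e : Expr) (h : ∀ a ∈ e.reads, m a = m' a) :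
    e.cost m = e.cost m' := by
  induction e with
  | const n => rfl
  | get a i ih =>
    simp only [Expr.reads, List.mem_cons, forall_eq_or_imp] at h
    simp only [Expr.cost, ih h.2, h.1, Expr.eval_congr i h.2]
  | add x y ihx ihy | sub x y ihx ihy | mul x y ihx ihy | div x y ihx ihy =>
    simp only [Expr.reads, List.mem_append] at h
    have hx := fun a ha => h a (Or.inl ha)
    have hy := fun a ha => h a (Or.inr ha)
    simp only [Expr.cost, ihx hx, ihy hy, Expr.eval_congr x hx, Expr.eval_congr y hy]

namespace LoopProg

theorem copy_run {a b n : ℕ} {x : Expr} {m : Mem} (ha : a ≠ 10) (hb : b ≠ 10) (hab : a ≠ b)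
    (hn : x.eval m = n) : (∀ i < n, (copy a b x).run m b (i : ℕ) = m a i) ∧
      (∀ z, (copy a b x).run m b z = m b z ∨ ∃ i < n, (copy a b x).run m b z = m a (i : ℕ)) ∧
      ∀ z, (copy a b x).run m 10 z = m 10 z ∨ ∃ i ≤ n, (copy a b x).run m 10 z = (i : ℕ) := by
  refine loop_induction hn (fun j m' => (∀ i < j, m' b (i : ℕ) = m a i) ∧
    (∀ z, m' b z = m b z ∨ ∃ i < n, m' b z = m a (i : ℕ)) ∧
    ∀ z, m' 10 z = m 10 z ∨ ∃ i ≤ n, m' 10 z = (i : ℕ)) ?_ ?_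
  · rw [Mem.set_of_ne _ _ _ hb]
    refine ⟨by simp, fun z => Or.inl rfl, fun z => ?_⟩
    rw [Mem.set_apply]
    split_ifs
    · exact Or.inr ⟨0, Nat.zero_le n, rfl⟩
    · exact Or.inl rfl
  · rintro j hj m' hf h10 ⟨h1, h2, h3⟩
    have haj : m' a = m a := hf a ha (by simpa [writes] using hab)
    rw [Mem.set_of_ne _ _ _ hb]
    simp only [run, Expr.eval, Expr.var, h10, haj, Mem.set_apply, Mem.set_of_ne _ _ _ hb.symm]
    refine ⟨fun i hi => ?_, fun z => ?_, fun z => ?_⟩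
    · split_ifs with hij
      · rw [hij]
      · exact h1 i (lt_of_le_of_ne (Nat.lt_succ_iff.1 hi) fun h => hij (by rw [h]))
    · split_ifs with hz
      · exact Or.inr ⟨j, hj, rfl⟩
      · exact h2 z
    · split_ifs with hz
      · exact Or.inr ⟨j + 1, hj, by push_cast; rfl⟩
      · exact h3 z

theorem copy_run_of_ne {a b : ℕ} (x : Expr) (m : Mem) {c : ℕ} (h10 : c ≠ 10) (hb : c ≠ b) :
    (copy a b x).run m c = m c :=
  run_of_notMem_writes _ m (by simp [copy, writes, h10, hb])

theorem copy_natAbs_le {a b n W : ℕ} {x : Expr} {m : Mem} (ha : a ≠ 10) (hb : b ≠ 10) (hab : a ≠ b)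
    (hn : x.eval m = n) (hnW : n ≤ 2 ^ W) (hval : ∀ i < n, (m a (i : ℕ)).natAbs ≤ 2 ^ W)
    (hm : ∀ c, 4 ≤ c → ∀ i, (m c i).natAbs ≤ 2 ^ W) (c : ℕ) (hc : 4 ≤ c) (i : ℤ) :
    ((copy a b x).run m c i).natAbs ≤ 2 ^ W := by
  obtain ⟨-, h2, h3⟩ := copy_run ha hb hab hn
  by_cases hcb : c = b
  · subst hcb
    rcases h2 i with h | ⟨j, hj, h⟩
    · rw [h]; exact hm c hc i
    · rw [h]; exact hval j hj
  by_cases hc10 : c = 10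
  · subst hc10
    rcases h3 i with h | ⟨j, hj, h⟩
    · rw [h]; exact hm 10 hc i
    · rw [h, Int.natAbs_natCast]; exact hj.trans hnW
  rw [copy_run_of_ne x m hc10 hcb]
  exact hm c hc i

/-- Copying is estimated by hand: input arrays may hold arbitrarily large numbers outside the copied
range, so the level analysis, which bounds whole arrays, does not apply to them. -/
theorem copy_cost_le {a b n W : ℕ} {x : Expr} {m : Mem} (ha : a ≠ 10) (hb : b ≠ 10) (hab : a ≠ b)
    (hx : ∀ c ∈ x.reads, c ≠ 10 ∧ c ≠ b) (hn : x.eval m = n) (hnW : n ≤ 2 ^ W)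
    (hval : ∀ i < n, (m a (i : ℕ)).natAbs ≤ 2 ^ W) (hcost : x.cost m ≤ 5 * (W + 2)) :
    (copy a b x).cost m ≤ (n + 1) * (20 * (W + 2)) := by
  have hn' : (x.eval m).toNat = n := by rw [hn]; exact Int.toNat_natCast n
  have hbit : ∀ z : ℤ, z.natAbs ≤ 2 ^ W → bitLength z ≤ W + 2 := fun z =>
    bitLength_le_of_natAbs_le
  have h0 : bitLength 0 = 1 := by simp [bitLength]
  have h1 : bitLength 1 = 2 := by simp [bitLength]
  rw [copy, cost, hn']
  set p := assign b (.var 10) (.get a (.var 10)) with hp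
  have hc : ∀ j, loopState p.run 10 m j 10 0 = j := loopState_counter p.run 10 m
  have hsa : ∀ j, loopState p.run 10 m j a = m a := fun j =>
    loopState_of_notMem p 10 m j ha (by simpa [hp, writes] using hab)
  have hsx : ∀ j, ∀ c ∈ x.reads, loopState p.run 10 m j c = m c := fun j c hcx =>
    loopState_of_notMem p 10 m j (hx c hcx).1 (by simpa [hp, writes] using (hx c hcx).2)
  have hxc : ∀ j, x.cost (loopState p.run 10 m j) = x.cost m := fun j =>
    Expr.cost_congr x (hsx j)
  have hxe : ∀ j, x.eval (loopState p.run 10 m j) = n := fun j => by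
    rw [Expr.eval_congr x (hsx j), hn]
  have hp10 : ∀ j, p.run (loopState p.run 10 m j) 10 0 = j := fun j => by
    rw [run_of_notMem_writes p _ (by simpa [hp, writes] using hb.symm), hc]
  have hsum : ∀ j ∈ Finset.range n,
      (Expr.sub x (.var 10)).cost (loopState p.run 10 m j)
            + (p.cost (loopState p.run 10 m j) +
              ((Expr.const 0).cost (p.run (loopState p.run 10 m j)) +
                (Expr.add (.var 10) (.const 1)).cost (p.run (loopState p.run 10 m j))))
        ≤ 20 * (W + 2) := by
    intro j hj
    have hj' := Finset.mem_range.1 hj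
    have b1 := hbit (j : ℤ) (by rw [Int.natAbs_natCast]; omega)
    have b2 := hbit ((j : ℤ) + 1) (by omega)
    have b3 := hbit ((n : ℤ) - j) (by omega)
    have b4 := hbit _ (hval j hj')
    rw [hp, cost, ← hp]
    simp only [Expr.cost, Expr.var, Expr.eval, hc, hsa, hxc, hxe, hp10, h0, h1]
    omega
  have hsum' := Finset.sum_le_card_nsmul _ _ _ hsum
  rw [Finset.card_range, smul_eq_mul] at hsum'
  have b1 := hbit (n : ℤ) (by rwa [Int.natAbs_natCast])
  have hend : (Expr.sub x (.var 10)).cost (loopState p.run 10 m n) ≤ 7 * (W + 2) + 1 := by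
    simp only [Expr.cost, Expr.var, Expr.eval, hc, hxc, hxe, sub_self, h0]
    omega
  have hst : (Expr.const 0).cost m = 1 := h0
  rw [hst, add_mul, one_mul]
  omega

/-- After copying, all working arrays are bounded by 2^(2N): the truncations of ε are read only up
to index N, and counters up to N² fit as well. This bound starts the level analysis. -/
theorem copyInput_run {m : Mem} {ε : ℝ} (hm : IsInput e S ε m) (hε : 0 < ε) (hε1 : ε < 1) :
    HoldsGroup e S (copyInput.run m) ∧
      (∀ i ≤ Fintype.card G, copyInput.run m 9 (i : ℤ) = ⌊2 ^ i * ε⌋) ∧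
      (∀ a, 4 ≤ a → ∀ i, (copyInput.run m a i).natAbs ≤ 2 ^ (2 * Fintype.card G)) ∧
      copyInput.run m 13 0 = 0 ∧ (∀ i, copyInput.run m 35 i = 0) ∧
      copyInput.cost m ≤ 1000 * Fintype.card G ^ 3 := by
  have hn : 0 < Fintype.card G := Fintype.card_pos
  set W := 2 * Fintype.card G with hW
  have hNlt : Fintype.card G + 1 ≤ 2 ^ Fintype.card G := Nat.lt_two_pow_self
  have hpow : 2 ^ W = 2 ^ Fintype.card G * 2 ^ Fintype.card G := by rw [hW, two_mul, pow_add]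
  have hWN : 2 ^ Fintype.card G ≤ 2 ^ W := by rw [hpow]; exact Nat.le_mul_of_pos_right _ (by positivity)
  have hWN2 : Fintype.card G * Fintype.card G ≤ 2 ^ W := by
    rw [hpow]; exact Nat.mul_le_mul (by omega) (by omega)
  have h0 : bitLength 0 = 1 := by simp [bitLength]
  have h1 : bitLength 1 = 2 := by simp [bitLength]
  have hbN : bitLength (Fintype.card G) ≤ W + 2 :=
    bitLength_le_of_natAbs_le (by rw [Int.natAbs_natCast]; omega)
  have hbN1 : bitLength ((Fintype.card G : ℤ) + 1) ≤ W + 2 :=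
    bitLength_le_of_natAbs_le (by omega)
  have hbN2 : bitLength ((Fintype.card G : ℤ) * Fintype.card G) ≤ W + 2 :=
    bitLength_le_of_natAbs_le (by rw [← Nat.cast_mul, Int.natAbs_natCast]; omega)
  have hdecomp : ∀ i < Fintype.card G * Fintype.card G, ∃ g h : G,
      (i : ℤ) = ((e g : ℕ) : ℤ) * Fintype.card G + ((e h : ℕ) : ℤ) := by
    intro i hi
    refine ⟨element e (i / Fintype.card G), element e (i % Fintype.card G), ?_⟩
    rw [apply_element_of_lt e (Nat.div_lt_of_lt_mul hi),
      apply_element_of_lt e (Nat.mod_lt _ hn)]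
    exact_mod_cast (Nat.div_add_mod' i (Fintype.card G)).symm
  have v1 : ∀ i < Fintype.card G * Fintype.card G, (m 1 (i : ℕ)).natAbs ≤ 2 ^ W := by
    intro i hi
    obtain ⟨g, h, hgh⟩ := hdecomp i hi
    rw [hgh, hm.table, Int.natAbs_natCast]
    exact (e (g * h)).2.le.trans (by omega)
  have v2 : ∀ i < Fintype.card G, (m 2 (i : ℕ)).natAbs ≤ 2 ^ W := by
    intro i hi
    have := hm.gens (element e i)
    rw [apply_element_of_lt e hi] at this
    rw [this]
    have := Nat.one_le_two_pow (n := W)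
    split_ifs <;> simp
    exact this
  have v3 : ∀ i < Fintype.card G + 1, (m 3 (i : ℕ)).natAbs ≤ 2 ^ W := by
    intro i hi
    rw [hm.eps]
    have h2 : 0 ≤ ⌊(2 : ℝ) ^ i * ε⌋ := Int.floor_nonneg.2 (by positivity)
    have h3 : ⌊(2 : ℝ) ^ i * ε⌋ ≤ ((2 ^ i : ℕ) : ℤ) := by
      refine Int.floor_le_iff.2 ?_
      push_cast
      nlinarith [pow_pos (two_pos : (0 : ℝ) < 2) i]
    have h4 : 2 ^ i ≤ 2 ^ Fintype.card G := Nat.pow_le_pow_right (by norm_num) (by omega)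
    omega
  have c0 : (assign 6 (.const 0) (.get 0 (.const 0))).cost m ≤ 3 * (W + 2) := by
    simp only [cost, Expr.cost, Expr.eval, hm.order, h0]
    omega
  have h6 : (assign 6 (.const 0) (.get 0 (.const 0))).run m 6 0 = Fintype.card G := by
    simp only [run, Expr.eval, Mem.set_same, hm.order]
  have hf0 := fun a (ha : a ≠ 6) => run_of_notMem_writes (assign 6 (.const 0) (.get 0 (.const 0))) m
    (a := a) (by simpa [writes] using ha)
  have b0 : ∀ a, 4 ≤ a → ∀ i,
      ((assign 6 (.const 0) (.get 0 (.const 0))).run m a i).natAbs ≤ 2 ^ W := by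
    intro a ha i
    simp only [run, Expr.eval, hm.order, Mem.set]
    split_ifs
    · rw [Int.natAbs_natCast]; omega
    · rw [hm.blank a ha]; simp
  have hrun : copyInput.run m = (copy 3 9 (.add (.var 6) (.const 1))).run
      ((copy 2 8 (.var 6)).run ((copy 1 7 (.mul (.var 6) (.var 6))).run
      ((assign 6 (.const 0) (.get 0 (.const 0))).run m))) := rfl
  have hcost : copyInput.cost m = (assign 6 (.const 0) (.get 0 (.const 0))).cost m +
      ((copy 1 7 (.mul (.var 6) (.var 6))).cost
        ((assign 6 (.const 0) (.get 0 (.const 0))).run m) +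
      ((copy 2 8 (.var 6)).cost ((copy 1 7 (.mul (.var 6) (.var 6))).run
        ((assign 6 (.const 0) (.get 0 (.const 0))).run m)) +
      (copy 3 9 (.add (.var 6) (.const 1))).cost ((copy 2 8 (.var 6)).run
        ((copy 1 7 (.mul (.var 6) (.var 6))).run
        ((assign 6 (.const 0) (.get 0 (.const 0))).run m))))) := rfl
  rw [hrun, hcost]
  clear hrun hcost
  generalize (assign 6 (.const 0) (.get 0 (.const 0))).run m = m1 at *
  have e1 : (Expr.mul (.var 6) (.var 6)).eval m1 = (Fintype.card G * Fintype.card G : ℕ) := by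
    simp [Expr.eval, Expr.var, h6]
  have w1 : ∀ i < Fintype.card G * Fintype.card G, (m1 1 (i : ℕ)).natAbs ≤ 2 ^ W := by
    rw [hf0 1 (by norm_num)]; exact v1
  have c1 := copy_cost_le (a := 1) (b := 7) (by norm_num) (by norm_num) (by norm_num)
    (by simp [Expr.reads, Expr.var]) e1 hWN2 w1 (by
      simp only [Expr.cost, Expr.eval, Expr.var, h6, h0]
      omega)
  obtain ⟨r1, -, -⟩ := copy_run (a := 1) (b := 7) (by norm_num) (by norm_num) (by norm_num) e1
  have b1 := copy_natAbs_le (a := 1) (b := 7) (by norm_num) (by norm_num) (by norm_num) e1 hWN2 w1 b0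
  have f1 := fun c h10 hb => copy_run_of_ne (a := 1) (b := 7) (.mul (.var 6) (.var 6)) m1 (c := c)
    h10 hb
  generalize (copy 1 7 _).run m1 = m2 at *
  have h62 : m2 6 0 = Fintype.card G := by rw [f1 6 (by norm_num) (by norm_num), h6]
  have e2 : (Expr.var 6).eval m2 = Fintype.card G := by simp [Expr.eval, Expr.var, h62]
  have w2 : ∀ i < Fintype.card G, (m2 2 (i : ℕ)).natAbs ≤ 2 ^ W := by
    rw [f1 2 (by norm_num) (by norm_num), hf0 2 (by norm_num)]; exact v2
  have c2 := copy_cost_le (a := 2) (b := 8) (by norm_num) (by norm_num) (by norm_num)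
    (by simp [Expr.reads, Expr.var]) e2 (by omega) w2 (by
      simp only [Expr.cost, Expr.eval, Expr.var, h62, h0]
      omega)
  obtain ⟨r2, -, -⟩ := copy_run (a := 2) (b := 8) (by norm_num) (by norm_num) (by norm_num) e2
  have b2 := copy_natAbs_le (a := 2) (b := 8) (by norm_num) (by norm_num) (by norm_num) e2 (by omega)
    w2 b1
  have f2 := fun c h10 hb => copy_run_of_ne (a := 2) (b := 8) (.var 6) m2 (c := c) h10 hb
  generalize (copy 2 8 _).run m2 = m3 at *
  have h63 : m3 6 0 = Fintype.card G := by rw [f2 6 (by norm_num) (by norm_num), h62]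
  have e3 : (Expr.add (.var 6) (.const 1)).eval m3 = (Fintype.card G + 1 : ℕ) := by
    simp [Expr.eval, Expr.var, h63]
  have w3 : ∀ i < Fintype.card G + 1, (m3 3 (i : ℕ)).natAbs ≤ 2 ^ W := by
    rw [f2 3 (by norm_num) (by norm_num), f1 3 (by norm_num) (by norm_num), hf0 3 (by norm_num)]
    exact v3
  have c3 := copy_cost_le (a := 3) (b := 9) (by norm_num) (by norm_num) (by norm_num)
    (by simp [Expr.reads, Expr.var]) e3 (by omega) w3 (by
      simp only [Expr.cost, Expr.eval, Expr.var, h63, h0, h1]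
      omega)
  obtain ⟨r3, -, -⟩ := copy_run (a := 3) (b := 9) (by norm_num) (by norm_num) (by norm_num) e3
  have b3 := copy_natAbs_le (a := 3) (b := 9) (by norm_num) (by norm_num) (by norm_num) e3 (by omega)
    w3 b2
  have f3 := fun c h10 hb => copy_run_of_ne (a := 3) (b := 9) (.add (.var 6) (.const 1)) m3 (c := c)
    h10 hb
  generalize (copy 3 9 _).run m3 = m4 at *
  refine ⟨⟨?_, ?_, ?_⟩, ?_, b3, ?_, ?_, ?_⟩
  · rw [f3 6 (by norm_num) (by norm_num), h63]
  · intro g h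
    have hlt : (e g : ℕ) * Fintype.card G + e h < Fintype.card G * Fintype.card G := by
      have h2 := (e g).2
      have h3 := (e h).2
      nlinarith
    have h2 := r1 _ hlt
    rw [f3 7 (by norm_num) (by norm_num), f2 7 (by norm_num) (by norm_num)]
    push_cast at h2
    rw [h2, hf0 1 (by norm_num), hm.table]
  · intro g
    rw [f3 8 (by norm_num) (by norm_num), r2 _ (e g).2, f1 2 (by norm_num) (by norm_num),
      hf0 2 (by norm_num), hm.gens, finsetIndicator]
  · intro i hi
    rw [r3 i (by omega), f2 3 (by norm_num) (by norm_num), f1 3 (by norm_num) (by norm_num),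
      hf0 3 (by norm_num), hm.eps]
  · rw [f3 13 (by norm_num) (by norm_num), f2 13 (by norm_num) (by norm_num),
      f1 13 (by norm_num) (by norm_num), hf0 13 (by norm_num), hm.blank 13 (by norm_num)]
  · intro i
    rw [f3 35 (by norm_num) (by norm_num), f2 35 (by norm_num) (by norm_num),
      f1 35 (by norm_num) (by norm_num), hf0 35 (by norm_num), hm.blank 35 (by norm_num)]
  · refine (Nat.add_le_add c0 (Nat.add_le_add c1 (Nat.add_le_add c2 c3))).trans ?_
    rw [hW]
    have q1 : 1 * 1 ≤ Fintype.card G * Fintype.card G := Nat.mul_le_mul hn hn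
    have q2 : Fintype.card G * 1 ≤ Fintype.card G * Fintype.card G := Nat.mul_le_mul_left _ hn
    have q3 : Fintype.card G * Fintype.card G * 1 ≤ Fintype.card G * Fintype.card G * Fintype.card G :=
      Nat.mul_le_mul_left _ hn
    have q4 : Fintype.card G ^ 3 = Fintype.card G * Fintype.card G * Fintype.card G := by ring
    rw [q4]
    ring_nf at q1 q2 q3 ⊢
    omega

end LoopProg

end Correctness

/-! ### Polynomial running time of the whole program. -/

section Correctness

set_option linter.unusedSectionVars false

open Matrix LoopProg

variable {G : Type u} [Group G] [Fintype G] [DecidableEq G] {e : G ≃ Fin (Fintype.card G)}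
  {S : Finset G}

namespace LoopProg

theorem steps_le_of_boundsFixed {A d : ℕ} {p : LoopProg} (hp : p.boundsFixed = true)
    (hd : p.depth ≤ d) {m : Mem} (hA : ∀ x ∈ p.loopBounds, x.eval m ≤ A) :
    p.steps m ≤ p.length * (A + 2) ^ d := by
  refine (steps_le p m (fun x hx a ha => ?_) hA).trans
    (Nat.mul_le_mul_left _ (Nat.pow_le_pow_right (by omega) hd))
  have h1 := List.all_eq_true.1 (List.all_eq_true.1 hp x hx) a ha
  simpa using h1

theorem boundsFixed_writeOnes : writeOnes.boundsFixed = true := by decide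

/-- In the greedy branch E ≤ N, l ≤ 4N and h ≤ 2N, so all loop bounds are at most 2¹⁹N⁶, and loops
nest at most six deep. The phases are counted separately because the bounds of the greedy loops are
computed by the earlier phases. The 4 counts the branching test and the three assignments of
`iterations`. -/
theorem steps_sparsify_le {m : Mem} {ε : ℝ} (hm : HoldsGroup e S m)
    (h9 : ∀ i ≤ Fintype.card G, m 9 (i : ℤ) = ⌊2 ^ i * ε⌋) (h13 : m 13 0 = 0)
    (hε : 0 < ε) (hε1 : ε < 1) :
    sparsify.steps m ≤ (parameters.length + 4 + writeOnes.length + greedy.length)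
      * (2 ^ 19 * Fintype.card G ^ 6 + 2) ^ 6 := by
  have hn : 0 < Fintype.card G := Fintype.card_pos
  set A := 2 ^ 19 * Fintype.card G ^ 6 with hA
  obtain ⟨l, h, E, h17, h19, h21, H⟩ := parameters_run hm h9 h13 hε hε1
  have hf1 := run_eq_of_writes (p := parameters) m (l := [6]) (by decide)
  have hpow : ∀ k ≤ 6, Fintype.card G ^ k ≤ Fintype.card G ^ 6 := fun k hk =>
    Nat.pow_le_pow_right hn hk
  have hone := hpow 0 (by norm_num)
  have hp1 := hpow 1 (by norm_num)
  have hp2 := hpow 2 (by norm_num)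
  have hp3 := hpow 3 (by norm_num)
  rw [pow_zero] at hone
  rw [pow_one] at hp1
  have s1 : parameters.steps m ≤ parameters.length * (A + 2) ^ 6 := by
    refine steps_le_of_boundsFixed boundsFixed_parameters (by decide) ?_
    simp only [parameters, search, loopBounds, List.cons_append, List.nil_append, List.append_nil,
      List.mem_cons, List.not_mem_nil, or_false, forall_eq_or_imp, forall_eq, Expr.eval, Expr.var,
      hm.order]
    omega
  rw [sparsify, steps, steps]
  generalize parameters.run m = m1 at *
  have h61 : m1 6 0 = Fintype.card G := by rw [hf1 6 (by decide), hm.order]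
  have hX : 1 ≤ (A + 2) ^ 6 := Nat.one_le_pow _ _ (by omega)
  have s2 : (if 0 < (Expr.sub (.var 21) (.var 6)).eval m1 then writeOnes.steps m1
      else (seq iterations greedy).steps m1) ≤ 3 + (writeOnes.length * (A + 2) ^ 6
        + greedy.length * (A + 2) ^ 6) := by
    simp only [Expr.eval, Expr.var, h21, h61]
    split_ifs with hlt
    · have : writeOnes.steps m1 ≤ writeOnes.length * (A + 2) ^ 6 := by
        refine steps_le_of_boundsFixed boundsFixed_writeOnes (by decide) ?_
        simp only [writeOnes, store, tab, loopBounds, List.cons_append, List.nil_append,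
          List.mem_cons, List.not_mem_nil, or_false, forall_eq_or_imp, forall_eq, Expr.eval,
          Expr.var, h61]
        omega
      omega
    · have hE : E ≤ Fintype.card G := by omega
      rw [steps]
      have s3 : iterations.steps m1 = 3 := rfl
      have e24 : iterations.run m1 24 0 = greedyRounds l h E := by
        simp [iterations, run, Expr.eval, Expr.var, Mem.set, h17, h19, h21, greedyRounds]
        ring
      have e25 : iterations.run m1 25 0 = greedyExponent l E := by
        simp [iterations, run, Expr.eval, Expr.var, Mem.set, h17, h21, greedyExponent]
      have e26 : iterations.run m1 26 0 = (2 * Fintype.card G ^ 3 : ℕ) := by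
        simp [iterations, run, Expr.eval, Expr.var, Mem.set, h61]
        ring
      have e6 : iterations.run m1 6 0 = Fintype.card G := by
        rw [run_eq_of_writes (p := iterations) m1 (l := [6]) (by decide) 6 (by decide), h61]
      generalize iterations.run m1 = m2 at *
      have hK : greedyRounds l h E ≤ A := by
        calc greedyRounds l h E ≤ 4096 * (4 * Fintype.card G) ^ 3 * (2 * Fintype.card G)
              * Fintype.card G ^ 2 := by
              rw [greedyRounds]
              gcongr
              · exact H.l_le
              · exact H.h_le
          _ = A := by rw [hA]; ring
      have hp : greedyExponent l E ≤ A := by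
        calc greedyExponent l E ≤ 32 * (4 * Fintype.card G) * Fintype.card G := by
              rw [greedyExponent]
              gcongr
              exact H.l_le
          _ = 128 * Fintype.card G ^ 2 := by ring
          _ ≤ A := by omega
      have hN2 : (Fintype.card G : ℤ) * (Fintype.card G + 1) ≤ A := by
        have h1 : Fintype.card G * (Fintype.card G + 1) = Fintype.card G ^ 2 + Fintype.card G := by
          ring
        have h2 : Fintype.card G * (Fintype.card G + 1) ≤ A := by omega
        exact_mod_cast h2
      have : greedy.steps m2 ≤ greedy.length * (A + 2) ^ 6 := by
        refine steps_le_of_boundsFixed boundsFixed_greedy (by decide) ?_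
        simp only [greedy, preconditioner, preconditionerStep, greedyRound, candidatePotential,
          improve, decode, powerTrace, writeWeights, store, tab, loopBounds, List.cons_append,
          List.nil_append, List.append_nil, List.mem_cons, List.not_mem_nil, or_false,
          forall_eq_or_imp, forall_eq, Expr.eval, Expr.var, e24, e25, e26, e6]
        omega
      omega
  rw [add_mul, add_mul, add_mul]
  omega

/-- The program for the sparsification of Cayley graphs. -/
def cayleySparsifier : LoopProg := seq copyInput sparsify

theorem cayleySparsifier_run {m : Mem} {ε : ℝ} (hm : IsInput e S ε m) (hS : ∀ s ∈ S, s⁻¹ ∈ S)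
    (hgen : Subgroup.closure (S : Set G) = ⊤) (hε : 0 < ε) (hε1 : ε < 1) :
    ∃ μ : S → ℝ≥0, IsOutput e S μ (cayleySparsifier.run m) ∧
      IsCayleySparsifier sparsifierConstant S ε μ := by
  obtain ⟨h1, h2, -, h3, h4, -⟩ := copyInput_run hm hε hε1
  exact sparsify_run h1 h2 h3 h4 hS hgen hε hε1

theorem exists_cayleySparsifier_cost_le : ∃ c d : ℕ, ∀ (G : Type u) [Group G] [Fintype G]
    [DecidableEq G] (e : G ≃ Fin (Fintype.card G)) (S : Finset G) (m : Mem) (ε : ℝ),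
    IsInput e S ε m → 0 < ε → ε < 1 → cayleySparsifier.cost m ≤ c * Fintype.card G ^ d := by
  obtain ⟨L, hL⟩ : ∃ L, L = (parameters.length + 4 + writeOnes.length + greedy.length)
    * (2 ^ 20) ^ 6 := ⟨_, rfl⟩
  obtain ⟨σ, hσ⟩ : ∃ σ, σ = sparsify.size := ⟨_, rfl⟩
  -- The steps are at most L n^36. The level analysis runs with y of order n^36, so an expression
  -- costs order y⁵ = n^180, and the total has degree 36 + 180 = 216.
  refine ⟨1000 + L * (2 * (σ * (σ * (2 + L * σ) ^ 5 + 2))), 216, ?_⟩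
  intro G _ _ _ e S m ε hm hε hε1
  obtain ⟨h1, h2, h3, h4, -, h5⟩ := copyInput_run hm hε hε1
  have hn : 0 < Fintype.card G := Fintype.card_pos
  have hsteps := steps_sparsify_le h1 h2 h4 hε hε1
  have hcost : cayleySparsifier.cost m = copyInput.cost m + sparsify.cost (copyInput.run m) := rfl
  rw [hcost]
  generalize copyInput.run m = m1 at *
  clear hm h1 h2 hcost e
  generalize Fintype.card G = n at *
  have hpow : ∀ {j k : ℕ}, j ≤ k → n ^ j ≤ n ^ k := fun h => Nat.pow_le_pow_right hn h
  have hsteps' : sparsify.steps m1 ≤ L * n ^ 36 := by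
    refine hsteps.trans ?_
    rw [hL, mul_assoc]
    refine Nat.mul_le_mul_left _ ?_
    calc (2 ^ 19 * n ^ 6 + 2) ^ 6 ≤ (2 ^ 20 * n ^ 6) ^ 6 := by
          refine Nat.pow_le_pow_left ?_ 6
          have := Nat.one_le_pow 6 n hn
          omega
      _ = (2 ^ 20) ^ 6 * n ^ 36 := by rw [mul_pow, ← pow_mul n]
  set y := (2 + L * σ) * n ^ 36 with hy
  have hy1 : 1 ≤ y := by
    have := Nat.one_le_pow 36 n hn
    rw [hy]
    nlinarith [Nat.zero_le (L * σ)]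
  have hbound : 2 * n + (0 + sparsify.steps m1) * σ ≤ y := by
    calc 2 * n + (0 + sparsify.steps m1) * σ ≤ 2 * n ^ 36 + L * n ^ 36 * σ := by
          rw [zero_add]
          refine Nat.add_le_add (Nat.mul_le_mul_left _ ?_) (Nat.mul_le_mul_right _ hsteps')
          calc n = n ^ 1 := (pow_one n).symm
            _ ≤ n ^ 36 := hpow (by norm_num)
      _ = y := by rw [hy]; ring
  have hlev : LevelBound arrayLevel 4 (2 * n) σ y 0 m1 := by
    intro a ha _ i
    refine (h3 a ha i).trans (Nat.pow_le_pow_right (by norm_num) ?_)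
    rw [zero_mul, add_zero]
    exact Nat.le_mul_of_pos_right _ (Nat.one_le_pow _ _ hy1)
  have hc := (cost_le_of_leveled hy1 sparsify wellFormed_sparsify leveled_sparsify hσ.ge m1 0 hlev
    hbound).2
  have hQ : σ * (σ * y ^ (4 + 1) + 2) ≤ σ * (σ * (2 + L * σ) ^ 5 + 2) * n ^ 180 := by
    have h1 := Nat.one_le_pow 180 n hn
    have h2 : y ^ (4 + 1) = (2 + L * σ) ^ 5 * n ^ 180 := by rw [hy, mul_pow, ← pow_mul]
    rw [h2, mul_assoc σ (_ + _)]
    refine Nat.mul_le_mul_left _ ?_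
    rw [add_mul, mul_assoc]
    omega
  calc copyInput.cost m + sparsify.cost m1
      ≤ 1000 * n ^ 216 + L * n ^ 36 * (2 * (σ * (σ * (2 + L * σ) ^ 5 + 2) * n ^ 180)) := by
        refine Nat.add_le_add (h5.trans (Nat.mul_le_mul_left _ (hpow (by norm_num)))) ?_
        exact hc.trans (Nat.mul_le_mul hsteps' (Nat.mul_le_mul_left _ hQ))
    _ = _ := by ring

end LoopProg

/-- A memory that holds a given input. -/
theorem exists_isInput (e : G ≃ Fin (Fintype.card G)) (S : Finset G) (ε : ℝ) :
    ∃ m : Mem, IsInput e S ε m := by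
  have hn : 0 < Fintype.card G := Fintype.card_pos
  refine ⟨fun a i => match a with
    | 0 => Fintype.card G
    | 1 => (e (element e (i.toNat / Fintype.card G) * element e (i.toNat % Fintype.card G)) : ℕ)
    | 2 => if element e i.toNat ∈ S then 1 else 0
    | 3 => ⌊2 ^ i.toNat * ε⌋
    | _ => 0, rfl, fun g h => ?_, fun g => ?_, fun i => ?_, fun a ha i => ?_⟩
  · have h1 : ((((e g : ℕ) : ℤ) * Fintype.card G + ((e h : ℕ) : ℤ))).toNat
        = (e g : ℕ) * Fintype.card G + (e h : ℕ) := by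
      rw [← Nat.cast_mul, ← Nat.cast_add, Int.toNat_natCast]
    simp only [h1]
    rw [mul_comm, Nat.mul_add_div hn, Nat.div_eq_of_lt (e h).2, add_zero, Nat.mul_add_mod,
      Nat.mod_eq_of_lt (e h).2, element_apply, element_apply]
  · simp only [Int.toNat_natCast, element_apply]
  · simp only [Int.toNat_natCast]
  · match a, ha with
    | _ + 4, _ => rfl

theorem isProbabilityMeasure_coinMeasure : IsProbabilityMeasure coinMeasure := by
  unfold coinMeasure
  infer_instance

end Correctness

theorem mainTheorem3 :
    ∃ C : ℝ, 0 < C ∧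
      (∀ (G : Type u) [Group G] [Fintype G] [DecidableEq G] (S : Finset G) (ε : ℝ),
        (∀ s ∈ S, s⁻¹ ∈ S) → Subgroup.closure (S : Set G) = ⊤ → 0 < ε → ε < 1 →
        ∃ μ : S → ℝ≥0, IsCayleySparsifier C S ε μ) ∧
      (∃ (P : Prog) (c d : ℕ),
        ∀ (G : Type u) [Group G] [Fintype G] [DecidableEq G] (S : Finset G) (ε : ℝ),
          (∀ s ∈ S, s⁻¹ ∈ S) → Subgroup.closure (S : Set G) = ⊤ → 0 < ε → ε < 1 →
          ∀ (e : G ≃ Fin (Fintype.card G)) (m : Mem), IsInput e S ε m →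
            (∀ ω : ℕ → Bool, ∃ (m' : Mem) (k t : ℕ),
              Exec ω P m 0 m' k t ∧ t ≤ c * Fintype.card G ^ d) ∧
            1 - Real.exp (-(Fintype.card G : ℝ)) ≤
              coinMeasure.real {ω : ℕ → Bool | ∃ (m' : Mem) (k t : ℕ) (μ : S → ℝ≥0),
                Exec ω P m 0 m' k t ∧ IsOutput e S μ m' ∧ IsCayleySparsifier C S ε μ}) := by
  refine ⟨sparsifierConstant, by norm_num [sparsifierConstant], ?_, ?_⟩
  · intro G _ _ _ S ε hS hgen hε hε1
    -- Existence is read off from the output of the program on a memory that holds the input for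
    -- some numbering of G.
    obtain ⟨m, hm⟩ := exists_isInput (Fintype.equivFin G) S ε
    obtain ⟨μ, -, hμ⟩ := LoopProg.cayleySparsifier_run hm hS hgen hε hε1
    exact ⟨μ, hμ⟩
  · obtain ⟨c, d, hcd⟩ := LoopProg.exists_cayleySparsifier_cost_le.{u}
    refine ⟨LoopProg.cayleySparsifier.compile, c, d, ?_⟩
    intro G _ _ _ S ε hS hgen hε hε1 e m hm
    have hexec : ∀ ω, Exec ω LoopProg.cayleySparsifier.compile m 0
        (LoopProg.cayleySparsifier.run m) 0 (LoopProg.cayleySparsifier.cost m) := fun ω =>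
      LoopProg.exec_compile _ (by decide) ω m 0
    obtain ⟨μ, hμ1, hμ2⟩ := LoopProg.cayleySparsifier_run hm hS hgen hε hε1
    refine ⟨fun ω => ⟨_, _, _, hexec ω, hcd G e S m ε hm hε hε1⟩, ?_⟩
    -- No coin is tossed, so one and the same run succeeds for every outcome and the event has
    -- probability 1.
    have huniv : {ω : ℕ → Bool | ∃ (m' : Mem) (k t : ℕ) (μ : S → ℝ≥0),
        Exec ω LoopProg.cayleySparsifier.compile m 0 m' k t ∧ IsOutput e S μ m' ∧
          IsCayleySparsifier sparsifierConstant S ε μ} = Set.univ :=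
      Set.eq_univ_of_forall fun ω => ⟨_, _, _, μ, hexec ω, hμ1, hμ2⟩
    have := isProbabilityMeasure_coinMeasure
    rw [huniv, probReal_univ]
    linarith [Real.exp_pos (-(Fintype.card G : ℝ))]
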